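/- Let $M$ be a compact connected Hausdorff topological $2$-manifold with nonempty boundary $\partial M$ (for example a closed topological disk). A convex body in $\mathbf{R}^3$ is a compact convex set with interior points. Let $f\colon M\to\mathbf{R}^3$ be a locally convex immersion, i.e., a continuous map such that each point of $M$ has a neighborhood which $f$ maps injectively into the boundary of some convex body. Assume that $f$ is locally nonflat along $\partial M$ (no point of $\partial M$ has a neighborhood $U$ in $M$ such that $f(U)$ lies in a plane), and that $f|_{\partial M}$ is a regular $\mathcal{C}^2$ curve without inflections (near each point $\partial M$ has a local parametrization along which $f$ is twice continuously differentiable with nonvanishing first derivative, and the curvature of $f|_{\partial M}$ vanishes nowhere). A nondegenerate cap in $\mathbf{R}^3$ is a set $C$ homeomorphic to a closed disk which lies on the boundary of a convex body and meets some plane $H$ precisely along its boundary circle $\partial C$. A degenerate cap in $\mathbf{R}^3$ is a nonempty compact convex subset of a plane. A closed connected nonempty set $C\subset M$ is a cap if (i) $f$ is injective on $C$ and $f(C)$ is a (degenerate or nondegenerate) cap in $\mathbf{R}^3$, and (ii) if $f(C)$ is degenerate, then there exist a plane $H$ containing $f(C)$, a closed half-space $H^+$ bounded by $H$, and a neighborhood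 $U$ of $C$ in $M$ such that $f(U\setminus C)\cap H^+=\emptyset$. Let $C_1\subset C_2\subset\cdots$ be a nested sequence of caps in $M$. Then the closure of $\bigcup_i C_i$ in $M$ is also a cap. -/

import Mathlib

namespace ConvexCaps

/-- Euclidean 3-space. -/
abbrev E3 : Type := EuclideanSpace ℝ (Fin 3)

/-- The closed unit disk in the Euclidean plane. -/
abbrev UnitDisk : Type := Metric.closedBall (0 : EuclideanSpace ℝ (Fin 2)) 1

/-- The plane `{x | ⟪n, x⟫ = c}`; only used with `n ≠ 0`. -/
def plane (n : E3) (c : ℝ) : Set E3 := {x | inner ℝ n x = c}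

/-- The closed half-space `{x | c ≤ ⟪n, x⟫}` bounded by `plane n c`; the other side of that plane
is `halfSpace (-n) (-c)`. -/
def halfSpace (n : E3) (c : ℝ) : Set E3 := {x | c ≤ inner ℝ n x}

/-- A convex body in the strict sense: compact, convex, with nonempty interior. -/
def IsSolidBody (K : Set E3) : Prop :=
  Convex ℝ K ∧ IsCompact K ∧ (interior K).Nonempty

/-- A nondegenerate cap in space: a topological disk `C`, embedded in the boundary of a convex
body, which meets some plane precisely along the boundary circle of the disk. -/
def IsNondegenerateCap (C : Set E3) : Prop :=
  ∃ (K : Set E3) (n : E3) (c : ℝ) (h : UnitDisk → E3),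
    IsSolidBody K ∧ n ≠ 0 ∧ Topology.IsEmbedding h ∧ Set.range h = C ∧
      C ⊆ frontier K ∧ C ∩ plane n c = h '' {z | ‖(z : EuclideanSpace ℝ (Fin 2))‖ = 1}

/-- A degenerate cap in space: a nonempty compact convex subset of a plane
(a point, a line segment, or a convex planar disk). -/
def IsDegenerateCap (C : Set E3) : Prop :=
  C.Nonempty ∧ IsCompact C ∧ Convex ℝ C ∧ ∃ (n : E3) (c : ℝ), n ≠ 0 ∧ C ⊆ plane n c

section Surface

variable {M : Type*} [TopologicalSpace M]

/-- `C ⊆ M` is a cap of `f : M → ℝ³`. -/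
def IsCap (f : M → E3) (C : Set M) : Prop :=
  IsClosed C ∧ IsConnected C ∧ Set.InjOn f C ∧
    (IsNondegenerateCap (f '' C) ∨ IsDegenerateCap (f '' C)) ∧
    (IsDegenerateCap (f '' C) →
      ∃ (n : E3) (c : ℝ) (U : Set M), n ≠ 0 ∧ f '' C ⊆ plane n c ∧
        IsOpen U ∧ C ⊆ U ∧ Disjoint (f '' (U \ C)) (halfSpace n c))

/-- A locally convex immersion: continuous, and every point has a neighborhood which `f` maps
injectively into the boundary of a convex body. -/
def IsLocallyConvexImmersion (f : M → E3) : Prop :=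
  Continuous f ∧ ∀ p : M, ∃ U ∈ nhds p, Set.InjOn f U ∧
    ∃ K : Set E3, IsSolidBody K ∧ f '' U ⊆ frontier K

variable [ChartedSpace (EuclideanHalfSpace 2) M]

variable (M) in
/-- The manifold boundary of the surface `M`. -/
abbrev bdry : Set M := (modelWithCornersEuclideanHalfSpace 2).boundary M

/-- No boundary point has a neighborhood that `f` maps into a plane. -/
def IsLocallyNonflatAlongBoundary (f : M → E3) : Prop :=
  ∀ p ∈ bdry M, ∀ U ∈ nhds p, ∀ (n : E3) (c : ℝ), n ≠ 0 → ¬ f '' U ⊆ plane n c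

/-- The curve `t ↦ f (e t)` obtained from a local parametrization `e` of `∂M`. -/
def boundaryCurve (f : M → E3) (e : OpenPartialHomeomorph ℝ (bdry M)) : ℝ → E3 :=
  fun t => f (e t : M)

/-- `e` is a local parametrization of `∂M` (a homeomorphism from an open subset of `ℝ` onto an
open subset of `∂M`) along which `f` is `k` times continuously differentiable with nonvanishing
derivative. -/
def IsRegularParametrization (k : ℕ) (f : M → E3)
    (e : OpenPartialHomeomorph ℝ (bdry M)) : Prop :=
  ContDiffOn ℝ k (boundaryCurve f e) e.source ∧
    ∀ t ∈ e.source, deriv (boundaryCurve f e) t ≠ 0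

/-- `f` restricted to `∂M` is a regular curve of class `C^k`: around each boundary point there is
a local parametrization as above. Any two of these differ by a `C^k` change of parameter (pass to
arc length), so they make up the differentiable structure of `∂M`. -/
def IsRegularOnBoundary (k : ℕ) (f : M → E3) : Prop :=
  ∀ p : bdry M, ∃ e : OpenPartialHomeomorph ℝ (bdry M),
    p ∈ e.target ∧ IsRegularParametrization k f e

/-- `f` restricted to `∂M` has no inflections: its curvature vanishes nowhere, that is, the first
two derivatives are linearly independent at every parameter. -/
def HasNoInflections (f : M → E3) : Prop :=
  ∀ e : OpenPartialHomeomorph ℝ (bdry M), IsRegularParametrization 2 f e →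
    ∀ t ∈ e.source, LinearIndependent ℝ
      ![deriv (boundaryCurve f e) t, deriv (deriv (boundaryCurve f e)) t]

end Surface

end ConvexCaps

namespace ConvexCaps

open Set Filter Topology Metric

/-! Suppose first that all the caps are degenerate. The direction spaces of the sets `f '' C i`
stabilize at some index N, so later caps map into the plane of `C N`. Condition (ii) for `C N` and
connectedness then stop any growth, and the sequence is eventually constant.

Otherwise all caps from some index on are nondegenerate. Their images lie on the boundary of one
convex body K, the closure of the union of their convex hulls. Each image lies between the open part
of ∂K beyond a plane H_i and the closure of that part (`IsNondegenerateCap.structure`). A limit of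
the planes H_i is a supporting plane of K, with face F. The part of K beyond none of the H_i is a
closed convex set B inside F, and inverting f on the caps gives a continuous lift of ∂K \ B to M
whose image has the same closure as the union of the caps. Three cases remain.

If B has no interior in ∂K, the closure of the lift is mapped bijectively onto ∂K. By invariance of
domain that closure is open in M, hence all of M, and M could have no boundary point
(`not_isLift_of_thin`).

If B = F has interior, radial projection from a relative interior point of F shows that the closure
of ∂K \ F is a nondegenerate cap (`isNondegenerateCap_of_face`). Injectivity passes to the closure
of the lift, because ∂K \ B is connected at small scales near the points of B
(`uniqueFiber_of_connectedAt`). This is the desired conclusion.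

If B has interior but is smaller than F, nestedness makes F \ B convex, so B is cut off from F by a
line. The lift always extends a little past such a cut (`CutFace.exists_extension`): at an endpoint
of the cutting segment the local convex body must contain F nearby, and this property spreads along
the segment. Boundary points of M over the segment are excluded by nonflatness in the relative
interior of F, and by regularity of the boundary curve at the endpoints. Sweeping the line across F
to the infimum of the admissible levels contradicts this extension or ends in the first case, so
this case does not occur. -/

/-! ### Invariance of domain in dimension two, by continuous logarithms -/

/-- A continuous logarithm propagates along a homotopy of nowhere vanishing functions. -/
theorem exists_log_of_homotopy {X : Type*} [TopologicalSpace X] (H : unitInterval × X → ℂ)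
    (hH : Continuous H) (h0 : ∀ z, H z ≠ 0)
    (hL : ∃ L : X → ℂ, Continuous L ∧ ∀ x, Complex.exp (L x) = H (0, x)) :
    ∃ L : X → ℂ, Continuous L ∧ ∀ x, Complex.exp (L x) = H (1, x) := by
  obtain ⟨L, hLc, hL⟩ := hL
  let H' : C(unitInterval × X, {z : ℂ // z ≠ 0}) := ⟨fun z => ⟨H z, h0 z⟩, by fun_prop⟩
  have key : ∀ a, H' (0, a) = (fun z : ℂ ↦ (⟨_, z.exp_ne_zero⟩ : {z : ℂ // z ≠ 0}))
      ((⟨L, hLc⟩ : C(X, ℂ)) a) := fun a => Subtype.ext (hL a).symm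
  let G := Complex.isCoveringMap_exp.liftHomotopy H' ⟨L, hLc⟩ key
  refine ⟨fun x => G (1, x), by fun_prop, fun x => ?_⟩
  have := congrFun (Complex.isCoveringMap_exp.liftHomotopy_lifts H' ⟨L, hLc⟩ key) (1, x)
  exact congrArg Subtype.val this

/-- An odd nowhere vanishing function on the circle has no continuous logarithm. -/
theorem not_exists_log_of_odd (g : sphere (0 : ℂ) 1 → ℂ)
    (hodd : ∀ x, g (-x) = -g x) :
    ¬ ∃ L : sphere (0 : ℂ) 1 → ℂ, Continuous L ∧ ∀ x, Complex.exp (L x) = g x := by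
  rintro ⟨L, hLc, hL⟩
  -- The increment `L (-x) - L x` is an odd multiple of πi. It varies continuously on the connected
  -- circle, so the multiple is constant; but it changes sign under `x ↦ -x`, which would make it
  -- zero.
  have hd : ∀ x, ∃ k : ℤ, L (-x) - L x = Real.pi * Complex.I + k * (2 * Real.pi * Complex.I) := by
    intro x
    have h1 : Complex.exp (L (-x)) = Complex.exp (L x + Real.pi * Complex.I) := by
      rw [hL, hodd, Complex.exp_add, hL, Complex.exp_pi_mul_I]; ring
    obtain ⟨k, hk⟩ := Complex.exp_eq_exp_iff_exists_int.1 h1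
    exact ⟨k, by rw [hk]; ring⟩
  choose k hk using hd
  have : PreconnectedSpace (sphere (0 : ℂ) 1) := by
    apply isPreconnected_iff_preconnectedSpace.1
    apply isPreconnected_sphere
    rw [Complex.rank_real_complex]; norm_num
  have hkc : Continuous (fun x => (k x : ℝ)) := by
    have : (fun x => (k x : ℝ)) = fun x => ((L (-x) - L x).im / Real.pi - 1) / 2 := by
      ext x
      rw [hk]
      simp
      field_simp
      ring
    rw [this]
    fun_prop
  have hkc' : Continuous k := by
    rw [Int.isClosedEmbedding_coe_real.isEmbedding.continuous_iff]
    exact hkc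
  let e : sphere (0 : ℂ) 1 := ⟨1, by simp⟩
  have hconst : k (-e) = k e :=
    PreconnectedSpace.constant inferInstance hkc'
  have h1 := hk e
  have h2 := hk (-e)
  rw [neg_neg, hconst] at h2
  have h3 : (Real.pi * Complex.I + k e * (2 * Real.pi * Complex.I) : ℂ) = 0 := by
    linear_combination (-1/2 : ℂ) * h1 + (-1/2 : ℂ) * h2
  have h4 : ((1 + 2 * k e : ℤ) : ℂ) * (Real.pi * Complex.I) = 0 := by
    push_cast; linear_combination h3
  rcases mul_eq_zero.1 h4 with h5 | h5
  · have : (1 + 2 * k e : ℤ) = 0 := by exact_mod_cast h5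
    omega
  · simp [Real.pi_ne_zero] at h5

/-- If values q arbitrarily near `f 0` were omitted, `f - q` on the unit circle would have a
logarithm, by contracting the circle inside the disk. Moving q to `f 0` and then deforming by
injectivity gives a logarithm of an odd function on the circle, which is impossible. -/
theorem image_unit_closedBall_mem_nhds (f : ℂ → ℂ) (hf : ContinuousOn f (closedBall 0 1))
    (hinj : InjOn f (closedBall 0 1)) : f '' closedBall 0 1 ∈ 𝓝 (f 0) := by
  have hS : ∀ x : sphere (0 : ℂ) 1, ‖(x : ℂ)‖ = 1 := fun x => by simp
  have h0 : (0 : ℂ) ∈ closedBall (0 : ℂ) 1 := by simp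
  have hxb : ∀ x : sphere (0 : ℂ) 1, (x : ℂ) ∈ closedBall (0 : ℂ) 1 := fun x => by
    simp [hS x]
  have hne : ∀ x : sphere (0 : ℂ) 1, f x ≠ f 0 := fun x h => by
    have := hinj (hxb x) h0 h
    have h1 := hS x
    rw [this] at h1
    simp at h1
  have hfS : Continuous fun x : sphere (0 : ℂ) 1 => f x :=
    hf.comp_continuous continuous_subtype_val hxb
  obtain ⟨x₀, hx₀⟩ : ∃ x₀ : sphere (0 : ℂ) 1, ∀ x : sphere (0 : ℂ) 1, ‖f x₀ - f 0‖ ≤ ‖f x - f 0‖ := by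
    have : Nonempty (sphere (0 : ℂ) 1) := ⟨⟨1, by simp⟩⟩
    obtain ⟨x₀, -, h⟩ := isCompact_univ.exists_isMinOn (univ_nonempty)
      (f := fun x : sphere (0 : ℂ) 1 => ‖f x - f 0‖)
      (hfS.sub continuous_const).norm.continuousOn
    exact ⟨x₀, fun x => h (mem_univ x)⟩
  have hδ : 0 < ‖f x₀ - f 0‖ := norm_pos_iff.2 (sub_ne_zero.2 (hne x₀))
  refine mem_of_superset (ball_mem_nhds _ hδ) fun q hq => ?_
  by_contra hqn
  have hqn' : ∀ z ∈ closedBall (0 : ℂ) 1, f z - q ≠ 0 := fun z hz h =>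
    hqn ⟨z, hz, sub_eq_zero.1 h⟩
  have hscale : ∀ (t : ℝ) (x : sphere (0 : ℂ) 1), |t| ≤ 1 → (t : ℂ) * x ∈ closedBall (0 : ℂ) 1 :=
    fun t x ht => by simpa [hS x] using ht
  -- the image circle has a logarithm with respect to `q`
  obtain hA := exists_log_of_homotopy
    (X := sphere (0 : ℂ) 1) (fun z => f (((z.1 : ℝ) : ℂ) * z.2) - q)
    ((hf.comp_continuous (by fun_prop)
      (fun z => hscale _ _ (by rw [abs_of_nonneg z.1.2.1]; exact z.1.2.2))).sub continuous_const)
    (fun z => hqn' _ (hscale _ _ (by rw [abs_of_nonneg z.1.2.1]; exact z.1.2.2)))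
    ⟨fun _ => Complex.log (f 0 - q), continuous_const, fun x => by
      simp [Complex.exp_log (hqn' 0 h0)]⟩
  -- hence one with respect to `f 0`
  obtain hB := exists_log_of_homotopy
    (X := sphere (0 : ℂ) 1) (fun z => f z.2 - q + ((z.1 : ℝ) : ℂ) * (q - f 0))
    (by have := hfS.comp (continuous_snd (X := unitInterval)); 
        exact (this.sub continuous_const).add (by fun_prop))
    (fun z hz => by
      have h1 : f z.2 - f 0 = (1 - ((z.1 : ℝ) : ℂ)) * (q - f 0) := by linear_combination hz
      have h2 := congrArg norm h1
      rw [norm_mul] at h2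
      have h3 : ‖(1 - ((z.1 : ℝ) : ℂ))‖ ≤ 1 := by
        rw [← Complex.ofReal_one, ← Complex.ofReal_sub, Complex.norm_real, Real.norm_eq_abs,
          abs_le]
        constructor <;> linarith [z.1.2.1, z.1.2.2]
      have h4 : ‖q - f 0‖ < ‖f x₀ - f 0‖ := by rwa [mem_ball, dist_eq_norm] at hq
      have h5 := hx₀ z.2
      nlinarith [norm_nonneg (q - f 0)])
    (by simpa using hA)
  -- The two arguments `x/(1+t)` and `-t x/(1+t)` stay distinct, so injectivity keeps the difference
  -- nonzero. It runs from `f x - f 0` to the odd function `f (x/2) - f (-x/2)`.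
  obtain hC := exists_log_of_homotopy
    (X := sphere (0 : ℂ) 1) (fun z => f (((1 / (1 + (z.1 : ℝ)) : ℝ) : ℂ) * z.2)
      - f (((-((z.1 : ℝ)) / (1 + (z.1 : ℝ)) : ℝ) : ℂ) * z.2))
    (by
      have hpos : ∀ z : unitInterval × sphere (0 : ℂ) 1, (1 + (z.1 : ℝ)) ≠ 0 := fun z => by
        linarith [z.1.2.1]
      refine (hf.comp_continuous ?_ fun z => hscale _ _ ?_).sub
        (hf.comp_continuous ?_ fun z => hscale _ _ ?_)
      · exact (Complex.continuous_ofReal.comp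
          (Continuous.div (by fun_prop) (by fun_prop) hpos)).mul (by fun_prop)
      · have := z.1.2.1
        rw [abs_of_nonneg (by positivity), div_le_one (by linarith)]; linarith
      · exact (Complex.continuous_ofReal.comp
          (Continuous.div (by fun_prop) (by fun_prop) hpos)).mul (by fun_prop)
      · have := z.1.2.1
        rw [neg_div, abs_neg, abs_of_nonneg (by positivity), div_le_one (by linarith)]; linarith)
    (fun z hz => by
      have h1 := z.1.2.1
      have := hinj (hscale _ _ ?_) (hscale _ _ ?_) (sub_eq_zero.1 hz)
      · have h3 := mul_right_cancel₀ (by intro h; have := hS z.2; simp [h] at this) this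
        have h4 : (1 / (1 + (z.1 : ℝ)) : ℝ) = (-((z.1 : ℝ)) / (1 + (z.1 : ℝ)) : ℝ) := by
          exact_mod_cast h3
        rw [div_left_inj' (by linarith)] at h4
        linarith
      · rw [abs_of_nonneg (by positivity), div_le_one (by linarith)]; linarith
      · rw [neg_div, abs_neg, abs_of_nonneg (by positivity), div_le_one (by linarith)]; linarith)
    (by simpa using hB)
  refine not_exists_log_of_odd _ (fun x => ?_) hC
  have e1 : ((1 / (1 + ((1 : unitInterval) : ℝ)) : ℝ) : ℂ) * ((-x : sphere (0 : ℂ) 1) : ℂ) =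
      ((-((1 : unitInterval) : ℝ) / (1 + ((1 : unitInterval) : ℝ)) : ℝ) : ℂ) * x := by
    simp; ring
  have e2 : ((-((1 : unitInterval) : ℝ) / (1 + ((1 : unitInterval) : ℝ)) : ℝ) : ℂ) *
      ((-x : sphere (0 : ℂ) 1) : ℂ) = ((1 / (1 + ((1 : unitInterval) : ℝ)) : ℝ) : ℂ) * x := by
    simp; ring
  simp only [e1, e2, neg_sub]

theorem image_mem_nhds_complex {f : ℂ → ℂ} {U : Set ℂ} {a : ℂ} (hU : U ∈ 𝓝 a)
    (hf : ContinuousOn f U) (hinj : InjOn f U) : f '' U ∈ 𝓝 (f a) := by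
  obtain ⟨r, hr, hrU⟩ := nhds_basis_closedBall.mem_iff.1 hU
  have hmaps : MapsTo (fun z : ℂ => a + r * z) (closedBall 0 1) U := fun z hz => hrU (by
    simp only [mem_closedBall, dist_zero_right] at hz
    simp only [mem_closedBall, dist_self_add_left, norm_mul, Complex.norm_real, Real.norm_eq_abs,
      abs_of_pos hr]
    nlinarith)
  have := image_unit_closedBall_mem_nhds (fun z => f (a + r * z))
    (hf.comp (by fun_prop) hmaps) (hinj.comp (fun z _ w _ h => by
      have h' : (r : ℂ) * z = r * w := add_left_cancel h
      exact mul_left_cancel₀ (by exact_mod_cast hr.ne') h') hmaps)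
  simp only [mul_zero, add_zero] at this
  refine mem_of_superset this ?_
  rintro _ ⟨z, hz, rfl⟩
  exact ⟨_, hmaps hz, rfl⟩

/-- Invariance of domain in dimension two. -/
theorem image_mem_nhds_of_injOn {E F : Type*} [NormedAddCommGroup E] [NormedSpace ℝ E]
    [NormedAddCommGroup F] [NormedSpace ℝ F] (hE : Module.finrank ℝ E = 2)
    (hF : Module.finrank ℝ F = 2) {f : E → F} {U : Set E} {a : E} (hU : U ∈ 𝓝 a)
    (hf : ContinuousOn f U) (hinj : InjOn f U) : f '' U ∈ 𝓝 (f a) := by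
  have : FiniteDimensional ℝ E := .of_finrank_pos (by omega)
  have : FiniteDimensional ℝ F := .of_finrank_pos (by omega)
  let e : E ≃L[ℝ] ℂ := ContinuousLinearEquiv.ofFinrankEq (by rw [hE, Complex.finrank_real_complex])
  let e' : F ≃L[ℝ] ℂ := ContinuousLinearEquiv.ofFinrankEq (by rw [hF, Complex.finrank_real_complex])
  have h1 : e '' U ∈ 𝓝 (e a) := e.toHomeomorph.isOpenMap.image_mem_nhds hU
  have hm : MapsTo e.symm (e '' U) U := by
    rintro _ ⟨x, hx, rfl⟩
    simpa using hx
  have h2 := image_mem_nhds_complex (f := fun z => e' (f (e.symm z))) h1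
    (e'.continuous.comp_continuousOn (hf.comp e.symm.continuous.continuousOn hm))
    (e'.injective.comp_injOn (hinj.comp e.symm.injective.injOn hm))
  have h3 := e'.symm.toHomeomorph.isOpenMap.image_mem_nhds h2
  simp only [ContinuousLinearEquiv.symm_apply_apply] at h3
  have h4 : e'.symm.toHomeomorph (e' (f a)) = f a := e'.symm_apply_apply _
  rw [h4] at h3
  refine mem_of_superset h3 ?_
  rintro _ ⟨_, ⟨_, ⟨x, hx, rfl⟩, rfl⟩, rfl⟩
  exact ⟨x, hx, by simp [ContinuousLinearEquiv.toHomeomorph]⟩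

/-! ### Gauges of convex bodies and central charts of their boundaries -/

theorem IsSolidBody.isClosed {K : Set E3} (hK : IsSolidBody K) : IsClosed K := hK.2.1.isClosed

theorem IsSolidBody.frontier_subset {K : Set E3} (hK : IsSolidBody K) : frontier K ⊆ K :=
  hK.isClosed.frontier_subset

theorem finrank_orthogonal_span {n : E3} (hn : n ≠ 0) : Module.finrank ℝ (ℝ ∙ n)ᗮ = 2 := by
  have : Fact (Module.finrank ℝ E3 = 2 + 1) := ⟨by simp⟩
  exact Submodule.finrank_orthogonal_span_singleton hn

theorem inner_orthogonal_coe {n : E3} (w : (ℝ ∙ n)ᗮ) : inner ℝ n (w : E3) = 0 :=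
  Submodule.mem_orthogonal_singleton_iff_inner_right.1 w.2

/-- The Minkowski gauge of `K` with respect to the center `x₀`. -/
noncomputable def bodyGauge (K : Set E3) (x₀ v : E3) : ℝ := gauge ((fun y => y - x₀) '' K) v

section gauge

variable {K : Set E3} {x₀ : E3}

theorem image_sub_mem_nhds (hx₀ : x₀ ∈ interior K) : (fun y => y - x₀) '' K ∈ 𝓝 (0 : E3) := by
  have h := (Homeomorph.subRight x₀).isOpenMap.image_mem_nhds (mem_interior_iff_mem_nhds.1 hx₀)
  simpa using h

theorem convex_image_sub (hK : IsSolidBody K) : Convex ℝ ((fun y => y - x₀) '' K) := by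
  have := hK.1.translate (-x₀)
  simpa [sub_eq_neg_add] using this

theorem continuous_bodyGauge (hK : IsSolidBody K) (hx₀ : x₀ ∈ interior K) :
    Continuous (bodyGauge K x₀) :=
  continuous_gauge (convex_image_sub hK) (image_sub_mem_nhds hx₀)

theorem bodyGauge_pos (hK : IsSolidBody K) (hx₀ : x₀ ∈ interior K) {v : E3} (hv : v ≠ 0) :
    0 < bodyGauge K x₀ v := by
  refine (gauge_pos (absorbent_nhds_zero (image_sub_mem_nhds hx₀)) ?_).2 hv
  exact NormedSpace.isVonNBounded_of_isBounded _
    (hK.2.1.image (continuous_id.sub continuous_const)).isBounded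

theorem bodyGauge_smul {t : ℝ} (ht : 0 ≤ t) (v : E3) :
    bodyGauge K x₀ (t • v) = t * bodyGauge K x₀ v := by
  simp [bodyGauge, gauge_smul_of_nonneg ht]

theorem bodyGauge_add_le (hK : IsSolidBody K) (hx₀ : x₀ ∈ interior K) (v w : E3) :
    bodyGauge K x₀ (v + w) ≤ bodyGauge K x₀ v + bodyGauge K x₀ w :=
  gauge_add_le (convex_image_sub hK) (absorbent_nhds_zero (image_sub_mem_nhds hx₀)) v w

theorem mem_frontier_iff_bodyGauge (hK : IsSolidBody K) (hx₀ : x₀ ∈ interior K) {y : E3} :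
    y ∈ frontier K ↔ bodyGauge K x₀ (y - x₀) = 1 := by
  rw [bodyGauge, gauge_eq_one_iff_mem_frontier (convex_image_sub hK) (image_sub_mem_nhds hx₀)]
  have h : (fun y => y - x₀) '' K = (Homeomorph.subRight x₀) '' K := rfl
  rw [h, ← Homeomorph.image_frontier]
  have h2 : y - x₀ = Homeomorph.subRight x₀ y := rfl
  rw [h2, (Homeomorph.subRight x₀).injective.mem_set_image]

/-- The point where the ray from `x₀` in direction `v` leaves `K`. -/
theorem exit_mem_frontier (hK : IsSolidBody K) (hx₀ : x₀ ∈ interior K) {v : E3} (hv : v ≠ 0) :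
    x₀ + (bodyGauge K x₀ v)⁻¹ • v ∈ frontier K := by
  have h := bodyGauge_pos hK hx₀ hv
  rw [mem_frontier_iff_bodyGauge hK hx₀, add_sub_cancel_left,
    bodyGauge_smul (inv_nonneg.2 h.le), inv_mul_cancel₀ h.ne']

end gauge

/-- Central projection from an interior point `x₀` of a convex body identifies the part of its
boundary below `x₀` with the plane through `x` orthogonal to `n`. -/
theorem exists_central_chart {K : Set E3} (hK : IsSolidBody K) {x₀ x n : E3}
    (hx₀ : x₀ ∈ interior K) (hn : 0 < inner ℝ n (x₀ - x)) :
    ∃ (Ψ : (ℝ ∙ n)ᗮ → E3) (Φ : E3 → (ℝ ∙ n)ᗮ), Continuous Ψ ∧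
      (∀ w, Ψ w ∈ frontier K ∧ 0 < inner ℝ n (x₀ - Ψ w)) ∧
      ContinuousOn Φ {y | 0 < inner ℝ n (x₀ - y)} ∧ (∀ w, Φ (Ψ w) = w) ∧
      (∀ y ∈ frontier K, 0 < inner ℝ n (x₀ - y) → Ψ (Φ y) = y) ∧
      (∀ w : (ℝ ∙ n)ᗮ, x + w ∈ frontier K → Ψ w = x + w) ∧
      (∀ w : (ℝ ∙ n)ᗮ, Φ (x + w) = w) ∧
      (∀ w : (ℝ ∙ n)ᗮ, Ψ w = x₀ + (bodyGauge K x₀ (x + w - x₀))⁻¹ • (x + w - x₀)) := by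
  have hinn : ∀ w : (ℝ ∙ n)ᗮ, inner ℝ n (x₀ - (x + w)) = inner ℝ n (x₀ - x) := fun w => by
    rw [inner_sub_right, inner_add_right, inner_orthogonal_coe, inner_sub_right]; ring
  have hne : ∀ w : (ℝ ∙ n)ᗮ, x + w - x₀ ≠ 0 := fun w h => by
    have := hinn w
    rw [← neg_sub, h] at this
    simp at this
    linarith
  set g : (ℝ ∙ n)ᗮ → ℝ := fun w => bodyGauge K x₀ (x + w - x₀) with hg
  have hgpos : ∀ w, 0 < g w := fun w => bodyGauge_pos hK hx₀ (hne w)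
  have hgc : Continuous g := (continuous_bodyGauge hK hx₀).comp (by fun_prop)
  let P := (ℝ ∙ n)ᗮ
  -- `t y` is the factor that stretches `y - x₀` until it reaches the plane through `x`. On ∂K it
  -- equals the gauge of the stretched vector, which makes Ψ and Φ mutually inverse.
  let t : E3 → ℝ := fun y => inner ℝ n (x₀ - x) / inner ℝ n (x₀ - y)
  let Φ : E3 → (ℝ ∙ n)ᗮ := fun y => P.orthogonalProjectionOnto (x₀ - x + t y • (y - x₀))
  let Ψ : (ℝ ∙ n)ᗮ → E3 := fun w => x₀ + (g w)⁻¹ • (x + w - x₀)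
  have hΨn : ∀ w, inner ℝ n (x₀ - Ψ w) = (g w)⁻¹ * inner ℝ n (x₀ - x) := fun w => by
    have : x₀ - Ψ w = (g w)⁻¹ • (x₀ - (x + w)) := by
      simp only [Ψ]; module
    rw [this, inner_smul_right, hinn]
  have hΨfr : ∀ w, Ψ w ∈ frontier K := fun w => exit_mem_frontier hK hx₀ (hne w)
  have hΦcoe : ∀ y, 0 < inner ℝ n (x₀ - y) → (Φ y : E3) = x₀ - x + t y • (y - x₀) := by
    intro y hy
    apply Submodule.starProjection_eq_self_iff.2
    rw [Submodule.mem_orthogonal_singleton_iff_inner_right, inner_add_right, inner_smul_right,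
      ← neg_sub x₀ y, inner_neg_right]
    simp only [t]
    field_simp
    ring
  refine ⟨Ψ, Φ, ?_, fun w => ⟨hΨfr w, ?_⟩, ?_, ?_, ?_, ?_, ?_, fun w => rfl⟩
  · exact continuous_const.add ((hgc.inv₀ fun w => (hgpos w).ne').smul (by fun_prop))
  · rw [hΨn]; exact mul_pos (inv_pos.2 (hgpos w)) hn
  · apply P.orthogonalProjectionOnto.continuous.comp_continuousOn
    have ht : ContinuousOn t {y | 0 < inner ℝ n (x₀ - y)} :=
      ContinuousOn.div continuousOn_const (by fun_prop) fun y hy => ne_of_gt hy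
    exact continuousOn_const.add (ht.fun_smul (by fun_prop))
  · intro w
    apply Subtype.ext
    rw [hΦcoe _ (by rw [hΨn]; exact mul_pos (inv_pos.2 (hgpos w)) hn)]
    have h1 : t (Ψ w) = g w := by
      simp only [t, hΨn]
      have := hgpos w
      field_simp
    have h2 : Ψ w - x₀ = (g w)⁻¹ • (x + w - x₀) := by simp [Ψ]
    rw [h1, h2, smul_smul, mul_inv_cancel₀ (hgpos w).ne', one_smul]
    abel
  · intro y hy hny
    have h1 : x + (Φ y : E3) - x₀ = t y • (y - x₀) := by rw [hΦcoe y hny]; abel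
    have htpos : 0 < t y := div_pos hn hny
    have h2 : g (Φ y) = t y := by
      simp only [hg]
      rw [h1, bodyGauge_smul htpos.le, (mem_frontier_iff_bodyGauge hK hx₀).1 hy, mul_one]
    simp only [Ψ]
    rw [h1, h2, smul_smul, inv_mul_cancel₀ htpos.ne', one_smul, add_sub_cancel]
  · intro w hw
    have h2 : g w = 1 := (mem_frontier_iff_bodyGauge hK hx₀).1 hw
    simp only [Ψ, h2]
    simp
  · intro w
    apply Subtype.ext
    rw [hΦcoe _ (by rwa [hinn])]
    simp only [t, hinn, div_self hn.ne', one_smul]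
    abel

/-- Transfers neighborhoods between the planar parameter domain and the boundary of the body, so
that planar invariance of domain becomes a statement about ∂K. -/
theorem map_nhds_central_chart {P : Type*} [TopologicalSpace P] {S O : Set E3} {Ψ : P → E3}
    {Φ : E3 → P} (hΨ : Continuous Ψ) (hΨO : ∀ w, Ψ w ∈ S ∧ Ψ w ∈ O) (hO : IsOpen O)
    (hΦ : ContinuousOn Φ O) (h1 : ∀ w, Φ (Ψ w) = w)
    (h2 : ∀ y ∈ S, y ∈ O → Ψ (Φ y) = y) (w : P) : map Ψ (𝓝 w) = 𝓝[S] (Ψ w) := by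
  apply le_antisymm
  · exact tendsto_nhdsWithin_of_tendsto_nhds_of_eventually_within _ hΨ.continuousAt
      (Eventually.of_forall fun w => (hΨO w).1)
  · intro s hs
    have h3 : Tendsto Φ (𝓝[S] (Ψ w)) (𝓝 w) := by
      have := (hΦ.continuousAt (hO.mem_nhds (hΨO w).2)).tendsto
      rw [h1] at this
      exact this.mono_left nhdsWithin_le_nhds
    filter_upwards [h3 hs, self_mem_nhdsWithin, nhdsWithin_le_nhds (hO.mem_nhds (hΨO w).2)]
      with y hy hyS hyO
    simp only [mem_preimage] at hy
    rwa [h2 y hyS hyO] at hy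

theorem isOpen_inner_sub_pos (n x₀ : E3) : IsOpen {y : E3 | 0 < inner ℝ n (x₀ - y)} :=
  isOpen_lt continuous_const (by fun_prop)

/-- An injective continuous map from a surface to the boundary of a convex body is open. -/
theorem image_mem_nhdsWithin_frontier {E : Type*} [NormedAddCommGroup E] [NormedSpace ℝ E]
    (hE : Module.finrank ℝ E = 2) {K : Set E3} (hK : IsSolidBody K) {h : E → E3} {V : Set E}
    {a : E} (hV : V ∈ 𝓝 a) (hc : ContinuousOn h V) (hinj : InjOn h V)
    (hfr : MapsTo h V (frontier K)) : h '' V ∈ 𝓝[frontier K] (h a) := by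
  obtain ⟨x₀, hx₀⟩ := hK.2.2
  have hne : x₀ - h a ≠ 0 := fun h0 => by
    have := hfr (mem_of_mem_nhds hV)
    rw [← sub_eq_zero.1 h0] at this
    exact this.2 hx₀
  set n := x₀ - h a with hn
  obtain ⟨Ψ, Φ, c1, c2, c3, c4, c5, c6, c7, -⟩ := exists_central_chart hK hx₀
    (real_inner_self_pos.2 hne : 0 < inner ℝ n (x₀ - h a))
  have hO := isOpen_inner_sub_pos n x₀
  obtain ⟨V', hV'V, hV'o, haV'⟩ := _root_.mem_nhds_iff.1 hV
  have hopen : IsOpen (V' ∩ h ⁻¹' {y | 0 < inner ℝ n (x₀ - y)}) :=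
    (hc.mono hV'V).isOpen_inter_preimage hV'o hO
  set W := V' ∩ h ⁻¹' {y | 0 < inner ℝ n (x₀ - y)} with hW
  have hWV : W ⊆ V := inter_subset_left.trans hV'V
  have haW : a ∈ W := ⟨haV', real_inner_self_pos.2 hne⟩
  have h1 := image_mem_nhds_of_injOn (f := Φ ∘ h) hE (finrank_orthogonal_span hne)
    (hopen.mem_nhds haW) (c3.comp (hc.mono hWV) fun y hy => hy.2) (by
      intro y hy z hz hyz
      apply hinj (hWV hy) (hWV hz)
      rw [← c5 _ (hfr (hWV hy)) hy.2, ← c5 _ (hfr (hWV hz)) hz.2]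
      exact congrArg Ψ hyz)
  have h2 : Ψ '' ((Φ ∘ h) '' W) ∈ 𝓝[frontier K] (Ψ ((Φ ∘ h) a)) := by
    rw [← map_nhds_central_chart c1 c2 hO c3 c4 c5]
    exact image_mem_map h1
  have h3 : ∀ y ∈ W, Ψ ((Φ ∘ h) y) = h y := fun y hy => c5 _ (hfr (hWV hy)) hy.2
  rw [h3 a haW] at h2
  refine mem_of_superset h2 ?_
  rintro _ ⟨_, ⟨y, hy, rfl⟩, rfl⟩
  exact ⟨y, hWV hy, (h3 y hy).symm⟩

/-- If two convex bodies share a piece of boundary near `x`, their boundaries agree there. -/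
theorem nhdsWithin_frontier_eq {K K' : Set E3} (hK : IsSolidBody K) (hK' : IsSolidBody K')
    {x : E3} (hx : x ∈ frontier K) (h : frontier K' ∈ 𝓝[frontier K] x) :
    𝓝[frontier K] x = 𝓝[frontier K'] x := by
  refine le_antisymm (nhdsWithin_le_iff.2 h) (nhdsWithin_le_iff.2 ?_)
  obtain ⟨x₀, hx₀⟩ := hK.2.2
  have hne : x₀ - x ≠ 0 := fun h0 => by
    rw [← sub_eq_zero.1 h0] at hx
    exact hx.2 hx₀
  obtain ⟨Ψ, Φ, c1, c2, c3, c4, c5, c6, c7, -⟩ := exists_central_chart hK hx₀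
    (real_inner_self_pos.2 hne : 0 < inner ℝ (x₀ - x) (x₀ - x))
  have hΨ0 : Ψ 0 = x := by simpa using c6 0 (by simpa using hx)
  have hm := map_nhds_central_chart c1 c2 (isOpen_inner_sub_pos (x₀ - x) x₀) c3 c4 c5 0
  rw [hΨ0] at hm
  have hV : Ψ ⁻¹' frontier K' ∈ 𝓝 (0 : (ℝ ∙ (x₀ - x))ᗮ) := by rwa [← mem_map, hm]
  -- A chart of ∂K near x, regarded as an injective map into ∂K', is open there by invariance of
  -- domain. The one-sided containment thus becomes an equality of germs.
  have h1 := image_mem_nhdsWithin_frontier (finrank_orthogonal_span hne) hK' hV c1.continuousOn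
    (fun y _ z _ hyz => by rw [← c4 y, hyz, c4]) (fun y hy => hy)
  rw [hΨ0] at h1
  refine mem_of_superset h1 ?_
  rintro _ ⟨y, -, rfl⟩
  exact (c2 y).1

/-! ### Interior and boundary points of the surface, seen in the boundary of a body -/

section chart

open scoped Manifold

variable {M : Type*} [TopologicalSpace M] [ChartedSpace (EuclideanHalfSpace 2) M]

theorem finrank_E2 : Module.finrank ℝ (EuclideanSpace ℝ (Fin 2)) = 2 := by simp

/-- Near an interior point of the surface, `f` covers a piece of the boundary of the body. -/
theorem image_mem_nhdsWithin_of_notMem_bdry {f : M → E3} (hf : Continuous f) {p : M}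
    (hp : p ∉ bdry M) {U : Set M} (hU : U ∈ 𝓝 p) (hinj : InjOn f U) {K : Set E3}
    (hK : IsSolidBody K) (hfr : f '' U ⊆ frontier K) : f '' U ∈ 𝓝[frontier K] (f p) := by
  have hp' : (𝓡∂ 2).IsInteriorPoint p := by
    rw [ModelWithCorners.isInteriorPoint_iff_not_isBoundaryPoint]; exact hp
  set φ := extChartAt (𝓡∂ 2) p with hφ
  have hV : φ.target ∩ φ.symm ⁻¹' U ∈ 𝓝 (φ p) := by
    apply inter_mem
    · have h0 := extChartAt_target_mem_nhdsWithin (I := 𝓡∂ 2) p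
      rwa [nhdsWithin_eq_nhds.2 (mem_interior_iff_mem_nhds.1 hp')] at h0
    · apply (continuousAt_extChartAt_symm p).preimage_mem_nhds
      rwa [extChartAt_to_inv]
  have h1 := image_mem_nhdsWithin_frontier finrank_E2 hK (h := f ∘ φ.symm) hV
    (hf.comp_continuousOn ((continuousOn_extChartAt_symm p).mono inter_subset_left))
    (fun x hx y hy hxy => φ.symm.injOn hx.1 hy.1 (hinj hx.2 hy.2 hxy))
    (fun x hx => hfr ⟨_, hx.2, rfl⟩)
  rw [Function.comp_apply, extChartAt_to_inv] at h1
  refine mem_of_superset h1 ?_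
  rintro _ ⟨x, hx, rfl⟩
  exact ⟨_, hx.2, rfl⟩

theorem exists_inverse_on_image {X Y : Type*} [TopologicalSpace X] [TopologicalSpace Y]
    [T2Space Y] [Nonempty X] {f : X → Y} {U : Set X} (hU : IsCompact U) (hf : ContinuousOn f U)
    (hinj : InjOn f U) :
    ∃ g : Y → X, ContinuousOn g (f '' U) ∧ (∀ x ∈ U, g (f x) = x) := by
  refine ⟨Function.invFunOn f U, ?_, fun x hx => hinj.leftInvOn_invFunOn hx⟩
  rw [continuousOn_iff_isClosed]
  intro t ht
  refine ⟨f '' (U ∩ t), ((hU.inter_right ht).image_of_continuousOn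
    (hf.mono inter_subset_left)).isClosed, ?_⟩
  ext y
  constructor
  · rintro ⟨hy, x, hx, rfl⟩
    rw [mem_preimage, hinj.leftInvOn_invFunOn hx] at hy
    exact ⟨⟨x, ⟨hx, hy⟩, rfl⟩, x, hx, rfl⟩
  · rintro ⟨⟨x, ⟨hx, hxt⟩, rfl⟩, -⟩
    refine ⟨?_, x, hx, rfl⟩
    rwa [mem_preimage, hinj.leftInvOn_invFunOn hx]

/-- Near a boundary point of the surface, `f` does not cover a piece of the boundary of a body. -/
theorem image_notMem_nhdsWithin_of_mem_bdry {f : M → E3} (hf : Continuous f) {p : M}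
    (hp : p ∈ bdry M) {U : Set M} (hU : U ∈ 𝓝 p) (hUc : IsCompact U) (hinj : InjOn f U)
    {K : Set E3} (hK : IsSolidBody K) (hpK : f p ∈ frontier K) :
    f '' U ∉ 𝓝[frontier K] (f p) := by
  intro hmem
  set φ := extChartAt (𝓡∂ 2) p with hφ
  have hpU : p ∈ U := mem_of_mem_nhds hU
  have : Nonempty M := ⟨p⟩
  obtain ⟨g, hgc, hg⟩ := exists_inverse_on_image hUc hf.continuousOn hinj
  obtain ⟨x₀, hx₀⟩ := hK.2.2
  have hne : x₀ - f p ≠ 0 := fun h0 => by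
    rw [← sub_eq_zero.1 h0] at hpK
    exact hpK.2 hx₀
  obtain ⟨Ψ, Φ, c1, c2, c3, c4, c5, c6, c7, -⟩ := exists_central_chart hK hx₀
    (real_inner_self_pos.2 hne : 0 < inner ℝ (x₀ - f p) (x₀ - f p))
  have hΨ0 : Ψ 0 = f p := by simpa using c6 0 (by simpa using hpK)
  have hm := map_nhds_central_chart c1 c2 (isOpen_inner_sub_pos (x₀ - f p) x₀) c3 c4 c5 0
  rw [hΨ0] at hm
  have hV1 : Ψ ⁻¹' (f '' U) ∈ 𝓝 (0 : (ℝ ∙ (x₀ - f p))ᗮ) := by rwa [← mem_map, hm]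
  have hgΨ : ContinuousOn (g ∘ Ψ) (Ψ ⁻¹' (f '' U)) :=
    hgc.comp c1.continuousOn (fun _ h => h)
  have hg0 : (g ∘ Ψ) 0 = p := by simp [hΨ0, hg p hpU]
  have hV2 : (g ∘ Ψ) ⁻¹' φ.source ∈ 𝓝 (0 : (ℝ ∙ (x₀ - f p))ᗮ) := by
    apply (hgΨ.continuousAt hV1).preimage_mem_nhds
    rw [hg0]
    exact extChartAt_source_mem_nhds p
  have hfg : ∀ y ∈ f '' U, f (g y) = y := by
    rintro _ ⟨x, hx, rfl⟩
    rw [hg x hx]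
  -- If f covered a neighborhood in ∂K, inverting f and passing to the surface chart would map a
  -- planar neighborhood injectively into the model half-plane. Invariance of domain would then make
  -- `φ p` an interior point of that half-plane.
  have h1 := image_mem_nhds_of_injOn (f := φ ∘ g ∘ Ψ) (finrank_orthogonal_span hne) finrank_E2
    (inter_mem hV1 hV2)
    ((continuousOn_extChartAt p).comp (hgΨ.mono inter_subset_left) (fun x hx => hx.2))
    (fun x hx y hy hxy => by
      have h2 : g (Ψ x) = g (Ψ y) := φ.injOn hx.2 hy.2 hxy
      have h3 := congrArg f h2
      rw [hfg _ hx.1, hfg _ hy.1] at h3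
      rw [← c4 x, h3, c4])
  rw [Function.comp_apply, hg0] at h1
  have h4 : range (𝓡∂ 2) ∈ 𝓝 (φ p) := by
    refine mem_of_superset h1 ?_
    rintro _ ⟨y, hy, rfl⟩
    exact extChartAt_target_subset_range p (φ.map_source hy.2)
  have h5 : φ p ∈ frontier (range (𝓡∂ 2)) := hp
  exact h5.2 (mem_interior_iff_mem_nhds.2 h4)

end chart

/-! ### Nondegenerate caps as one side of the boundary of a body -/

theorem IsSolidBody.exists_support {K : Set E3} (hK : IsSolidBody K) {d : E3}
    (hd : d ∉ interior K) :
    ∃ k : E3, (∀ y ∈ interior K, inner ℝ k y < inner ℝ k d) ∧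
      ∀ y ∈ K, inner ℝ k y ≤ inner ℝ k d := by
  obtain ⟨φ, hφ⟩ := geometric_hahn_banach_open_point hK.1.interior isOpen_interior hd
  have hk : ∀ y, inner ℝ ((InnerProductSpace.toDual ℝ E3).symm φ) y = φ y := fun y => by simp
  refine ⟨(InnerProductSpace.toDual ℝ E3).symm φ, fun y hy => by rw [hk, hk]; exact hφ y hy,
    fun y hy => ?_⟩
  rw [hk, hk]
  have h1 : K ⊆ closure (interior K) := by
    rw [hK.1.closure_interior_eq_closure_of_nonempty_interior hK.2.2]
    exact subset_closure
  exact closure_minimal (fun z hz => (hφ z hz).le)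
    (isClosed_le φ.continuous continuous_const) (h1 hy)

/-- The part of the boundary of a convex body on one side of a plane. -/
def openCap (K : Set E3) (n : E3) (c : ℝ) : Set E3 := frontier K ∩ {y | c < inner ℝ n y}

/-- Central projection from `x₀` onto the parallel plane through `x₀ + n` turns the cap into a
strict sublevel set of the gauge multiplied by `c - ⟪n, x₀⟫`. This factor is nonnegative, so the set
is convex. -/
theorem isPreconnected_openCap_of_interior {K : Set E3} (hK : IsSolidBody K) {n x₀ : E3} {c : ℝ}
    (hn : n ≠ 0) (hx₀ : x₀ ∈ interior K) (hc : inner ℝ n x₀ ≤ c) :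
    IsPreconnected (openCap K n c) := by
  have hnn : 0 < inner ℝ n n := real_inner_self_pos.2 hn
  obtain ⟨Ψ, Φ, c1, c2, c3, c4, c5, -, -, c8⟩ := exists_central_chart (n := -n) (x := x₀ + n) hK hx₀
    (by simpa using hnn)
  have hval : ∀ w, inner ℝ n (Ψ w) =
      inner ℝ n x₀ + (bodyGauge K x₀ (x₀ + n + w - x₀))⁻¹ * inner ℝ n n := fun w => by
    have h0 : inner ℝ n (w : E3) = 0 := by simpa using inner_orthogonal_coe w
    rw [c8, inner_add_right, inner_smul_right, inner_sub_right, inner_add_right, inner_add_right,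
      h0]
    ring
  have hpos : ∀ w : (ℝ ∙ (-n))ᗮ, 0 < bodyGauge K x₀ (x₀ + n + w - x₀) := fun w =>
    bodyGauge_pos hK hx₀ fun h => by
      have h0 : inner ℝ n (w : E3) = 0 := by simpa using inner_orthogonal_coe w
      have h1 := congrArg (inner ℝ n) h
      rw [inner_sub_right, inner_add_right, inner_add_right, h0, inner_zero_right] at h1
      linarith
  set T : Set (ℝ ∙ (-n))ᗮ :=
    {w | (c - inner ℝ n x₀) * bodyGauge K x₀ (x₀ + n + w - x₀) < inner ℝ n n} with hT
  have hTmem : ∀ w, w ∈ T ↔ c < inner ℝ n (Ψ w) := fun w => by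
    rw [hval, hT, mem_ofPred_eq, ← sub_lt_iff_lt_add', inv_mul_eq_div, lt_div_iff₀ (hpos w)]
  have hconv : Convex ℝ T := by
    intro w hw w' hw' a b ha hb hab
    have e : x₀ + n + ((a • w + b • w' : (ℝ ∙ (-n))ᗮ) : E3) - x₀ =
        a • (x₀ + n + w - x₀) + b • (x₀ + n + w' - x₀) := by
      have : x₀ + n = (a + b) • (x₀ + n) := by rw [hab, one_smul]
      obtain rfl : b = 1 - a := by linarith
      simp only [Submodule.coe_add, Submodule.coe_smul]
      module
    have h1 := bodyGauge_add_le hK hx₀ (a • (x₀ + n + w - x₀)) (b • (x₀ + n + w' - x₀))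
    rw [← e, bodyGauge_smul ha, bodyGauge_smul hb] at h1
    simp only [hT, mem_ofPred_eq] at hw hw' ⊢
    have h2 := mul_le_mul_of_nonneg_left h1 (sub_nonneg.2 hc)
    rcases ha.eq_or_lt with rfl | ha
    · obtain rfl : b = 1 := by linarith
      linarith
    · nlinarith
  have himg : openCap K n c = Ψ '' T := by
    ext y
    constructor
    · rintro ⟨hy, hyc⟩
      have hyp : 0 < inner ℝ (-n) (x₀ - y) := by
        rw [inner_neg_left, inner_sub_right]
        simp only [mem_ofPred_eq] at hyc
        linarith
      refine ⟨Φ y, ?_, c5 y hy hyp⟩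
      rw [hTmem, c5 y hy hyp]
      exact hyc
    · rintro ⟨w, hw, rfl⟩
      exact ⟨(c2 w).1, (hTmem w).1 hw⟩
  rw [himg]
  exact hconv.isPreconnected.image _ c1.continuousOn

/-- The half-space at or below level c may meet K only in its boundary. For two given points of the
cap, z is moved slightly into the interior while staying below both of them; they then lie in a
smaller cap to which the interior case applies. -/
theorem isPreconnected_openCap {K : Set E3} (hK : IsSolidBody K) {n z : E3} {c : ℝ}
    (hn : n ≠ 0) (hz : z ∈ K) (hc : inner ℝ n z ≤ c) : IsPreconnected (openCap K n c) := by
  obtain ⟨x₀, hx₀⟩ := hK.2.2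
  have hint : ∀ t ∈ Ioc (0 : ℝ) 1, z + t • (x₀ - z) ∈ interior K := fun t ht =>
    hK.1.add_smul_sub_mem_interior hz hx₀ ht
  apply isPreconnected_of_forall_pair
  intro a ha b hb
  obtain ⟨t, ht, hta, htb⟩ : ∃ t ∈ Ioc (0 : ℝ) 1,
      inner ℝ n (z + t • (x₀ - z)) < inner ℝ n a ∧ inner ℝ n (z + t • (x₀ - z)) < inner ℝ n b := by
    have hlim : Tendsto (fun t : ℝ => inner ℝ n (z + t • (x₀ - z))) (𝓝[>] 0) (𝓝 (inner ℝ n z)) := by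
      have : Continuous fun t : ℝ => inner ℝ n (z + t • (x₀ - z)) := by fun_prop
      have h2 := this.tendsto 0
      simp only [zero_smul, add_zero] at h2
      exact h2.mono_left nhdsWithin_le_nhds
    have h1 := hlim.eventually_lt_const (hc.trans_lt ha.2)
    have h2 := hlim.eventually_lt_const (hc.trans_lt hb.2)
    have h3 : ∀ᶠ t : ℝ in 𝓝[>] 0, t ∈ Ioc (0 : ℝ) 1 := Ioc_mem_nhdsGT one_pos
    obtain ⟨t, ⟨h4, h5⟩, h6⟩ := ((h1.and h2).and h3).exists
    exact ⟨t, h6, h4, h5⟩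
  refine ⟨openCap K n (max c (inner ℝ n (z + t • (x₀ - z)))), ?_, ?_, ?_, ?_⟩
  · rintro y ⟨hy, hy'⟩
    exact ⟨hy, lt_of_le_of_lt (le_max_left _ _) (mem_ofPred_eq ▸ hy')⟩
  · exact ⟨ha.1, max_lt ha.2 hta⟩
  · exact ⟨hb.1, max_lt hb.2 htb⟩
  · exact isPreconnected_openCap_of_interior hK hn (hint t ht) (le_max_right _ _)

/-- A line through x parallel to the plane leaves K at two boundary points on the level of x, and x
lies between them. -/
theorem interior_inter_subset_convexHull_openCap {K : Set E3} (hK : IsSolidBody K) {n : E3} {c : ℝ}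
    (hn : n ≠ 0) : interior K ∩ {y | c < inner ℝ n y} ⊆ convexHull ℝ (openCap K n c) := by
  rintro x ⟨hx, hxc⟩
  have : Nontrivial (ℝ ∙ n)ᗮ := by
    apply Module.nontrivial_of_finrank_pos (R := ℝ)
    rw [finrank_orthogonal_span hn]; norm_num
  obtain ⟨w, hw⟩ := exists_ne (0 : (ℝ ∙ n)ᗮ)
  have hmem : ∀ w : (ℝ ∙ n)ᗮ, w ≠ 0 →
      x + (bodyGauge K x (w : E3))⁻¹ • (w : E3) ∈ convexHull ℝ (openCap K n c) := fun w hw => by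
    apply subset_convexHull
    refine ⟨exit_mem_frontier hK hx (by simpa using hw), ?_⟩
    rw [mem_ofPred_eq, inner_add_right, inner_smul_right, inner_orthogonal_coe]
    simpa using hxc
  have h1 := hmem w hw
  have h2 := hmem (-w) (neg_ne_zero.2 hw)
  have p1 := bodyGauge_pos hK hx (v := (w : E3)) (by simpa using hw)
  have p2 := bodyGauge_pos hK hx (v := ((-w : (ℝ ∙ n)ᗮ) : E3)) (by simpa using hw)
  set g1 := bodyGauge K x (w : E3)
  set g2 := bodyGauge K x ((-w : (ℝ ∙ n)ᗮ) : E3)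
  have h3 := (convex_convexHull ℝ (openCap K n c)) h1 h2 (a := g1 / (g1 + g2))
    (b := g2 / (g1 + g2)) (by positivity) (by positivity) (by field_simp)
  convert h3 using 1
  have e1 : (g1 / (g1 + g2)) • (x + g1⁻¹ • (w : E3)) +
      (g2 / (g1 + g2)) • (x + g2⁻¹ • ((-w : (ℝ ∙ n)ᗮ) : E3)) =
      (g1 / (g1 + g2) + g2 / (g1 + g2)) • x +
      (g1 / (g1 + g2) * g1⁻¹ - g2 / (g1 + g2) * g2⁻¹) • (w : E3) := by
    simp only [Submodule.coe_neg]
    module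
  have e2 : g1 / (g1 + g2) + g2 / (g1 + g2) = 1 := by field_simp
  have e3 : g1 / (g1 + g2) * g1⁻¹ - g2 / (g1 + g2) * g2⁻¹ = 0 := by field_simp; ring
  rw [e1, e2, e3, one_smul, zero_smul, add_zero]

/-- The interior of a nondegenerate cap is the part of the boundary on one side of the plane. -/
theorem openCap_eq_of_embedding {K : Set E3} (hK : IsSolidBody K) {n : E3} {c : ℝ} (hn : n ≠ 0)
    {h : UnitDisk → E3} (he : IsEmbedding h) (hfr : range h ⊆ frontier K)
    (hp : range h ∩ plane n c = h '' {z | ‖(z : EuclideanSpace ℝ (Fin 2))‖ = 1})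
    (hpos : c < inner ℝ n (h ⟨0, by simp⟩)) :
    openCap K n c ⊆ range h ∧ range h ⊆ closure (openCap K n c) ∧
      (∃ z ∈ range h, inner ℝ n z = c) := by
  set Bo : Set UnitDisk := {z | ‖(z : EuclideanSpace ℝ (Fin 2))‖ < 1} with hBo
  have hBoimg : Subtype.val '' Bo = ball (0 : EuclideanSpace ℝ (Fin 2)) 1 := by
    ext z
    constructor
    · rintro ⟨z, hz, rfl⟩
      exact mem_ball_zero_iff.2 hz
    · intro hz
      exact ⟨⟨z, ball_subset_closedBall hz⟩, by simpa [hBo] using hz, rfl⟩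
  have hBoconn : IsPreconnected Bo := by
    rw [← IsInducing.subtypeVal.isPreconnected_image, hBoimg]
    exact (convex_ball _ _).isPreconnected
  have hne : ∀ z ∈ Bo, inner ℝ n (h z) ≠ c := fun z hz heq => by
    have : h z ∈ h '' {z | ‖(z : EuclideanSpace ℝ (Fin 2))‖ = 1} := by
      rw [← hp]; exact ⟨mem_range_self _, heq⟩
    obtain ⟨z', hz', hzz⟩ := this
    rw [he.injective hzz] at hz'
    exact (ne_of_lt hz) hz'
  have hBopos : ∀ z ∈ Bo, c < inner ℝ n (h z) := fun z hz => by
    by_contra hle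
    -- The open disk is connected and its image avoids the plane, so the image stays on the side of
    -- the center.
    have := hBoconn.intermediate_value hz (show (⟨0, by simp⟩ : UnitDisk) ∈ Bo by simp [hBo])
      (f := fun z => inner ℝ n (h z)) (continuous_const.inner he.continuous).continuousOn
      ⟨not_lt.1 hle, hpos.le⟩
    obtain ⟨w, hw, hwc⟩ := this
    exact hne w hw hwc
  obtain ⟨z₁, hz₁, hz₁c⟩ : ∃ z ∈ range h, inner ℝ n z = c := by
    let e : UnitDisk := ⟨EuclideanSpace.single 0 1, by simp⟩
    have : h e ∈ range h ∩ plane n c := by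
      rw [hp]; exact ⟨e, by simp [e], rfl⟩
    exact ⟨h e, this.1, this.2⟩
  have hO : ∀ y ∈ h '' Bo, h '' Bo ∈ 𝓝[frontier K] y := by
    rintro _ ⟨z, hz, rfl⟩
    classical
    let h' : EuclideanSpace ℝ (Fin 2) → E3 := fun x =>
      if hx : x ∈ closedBall (0 : EuclideanSpace ℝ (Fin 2)) 1 then h ⟨x, hx⟩ else 0
    have hh' : ∀ z : UnitDisk, h' z = h z := fun z => dif_pos z.2
    have hc : ContinuousOn h' (ball 0 1) := by
      apply ContinuousOn.mono _ ball_subset_closedBall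
      rw [continuousOn_iff_continuous_domRestrict]
      convert he.continuous using 1
      ext1 z
      exact hh' z
    have himg : h' '' ball 0 1 = h '' Bo := by
      rw [← hBoimg, image_image]
      exact image_congr fun z _ => hh' z
    rw [← himg, ← hh']
    refine image_mem_nhdsWithin_frontier finrank_E2 hK (isOpen_ball.mem_nhds ?_) hc ?_ ?_
    · rw [← hBoimg]; exact ⟨z, hz, rfl⟩
    · rw [← hBoimg]
      rintro _ ⟨x, -, rfl⟩ _ ⟨y, -, rfl⟩ hxy
      rw [hh', hh'] at hxy
      rw [he.injective hxy]
    · rw [← hBoimg]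
      rintro _ ⟨x, -, rfl⟩
      rw [hh']
      exact hfr (mem_range_self _)
  have hDO : ∀ z, c < inner ℝ n (h z) → z ∈ Bo := fun z hz => by
    by_contra hzn
    have h1 : ‖(z : EuclideanSpace ℝ (Fin 2))‖ = 1 :=
      le_antisymm (mem_closedBall_zero_iff.1 z.2) (not_lt.1 hzn)
    have : h z ∈ range h ∩ plane n c := by rw [hp]; exact ⟨z, h1, rfl⟩
    exact hz.ne' this.2
  have hBS : h '' Bo ⊆ openCap K n c := by
    rintro _ ⟨z, hz, rfl⟩
    exact ⟨hfr (mem_range_self _), hBopos z hz⟩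
  have hcompact : IsCompact (range h) := isCompact_range he.continuous
  refine ⟨?_, ?_, z₁, hz₁, hz₁c⟩
  · have hpre := isPreconnected_openCap hK hn (hK.frontier_subset (hfr hz₁)) hz₁c.le
    rw [isPreconnected_iff_subset_of_disjoint] at hpre
    have hu : ∀ y ∈ openCap K n c, y ∈ interior (h '' Bo ∪ (frontier K)ᶜ) → y ∈ h '' Bo :=
      fun y hy hyu => (interior_subset hyu).resolve_right (fun h => h hy.1)
    -- The image of the open disk is relatively open by invariance of domain, and it is relatively
    -- closed in the open cap because only circle points reach the plane. The connected open cap is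
    -- therefore contained in it.
    have hsub := hpre (interior (h '' Bo ∪ (frontier K)ᶜ)) (range h)ᶜ isOpen_interior
      hcompact.isClosed.isOpen_compl ?_ ?_
    · rcases hsub with hs | hs
      · exact fun y hy => image_subset_range _ _ (hu y hy (hs hy))
      · exfalso
        have h0 : h ⟨0, by simp⟩ ∈ openCap K n c := hBS ⟨_, by simp [hBo], rfl⟩
        exact hs h0 (mem_range_self _)
    · intro y hy
      by_cases hyD : y ∈ range h
      · left
        obtain ⟨z, rfl⟩ := hyD
        have := hO (h z) ⟨z, hDO z hy.2, rfl⟩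
        rw [mem_interior_iff_mem_nhds]
        filter_upwards [mem_inf_principal.1 this] with y hy
        by_cases hyf : y ∈ frontier K
        · exact Or.inl (hy hyf)
        · exact Or.inr hyf
      · exact Or.inr hyD
    · rw [eq_empty_iff_forall_notMem]
      rintro y ⟨hy, hyu, hyv⟩
      exact hyv (image_subset_range _ _ (hu y hy hyu))
  · have hdense : ∀ z : UnitDisk, z ∈ closure Bo := fun z => by
      rw [closure_subtype, hBoimg, closure_ball _ one_ne_zero]
      exact z.2
    rintro _ ⟨z, rfl⟩
    exact closure_mono hBS (image_closure_subset_closure_image he.continuous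
      ⟨z, hdense z, rfl⟩)

theorem plane_smul {n : E3} {c s : ℝ} (hs : s ≠ 0) : plane (s • n) (s * c) = plane n c := by
  ext y
  simp [plane, inner_smul_left, hs]

/-- The structure of a nondegenerate cap lying on the boundary of a convex body `K`. -/
theorem IsNondegenerateCap.structure {D : Set E3} (hD : IsNondegenerateCap D) :
    ∃ (n : E3) (c : ℝ), ‖n‖ = 1 ∧ (∃ z ∈ D, inner ℝ n z = c) ∧ (∀ z ∈ D, c ≤ inner ℝ n z) ∧
      ∀ K : Set E3, IsSolidBody K → D ⊆ frontier K →
        openCap K n c ⊆ D ∧ D ⊆ closure (openCap K n c) := by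
  obtain ⟨K₀, n, c, h, hK₀, hn, he, rfl, hfr, hp⟩ := hD
  have hn' : 0 < ‖n‖ := norm_pos_iff.2 hn
  have hne : inner ℝ n (h ⟨0, by simp⟩) ≠ c := fun heq => by
    have : h ⟨0, by simp⟩ ∈ h '' {z | ‖(z : EuclideanSpace ℝ (Fin 2))‖ = 1} := by
      rw [← hp]; exact ⟨mem_range_self _, heq⟩
    obtain ⟨z', hz', hzz⟩ := this
    rw [he.injective hzz] at hz'
    simp at hz'
  -- The normal is made a unit vector and oriented so that the center of the disk lies on the
  -- positive side.
  obtain ⟨s, hs, hsn, hpos⟩ : ∃ s : ℝ, s ≠ 0 ∧ ‖s • n‖ = 1 ∧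
      s * c < inner ℝ (s • n) (h ⟨0, by simp⟩) := by
    rcases lt_or_gt_of_ne hne with hlt | hgt
    · refine ⟨-‖n‖⁻¹, by simpa using hn, ?_, ?_⟩
      · rw [norm_smul, norm_neg, norm_inv, norm_norm, inv_mul_cancel₀ hn'.ne']
      · rw [real_inner_smul_left]
        have := mul_lt_mul_of_pos_left hlt (inv_pos.2 hn')
        linarith
    · refine ⟨‖n‖⁻¹, by simpa using hn, ?_, ?_⟩
      · rw [norm_smul, norm_inv, norm_norm, inv_mul_cancel₀ hn'.ne']
      · rw [real_inner_smul_left]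
        exact mul_lt_mul_of_pos_left hgt (inv_pos.2 hn')
  have hsn0 : s • n ≠ 0 := smul_ne_zero hs hn
  rw [← plane_smul hs] at hp
  have key := fun K (hK : IsSolidBody K) (hf : range h ⊆ frontier K) =>
    openCap_eq_of_embedding hK hsn0 he hf hp hpos
  refine ⟨s • n, s * c, hsn, (key K₀ hK₀ hfr).2.2, fun z hz => ?_,
    fun K hK hf => ⟨(key K hK hf).1, (key K hK hf).2.1⟩⟩
  have hcl : IsClosed {y : E3 | s * c ≤ inner ℝ (s • n) y} :=
    isClosed_le continuous_const (by fun_prop)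
  have hsub : openCap K₀ (s • n) (s * c) ⊆ {y : E3 | s * c ≤ inner ℝ (s • n) y} :=
    fun y hy => le_of_lt (mem_ofPred_eq ▸ hy.2)
  exact closure_minimal hsub hcl ((key K₀ hK₀ hfr).2.1 hz)

/-! ### Extending uniqueness of fibers to limit points -/

/-- `A` is connected at arbitrarily small scales near `x`. -/
def ConnectedAt {X : Type*} [TopologicalSpace X] (A : Set X) (x : X) : Prop :=
  ∀ V ∈ 𝓝 x, ∃ V' ∈ 𝓝 x, ∃ E, IsPreconnected E ∧ V' ∩ A ⊆ E ∧ E ⊆ V ∩ A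

/-- The fiber of `f` over `x` in `C` has at most one point. -/
def UniqueFiber {X Y : Type*} (f : X → Y) (C : Set X) (x : Y) : Prop :=
  ∀ p ∈ C, ∀ q ∈ C, f p = x → f q = x → p = q

/-- Suppose x had two preimages p and q. Take a closed neighborhood N of p on which f is injective,
so that N omits q. Then `f '' (C ∩ frontier N)` stays away from x, and a connected piece E of A near
x misses it. The images of the parts of C inside N and outside N are closed, cover E, and both meet
E by density; at a common point, uniqueness over A puts the preimage on the frontier of N. -/
theorem uniqueFiber_of_connectedAt {X Y : Type*} [TopologicalSpace X] [CompactSpace X]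
    [T2Space X] [TopologicalSpace Y] [T2Space Y] {f : X → Y} (hf : Continuous f)
    (hloc : ∀ p, ∃ U ∈ 𝓝 p, InjOn f U) {C : Set X} {A : Set Y} (hAC : A ⊆ f '' C)
    (hC : IsClosed C) (hA : ∀ a ∈ A, UniqueFiber f C a) (hd : C ⊆ closure (C ∩ f ⁻¹' A)) {x : Y}
    (hx : ConnectedAt A x) : UniqueFiber f C x := by
  intro p hp q hq hpx hqx
  by_contra hpq
  obtain ⟨U, hU, hinj⟩ := hloc p
  obtain ⟨N, hN, hNc, hNU⟩ := exists_mem_nhds_isClosed_subset hU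
  have hNinj : InjOn f N := hinj.mono hNU
  have hpN : p ∈ N := mem_of_mem_nhds hN
  have hqN : q ∉ N := fun h => hpq (hNinj hpN h (hpx.trans hqx.symm))
  have hfr : IsCompact (C ∩ frontier N) := (hC.inter isClosed_frontier).isCompact
  have hV : (f '' (C ∩ frontier N))ᶜ ∈ 𝓝 x := by
    apply (hfr.image hf).isClosed.isOpen_compl.mem_nhds
    rintro ⟨r, ⟨-, hr⟩, hrx⟩
    have := hNinj hpN (hNc.frontier_subset hr) (hpx.trans hrx.symm)
    rw [← this] at hr
    exact hr.2 (mem_interior_iff_mem_nhds.2 hN)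
  obtain ⟨V', hV', E, hE, hVE, hEV⟩ := hx _ hV
  have hp' : ∃ p' ∈ N, p' ∈ C ∧ f p' ∈ E := by
    have h1 : N ∩ f ⁻¹' V' ∈ 𝓝 p :=
      inter_mem hN (hf.continuousAt.preimage_mem_nhds (by rwa [hpx]))
    obtain ⟨p', ⟨h2, h3⟩, h4, h5⟩ := mem_closure_iff_nhds.1 (hd hp) _ h1
    exact ⟨p', h2, h4, hVE ⟨h3, h5⟩⟩
  have hq' : ∃ q' ∈ Nᶜ, q' ∈ C ∧ f q' ∈ E := by
    have h1 : Nᶜ ∩ f ⁻¹' V' ∈ 𝓝 q :=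
      inter_mem (hNc.isOpen_compl.mem_nhds hqN) (hf.continuousAt.preimage_mem_nhds (by rwa [hqx]))
    obtain ⟨p', ⟨h2, h3⟩, h4, h5⟩ := mem_closure_iff_nhds.1 (hd hq) _ h1
    exact ⟨p', h2, h4, hVE ⟨h3, h5⟩⟩
  obtain ⟨p', hp'N, hp'C, hp'E⟩ := hp'
  obtain ⟨q', hq'N, hq'C, hq'E⟩ := hq'
  rw [isPreconnected_closed_iff] at hE
  have h1 : IsClosed (f '' (C ∩ N)) := ((hC.inter hNc).isCompact.image hf).isClosed
  have h2 : IsClosed (f '' (C ∩ closure Nᶜ)) :=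
    ((hC.inter isClosed_closure).isCompact.image hf).isClosed
  obtain ⟨y, hyE, ⟨r, hr, hry⟩, r', hr', hry'⟩ := hE _ _ h1 h2 (by
    intro y hy
    obtain ⟨r, hr, rfl⟩ := hAC (hEV hy).2
    by_cases hrN : r ∈ N
    · exact Or.inl ⟨r, ⟨hr, hrN⟩, rfl⟩
    · exact Or.inr ⟨r, ⟨hr, subset_closure hrN⟩, rfl⟩)
    ⟨_, hp'E, p', ⟨hp'C, hp'N⟩, rfl⟩ ⟨_, hq'E, q', ⟨hq'C, subset_closure hq'N⟩, rfl⟩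
  have hrr : r = r' := hA y (hEV hyE).2 r hr.1 r' hr'.1 hry hry'
  refine (hEV hyE).1 ⟨r, ⟨hr.1, ?_⟩, hry⟩
  rw [frontier_eq_closure_inter_closure]
  exact ⟨subset_closure hr.2, by rw [hrr]; exact hr'.2⟩

/-! ### Local connectedness of complements in a plane -/

section planar

variable {P : Type*} [NormedAddCommGroup P] [NormedSpace ℝ P]

theorem isPreconnected_of_segment {s : Set P} {z : P} (h : ∀ y ∈ s, segment ℝ y z ⊆ s) :
    IsPreconnected s :=
  isPreconnected_of_forall z fun y hy =>
    ⟨segment ℝ y z, h y hy, right_mem_segment _ _ _, left_mem_segment _ _ _,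
      (convex_segment y z).isPreconnected⟩

/-- The complement of a convex set with interior points is connected near each point of it. -/
theorem connectedAt_compl_of_interior {B : Set P} (hB : Convex ℝ B)
    (hint : (interior B).Nonempty) (x : P) : ConnectedAt Bᶜ x := by
  intro V hV
  obtain ⟨ε, hε, hεV⟩ := Metric.mem_nhds_iff.1 hV
  obtain ⟨y₀, hy₀⟩ := hint
  obtain ⟨ρ, hρ, hρB⟩ := Metric.mem_nhds_iff.1 (mem_interior_iff_mem_nhds.1 hy₀)
  set r : ℝ := ε / (2 * (‖x - y₀‖ + 1)) with hr
  have hrpos : 0 < r := by positivity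
  -- z lies just beyond x as seen from the interior point `y₀`. Every point outside B sufficiently
  -- near x can be joined to z by a segment missing B.
  set z := x + r • (x - y₀) with hz
  have hzε : z ∈ ball x ε := by
    rw [mem_ball, dist_eq_norm, hz, add_sub_cancel_left, norm_smul, Real.norm_eq_abs,
      abs_of_pos hrpos, hr, div_mul_eq_mul_div, div_lt_iff₀ (by positivity)]
    nlinarith [norm_nonneg (x - y₀)]
  set δ := min ε (ρ * r / (1 + r)) with hδ
  refine ⟨ball x δ, ball_mem_nhds _ (by positivity), {y ∈ ball x ε | Disjoint (segment ℝ y z) B},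
    ?_, ?_, ?_⟩
  · apply isPreconnected_of_segment (z := z)
    rintro y ⟨hy, hyd⟩ w hw
    refine ⟨(convex_ball x ε).segment_subset hy hzε hw, hyd.mono_left ?_⟩
    exact (convex_segment y z).segment_subset hw (right_mem_segment _ _ _)
  · rintro a ⟨ha, haB⟩
    refine ⟨ball_subset_ball (min_le_left _ _) ha, disjoint_left.2 ?_⟩
    rintro b ⟨s, t, hs, ht, hst, rfl⟩ hb
    apply haB
    have hy : y₀ + ((1 + r) / r) • (a - x) ∈ B := by
      apply hρB
      rw [mem_ball, dist_eq_norm, add_sub_cancel_left, norm_smul, Real.norm_eq_abs,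
        abs_of_pos (by positivity)]
      rw [mem_ball, dist_eq_norm] at ha
      have h1 := ha.trans_le (min_le_right _ _)
      rw [lt_div_iff₀ (by positivity)] at h1
      rw [div_mul_eq_mul_div, div_lt_iff₀ hrpos]
      linarith
    -- With `b = (1 - t) a + t z`, these weights express a as a convex combination of b and a point
    -- of the ball around `y₀`, so a would lie in B.
    have h2 := hB hb hy (a := 1 / (1 + t * r)) (b := t * r / (1 + t * r)) (by positivity)
      (by positivity) (by field_simp)
    convert h2 using 1
    have h3 : 0 < 1 + t * r := by positivity
    obtain rfl : s = 1 - t := by linarith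
    rw [hz]
    match_scalars <;> field_simp <;> ring
  · rintro y ⟨hy, hyd⟩
    exact ⟨hεV hy, fun h => disjoint_left.1 hyd (left_mem_segment _ _ _) h⟩

/-- A ball minus the ray R is star-shaped about a point z on the opposite side of x. Points of R are
limits of points off R in a transverse direction, so restoring those outside B keeps the set
connected. -/
theorem connectedAt_compl_of_subset_ray (hP : 1 < Module.finrank ℝ P) {x d : P} (hd : d ≠ 0)
    {B : Set P} (hB : ∀ y ∈ B, ∃ τ : ℝ, 0 ≤ τ ∧ y = x + τ • d) : ConnectedAt Bᶜ x := by
  intro V hV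
  obtain ⟨ε, hε, hεV⟩ := Metric.mem_nhds_iff.1 hV
  refine ⟨ball x ε, ball_mem_nhds _ hε, ball x ε ∩ Bᶜ, ?_, subset_rfl,
    inter_subset_inter_left _ hεV⟩
  set R : Set P := {y | ∃ τ : ℝ, 0 ≤ τ ∧ y = x + τ • d} with hR
  have hdn : 0 < ‖d‖ := norm_pos_iff.2 hd
  set r : ℝ := ε / (2 * ‖d‖) with hr
  have hrpos : 0 < r := by positivity
  set z := x - r • d with hz
  have hzε : z ∈ ball x ε := by
    rw [mem_ball, dist_eq_norm, hz, sub_sub_cancel_left, norm_neg, norm_smul, Real.norm_eq_abs,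
      abs_of_pos hrpos, hr, div_mul_eq_mul_div, div_lt_iff₀ (by positivity)]
    nlinarith
  have h1 : IsPreconnected (ball x ε ∩ Rᶜ) := by
    apply isPreconnected_of_segment (z := z)
    rintro y ⟨hy, hyR⟩ w hw
    refine ⟨(convex_ball x ε).segment_subset hy hzε hw, ?_⟩
    rintro ⟨τ, hτ, hwτ⟩
    obtain ⟨s, t, hs, ht, hst, rfl⟩ := hw
    rcases hs.eq_or_lt with rfl | hs
    · obtain rfl : t = 1 := by linarith
      have h2 : (τ + r) • d = 0 := by
        rw [zero_smul, one_smul, zero_add, hz] at hwτ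
        have : x - r • d - (x + τ • d) = 0 := sub_eq_zero.2 hwτ
        rw [← neg_eq_zero, ← this]; module
      rcases smul_eq_zero.1 h2 with h3 | h3
      · linarith
      · exact hd h3
    · apply hyR
      refine ⟨(τ + t * r) / s, by positivity, ?_⟩
      have h2 : s • y = s • x + (τ + t * r) • d := by
        obtain rfl : s = 1 - t := by linarith
        have : (1 - t) • y = (x + τ • d) - t • z := by rw [← hwτ]; module
        rw [this, hz]; module
      have h3 : y = s⁻¹ • (s • y) := by rw [smul_smul, inv_mul_cancel₀ hs.ne', one_smul]
      rw [h3, h2, smul_add, smul_smul, smul_smul, inv_mul_cancel₀ hs.ne', one_smul]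
      congr 2
      field_simp
  refine h1.subset_closure (inter_subset_inter_right _ (compl_subset_compl.2 hB)) ?_
  rintro y ⟨hy, -⟩
  by_cases hyR : y ∈ R
  · obtain ⟨τ, hτ, rfl⟩ := hyR
    obtain ⟨e, he⟩ : ∃ e : P, e ∉ Submodule.span ℝ {d} := by
      by_contra! hall
      have h2 : Submodule.span ℝ {d} = ⊤ := by rw [eq_top_iff]; exact fun e _ => hall e
      have h3 := finrank_span_le_card (R := ℝ) ({d} : Set P)
      rw [h2, finrank_top] at h3
      simp at h3
      omega
    have hlim : Tendsto (fun s : ℝ => x + τ • d + s • e) (𝓝[≠] 0) (𝓝 (x + τ • d)) := by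
      have : Continuous fun s : ℝ => x + τ • d + s • e := by fun_prop
      have h2 := this.tendsto 0
      simp only [zero_smul, add_zero] at h2
      exact h2.mono_left nhdsWithin_le_nhds
    refine mem_closure_of_tendsto hlim ?_
    filter_upwards [hlim (isOpen_ball.mem_nhds hy), self_mem_nhdsWithin] with s hs hs0
    refine ⟨hs, ?_⟩
    rintro ⟨τ', -, h2⟩
    apply he
    rw [Submodule.mem_span_singleton]
    refine ⟨s⁻¹ * (τ' - τ), ?_⟩
    have h3 : s • e = (τ' - τ) • d := by
      have : s • e = (x + τ • d + s • e) - (x + τ • d) := by abel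
      rw [this, h2]; module
    rw [mul_smul, ← h3, smul_smul, inv_mul_cancel₀ hs0, one_smul]
  · exact subset_closure ⟨hy, hyR⟩

end planar

/-! ### Faces of a convex body -/

section face

variable {K : Set E3} {n : E3} {c : ℝ}

theorem lt_inner_of_mem_interior (hn : n ≠ 0) (hKc : ∀ y ∈ K, c ≤ inner ℝ n y) {x₀ : E3}
    (hx₀ : x₀ ∈ interior K) : c < inner ℝ n x₀ := by
  have hlim : Tendsto (fun t : ℝ => x₀ - t • n) (𝓝[>] 0) (𝓝 x₀) := by
    have : Continuous fun t : ℝ => x₀ - t • n := by fun_prop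
    have h2 := this.tendsto 0
    simp only [zero_smul, sub_zero] at h2
    exact h2.mono_left nhdsWithin_le_nhds
  obtain ⟨t, ht, ht0⟩ := ((hlim.eventually_mem (mem_interior_iff_mem_nhds.1 hx₀)).and
    self_mem_nhdsWithin).exists
  have h1 := hKc _ ht
  rw [inner_sub_right, inner_smul_right] at h1
  have h2 : 0 < t * inner ℝ n n := mul_pos ht0 (real_inner_self_pos.2 hn)
  linarith

theorem face_subset_frontier (hn : n ≠ 0) (hKc : ∀ y ∈ K, c ≤ inner ℝ n y) :
    K ∩ plane n c ⊆ frontier K := by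
  rintro y ⟨hy, hyc⟩
  refine ⟨subset_closure hy, fun hi => ?_⟩
  exact (lt_inner_of_mem_interior hn hKc hi).ne' hyc

/-- A chart of the boundary of `K` by the plane of a face, fixing the face. -/
theorem exists_face_chart (hK : IsSolidBody K) (hn : n ≠ 0) (hKc : ∀ y ∈ K, c ≤ inner ℝ n y)
    {x : E3} (hx : x ∈ K) (hxc : x ∈ plane n c) :
    ∃ (Ψ : (ℝ ∙ n)ᗮ → E3) (Φ : E3 → (ℝ ∙ n)ᗮ) (O : Set E3), IsOpen O ∧ Continuous Ψ ∧
      ContinuousOn Φ O ∧ (∀ w, Ψ w ∈ frontier K ∧ Ψ w ∈ O) ∧ (∀ w, Φ (Ψ w) = w) ∧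
      (∀ y ∈ frontier K, y ∈ O → Ψ (Φ y) = y) ∧ Ψ 0 = x ∧
      (∀ w, map Ψ (𝓝 w) = 𝓝[frontier K] (Ψ w)) ∧
      (∀ S ⊆ K ∩ plane n c, ∀ w, Ψ w ∈ S ↔ x + w ∈ S) := by
  obtain ⟨x₀, hx₀⟩ := hK.2.2
  have hpos : 0 < inner ℝ n (x₀ - x) := by
    have := lt_inner_of_mem_interior hn hKc hx₀
    rw [inner_sub_right, show inner ℝ n x = c from hxc]
    linarith
  obtain ⟨Ψ, Φ, c1, c2, c3, c4, c5, c6, c7, -⟩ := exists_central_chart hK hx₀ hpos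
  have hxf : x ∈ frontier K := face_subset_frontier hn hKc ⟨hx, hxc⟩
  refine ⟨Ψ, Φ, _, isOpen_inner_sub_pos n x₀, c1, c3, c2, c4, c5, ?_, ?_, ?_⟩
  · simpa using c6 0 (by simpa using hxf)
  · exact map_nhds_central_chart c1 c2 (isOpen_inner_sub_pos n x₀) c3 c4 c5
  · intro S hS w
    constructor
    · intro hw
      have h1 : Ψ w - x ∈ (ℝ ∙ n)ᗮ := by
        rw [Submodule.mem_orthogonal_singleton_iff_inner_right, inner_sub_right,
          show inner ℝ n (Ψ w) = c from (hS hw).2, show inner ℝ n x = c from hxc, sub_self]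
      have h2 := c7 ⟨_, h1⟩
      simp only [add_sub_cancel] at h2
      rw [c4] at h2
      have h3 : (w : E3) = Ψ w - x := congrArg Subtype.val h2
      rw [h3, add_sub_cancel]
      exact hw
    · intro hw
      rw [c6 w (face_subset_frontier hn hKc (hS hw))]
      exact hw

/-- The central chart fixes the face pointwise, so being a neighborhood in ∂K can be tested in the
plane of the face. -/
theorem mem_nhdsWithin_frontier_iff_face (hK : IsSolidBody K) (hn : n ≠ 0)
    (hKc : ∀ y ∈ K, c ≤ inner ℝ n y) {S : Set E3} (hS : S ⊆ K ∩ plane n c) {x : E3}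
    (hx : x ∈ K) (hxc : x ∈ plane n c) :
    S ∈ 𝓝[frontier K] x ↔ {w : (ℝ ∙ n)ᗮ | x + w ∈ S} ∈ 𝓝 0 := by
  obtain ⟨Ψ, Φ, O, -, -, -, -, -, -, c6, c7, c8⟩ := exists_face_chart hK hn hKc hx hxc
  rw [← c6, ← c7, mem_map]
  have : Ψ ⁻¹' S = {w : (ℝ ∙ n)ᗮ | x + w ∈ S} := by
    ext w
    exact c8 S hS w
  rw [this, c6]

theorem connectedAt_frontier_diff (hK : IsSolidBody K) (hn : n ≠ 0)
    (hKc : ∀ y ∈ K, c ≤ inner ℝ n y) {S : Set E3} (hS : S ⊆ K ∩ plane n c) {x : E3}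
    (hx : x ∈ K) (hxc : x ∈ plane n c) (h : ConnectedAt {w : (ℝ ∙ n)ᗮ | x + w ∈ S}ᶜ 0) :
    ConnectedAt (frontier K \ S) x := by
  obtain ⟨Ψ, Φ, O, c1, c2, c3, c4, c5, c5', c6, c7, c8⟩ := exists_face_chart hK hn hKc hx hxc
  intro V hV
  have hΦx : Φ x = 0 := by rw [← c6, c5]
  have hxO : x ∈ O := by rw [← c6]; exact (c4 0).2
  obtain ⟨V', hV', E, hE, hVE, hEV⟩ := h (Ψ ⁻¹' V)
    (c2.continuousAt.preimage_mem_nhds (by rwa [c6]))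
  refine ⟨O ∩ Φ ⁻¹' V', inter_mem (c1.mem_nhds hxO)
    ((c3.continuousAt (c1.mem_nhds hxO)).preimage_mem_nhds (by rwa [hΦx])), Ψ '' E,
    hE.image _ c2.continuousOn, ?_, ?_⟩
  · rintro y ⟨⟨hyO, hyV⟩, hyf, hyS⟩
    refine ⟨Φ y, hVE ⟨hyV, fun hw => hyS ?_⟩, c5' y hyf hyO⟩
    rw [← c5' y hyf hyO]
    exact (c8 S hS _).2 hw
  · rintro _ ⟨w, hw, rfl⟩
    exact ⟨(hEV hw).1, (c4 w).1, fun h => (hEV hw).2 ((c8 S hS _).1 h)⟩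

end face

/-! ### Lifts and their closures -/

section lift

variable {X Y : Type*} [TopologicalSpace X] [TopologicalSpace Y]

/-- `g` is a continuous right inverse of `f` over `A`. -/
def IsLift (f : X → Y) (A : Set Y) (g : Y → X) : Prop :=
  ContinuousOn g A ∧ ∀ a ∈ A, f (g a) = a

variable {f : X → Y} {A : Set Y} {g : Y → X}

/-- On the image of the lift, `g ∘ f` is the identity. Continuity of g at `f p` compares the limit p
with `g (f p)`, so taking the closure adds no second sheet over A. -/
theorem IsLift.eq_of_mem_closure [T2Space X] (hg : IsLift f A g) (hf : Continuous f) {p : X}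
    (hp : p ∈ closure (g '' A)) (hpA : f p ∈ A) : p = g (f p) := by
  have h1 : (𝓝[g '' A] p).NeBot := mem_closure_iff_nhdsWithin_neBot.1 hp
  have h2 : Tendsto f (𝓝[g '' A] p) (𝓝[A] (f p)) := by
    apply tendsto_nhdsWithin_of_tendsto_nhds_of_eventually_within
    · exact hf.continuousAt.mono_left nhdsWithin_le_nhds
    · filter_upwards [self_mem_nhdsWithin] with _ ⟨a, ha, hga⟩
      rw [← hga, hg.2 a ha]
      exact ha
  have h3 : Tendsto (g ∘ f) (𝓝[g '' A] p) (𝓝 (g (f p))) := (hg.1 _ hpA).tendsto.comp h2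
  have h4 : Tendsto (g ∘ f) (𝓝[g '' A] p) (𝓝 p) := by
    have : Tendsto id (𝓝[g '' A] p) (𝓝 p) := nhdsWithin_le_nhds
    refine this.congr' ?_
    filter_upwards [self_mem_nhdsWithin] with _ ⟨a, ha, hga⟩
    rw [← hga]
    simp [hg.2 a ha]
  exact tendsto_nhds_unique h4 h3

theorem IsLift.uniqueFiber [T2Space X] (hg : IsLift f A g) (hf : Continuous f) {a : Y}
    (ha : a ∈ A) : UniqueFiber f (closure (g '' A)) a := by
  rintro p hp q hq hpa rfl
  rw [hg.eq_of_mem_closure hf hp (by rwa [hpa]), hg.eq_of_mem_closure hf hq ha, hpa]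

theorem IsLift.image_image (hg : IsLift f A g) : f '' (g '' A) = A := by
  ext a
  constructor
  · rintro ⟨_, ⟨a, ha, rfl⟩, rfl⟩
    rwa [hg.2 a ha]
  · intro ha
    exact ⟨g a, ⟨a, ha, rfl⟩, hg.2 a ha⟩

theorem IsLift.image_closure [T2Space X] [CompactSpace X] [T2Space Y] (hg : IsLift f A g)
    (hf : Continuous f) : f '' closure (g '' A) = closure A := by
  rw [← hf.isClosedMap.closure_image_eq_of_continuous hf, hg.image_image]

theorem IsLift.subset_closure_inter (hg : IsLift f A g) :
    closure (g '' A) ⊆ closure (closure (g '' A) ∩ f ⁻¹' A) := by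
  apply closure_mono
  rintro _ ⟨a, ha, rfl⟩
  exact ⟨subset_closure ⟨a, ha, rfl⟩, by rwa [mem_preimage, hg.2 a ha]⟩

end lift

/-- A lift over the complement of a two-dimensional convex subset of a face of `K` extends
injectively to the closure. -/
theorem injOn_closure_lift {M : Type*} [TopologicalSpace M] [T2Space M] [CompactSpace M]
    {f : M → E3} (hf : Continuous f) (hloc : ∀ p, ∃ U ∈ 𝓝 p, InjOn f U) {K : Set E3}
    (hK : IsSolidBody K) {n : E3} {c : ℝ} (hn : n ≠ 0) (hKc : ∀ y ∈ K, c ≤ inner ℝ n y)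
    {B : Set E3} (hB : B ⊆ K ∩ plane n c) (hBc : Convex ℝ B) {y : E3} (hy : y ∈ B)
    (hyB : B ∈ 𝓝[frontier K] y) {g : E3 → M} (hg : IsLift f (frontier K \ B) g) :
    InjOn f (closure (g '' (frontier K \ B))) := by
  intro p hp q hq hpq
  by_cases hA : f q ∈ frontier K \ B
  · exact hg.uniqueFiber hf hA p hp q hq hpq rfl
  · have hfr : f q ∈ frontier K := by
      have h1 : f q ∈ closure (frontier K \ B) := by
        rw [← hg.image_closure hf]; exact ⟨q, hq, rfl⟩
      exact closure_minimal sdiff_subset isClosed_frontier h1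
    have hqB : f q ∈ B := by
      by_contra h
      exact hA ⟨hfr, h⟩
    -- Only points over B are left. There, in the plane of the face, the complement of the convex
    -- set B with nonempty interior is connected at small scales.
    refine uniqueFiber_of_connectedAt hf hloc (A := frontier K \ B) ?_ isClosed_closure
      (fun a ha => hg.uniqueFiber hf ha) hg.subset_closure_inter ?_ p hp q hq hpq rfl
    · rw [hg.image_closure hf]; exact subset_closure
    · refine connectedAt_frontier_diff hK hn hKc hB (hB hqB).1 (hB hqB).2 ?_
      refine connectedAt_compl_of_interior ?_ ?_ 0
      · have h1 := hBc.translate_preimage_right (f q)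
        exact h1.is_linear_preimage (f := ((ℝ ∙ n)ᗮ).subtype) ((ℝ ∙ n)ᗮ).subtype.isLinear
      · rw [mem_nhdsWithin_frontier_iff_face hK hn hKc hB (hB hy).1 (hB hy).2] at hyB
        have h1 : y - f q ∈ (ℝ ∙ n)ᗮ := by
          rw [Submodule.mem_orthogonal_singleton_iff_inner_right, inner_sub_right,
            show inner ℝ n y = c from (hB hy).2, show inner ℝ n (f q) = c from (hB hqB).2, sub_self]
        refine ⟨⟨_, h1⟩, mem_interior_iff_mem_nhds.2 ?_⟩
        have h2 : Tendsto (fun w : (ℝ ∙ n)ᗮ => w - ⟨_, h1⟩) (𝓝 ⟨_, h1⟩) (𝓝 0) := by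
          have : Continuous (fun w : (ℝ ∙ n)ᗮ => w - ⟨_, h1⟩) := by fun_prop
          simpa using this.tendsto ⟨_, h1⟩
        filter_upwards [h2 hyB] with w hw
        simp only [mem_preimage, mem_ofPred_eq, Submodule.coe_sub] at hw ⊢
        convert hw using 1
        abel

theorem mem_closure_diff_iff {X : Type*} [TopologicalSpace X] {S F : Set X} {d : X} :
    d ∈ closure (S \ F) ↔ F ∉ 𝓝[S] d := by
  rw [mem_closure_iff_frequently, nhdsWithin, mem_inf_principal, ← Filter.Eventually,
    Filter.Frequently, not_iff_not]
  apply eventually_congr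
  filter_upwards with z
  simp only [Set.mem_sdiff, not_and, not_not]

theorem eventually_smul_mem {E : Type*} [NormedAddCommGroup E] [NormedSpace ℝ E]
    {s : Set E} (hs : s ∈ 𝓝 0) (w : E) : ∀ᶠ t : ℝ in 𝓝[>] 0, t • w ∈ s := by
  have : Continuous fun t : ℝ => t • w := by fun_prop
  have h2 := this.tendsto 0
  rw [zero_smul] at h2
  exact (h2.mono_left nhdsWithin_le_nhds) hs

/-- A functional that is maximal on a planar set at a relative interior point is normal to the
plane. -/
theorem exists_eq_smul_of_forall_le {n k y : E3} {F : Set E3}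
    (hy : {w : (ℝ ∙ n)ᗮ | y + w ∈ F} ∈ 𝓝 0) (hk : ∀ z ∈ F, inner ℝ k z ≤ inner ℝ k y) :
    ∃ a : ℝ, k = a • n := by
  have h1 : ∀ w : (ℝ ∙ n)ᗮ, inner ℝ k (w : E3) ≤ 0 := fun w => by
    obtain ⟨t, ht, ht0⟩ := ((eventually_smul_mem hy w).and self_mem_nhdsWithin).exists
    have h2 := hk _ ht
    rw [inner_add_right, Submodule.coe_smul, inner_smul_right] at h2
    have h3 : 0 < t := ht0
    nlinarith
  have h2 : k ∈ (ℝ ∙ n)ᗮᗮ := by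
    rw [Submodule.mem_orthogonal']
    intro w hw
    have h3 := h1 ⟨w, hw⟩
    have h4 := h1 (-⟨w, hw⟩)
    simp only [Submodule.coe_neg, inner_neg_right] at h4
    linarith
  rw [Submodule.orthogonal_orthogonal, Submodule.mem_span_singleton] at h2
  obtain ⟨a, ha⟩ := h2
  exact ⟨a, ha.symm⟩

theorem relint_segment {n y z : E3} {F : Set E3} (hF : Convex ℝ F)
    (hy : {w : (ℝ ∙ n)ᗮ | y + w ∈ F} ∈ 𝓝 0) (hz : z ∈ F) {t : ℝ} (ht : t ∈ Ico (0 : ℝ) 1) :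
    {w : (ℝ ∙ n)ᗮ | y + t • (z - y) + w ∈ F} ∈ 𝓝 0 := by
  have h1 : 0 < 1 - t := by linarith [ht.2]
  have h2 : Tendsto (fun w : (ℝ ∙ n)ᗮ => (1 - t)⁻¹ • w) (𝓝 0) (𝓝 0) := by
    have : Continuous (fun w : (ℝ ∙ n)ᗮ => (1 - t)⁻¹ • w) := by fun_prop
    simpa using this.tendsto 0
  filter_upwards [h2 hy] with w hw
  have h3 := hF hw hz h1.le ht.1 (by ring)
  convert h3 using 1
  simp only [Submodule.coe_smul]
  match_scalars <;> field_simp; ring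

theorem sub_inner_smul_mem {n : E3} (hn : ‖n‖ = 1) (v : E3) : v - inner ℝ n v • n ∈ (ℝ ∙ n)ᗮ := by
  rw [Submodule.mem_orthogonal_singleton_iff_inner_right, inner_sub_right, inner_smul_right,
    real_inner_self_eq_norm_sq, hn]
  ring

/-- Orthogonal projection along the unit vector `n`. -/
noncomputable def projAlong {n : E3} (hn : ‖n‖ = 1) (v : E3) : (ℝ ∙ n)ᗮ :=
  ⟨v - inner ℝ n v • n, sub_inner_smul_mem hn v⟩

theorem norm_projAlong_sq {n : E3} (hn : ‖n‖ = 1) (v : E3) :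
    ‖projAlong hn v‖ ^ 2 = ‖v‖ ^ 2 - (inner ℝ n v) ^ 2 := by
  rw [projAlong, Submodule.coe_norm, norm_sub_sq_real, norm_smul, hn, inner_smul_right,
    real_inner_comm, Real.norm_eq_abs, mul_one, sq_abs]
  ring

theorem projAlong_smul {n : E3} (hn : ‖n‖ = 1) (t : ℝ) (v : E3) :
    projAlong hn (t • v) = t • projAlong hn v := by
  apply Subtype.ext
  simp only [projAlong, Submodule.coe_smul, inner_smul_right]
  module

theorem continuous_projAlong {n : E3} (hn : ‖n‖ = 1) : Continuous (projAlong hn) :=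
  Continuous.subtype_mk (by fun_prop) _

/-! ### The complement of a two-dimensional face is a cap -/

section cap

variable {K : Set E3} {n : E3} {c : ℝ}

/-- A support functional at such a limit point takes equal values at y and d. Being maximal on F at
the relative interior point y, it is a multiple of n, so d lies in F and the point itself is
relatively interior to F; there ∂K coincides with F. This gives injectivity of the radial projection
from y. -/
theorem notMem_closure_of_mem_open_segment (hK : IsSolidBody K) (hn : n ≠ 0)
    (hKc : ∀ z ∈ K, c ≤ inner ℝ n z) {y d : E3} (hy : y ∈ K ∩ plane n c)
    (hyF : {w : (ℝ ∙ n)ᗮ | y + w ∈ K ∩ plane n c} ∈ 𝓝 0) (hd : d ∈ K) {t : ℝ}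
    (ht : t ∈ Ioo (0 : ℝ) 1) :
    y + t • (d - y) ∉ closure (frontier K \ (K ∩ plane n c)) := by
  intro hmem
  have hfr : y + t • (d - y) ∈ frontier K := closure_minimal sdiff_subset isClosed_frontier hmem
  obtain ⟨k, hk, hk'⟩ := hK.exists_support hfr.2
  have h1 := hk' y hy.1
  have h2 := hk' d hd
  have e : inner ℝ k (y + t • (d - y)) = (1 - t) * inner ℝ k y + t * inner ℝ k d := by
    rw [inner_add_right, inner_smul_right, inner_sub_right]; ring
  rw [e] at h1 h2
  have h3 : inner ℝ k d = inner ℝ k y := by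
    have := ht.1
    have := ht.2
    apply le_antisymm <;> nlinarith
  obtain ⟨a, rfl⟩ := exists_eq_smul_of_forall_le (k := k) hyF fun z hz => by
    have := hk' z hz.1
    rw [e, h3] at this
    linarith
  have ha : a ≠ 0 := by
    rintro rfl
    obtain ⟨x₀, hx₀⟩ := hK.2.2
    have := hk x₀ hx₀
    simp at this
  rw [real_inner_smul_left, real_inner_smul_left] at h3
  have hdF : d ∈ K ∩ plane n c := ⟨hd, (mul_left_cancel₀ ha h3).trans hy.2⟩
  have hconv : Convex ℝ (K ∩ plane n c) := by
    apply hK.1.inter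
    exact convex_hyperplane (f := fun z => inner ℝ n z) ⟨fun a b => inner_add_right _ _ _,
      fun a b => inner_smul_right _ _ _⟩ c
  have h4 := relint_segment hconv hyF hdF ⟨ht.1.le, ht.2⟩
  have h5 : y + t • (d - y) ∈ K ∩ plane n c := by
    have := mem_of_mem_nhds h4
    simpa using this
  rw [← mem_nhdsWithin_frontier_iff_face hK hn hKc subset_rfl h5.1 h5.2] at h4
  exact mem_closure_diff_iff.1 hmem h4

/-- The last point of K on the ray works: it cannot be relatively interior to F, since the ray would
then continue inside F. This gives surjectivity of the radial projection from y. -/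
theorem exists_mem_closure_on_ray (hK : IsSolidBody K) (hn : n ≠ 0)
    (hKc : ∀ z ∈ K, c ≤ inner ℝ n z) {y u : E3} (hy : y ∈ K ∩ plane n c)
    (hyF : {w : (ℝ ∙ n)ᗮ | y + w ∈ K ∩ plane n c} ∈ 𝓝 0) (hu : ‖u‖ = 1) (hun : 0 ≤ inner ℝ n u) :
    ∃ τ : ℝ, 0 < τ ∧ y + τ • u ∈ closure (frontier K \ (K ∩ plane n c)) := by
  obtain ⟨x₀, hx₀⟩ := hK.2.2
  have hx₀c := lt_inner_of_mem_interior hn hKc hx₀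
  obtain ⟨ε, hε, hεK⟩ : ∃ ε : ℝ, 0 < ε ∧ y + ε • u ∈ K := by
    -- With this s the vector `u - s • (x₀ - y)` is parallel to the plane. Hence a short step along
    -- u is half a step inside F plus half a step towards the interior point `x₀`.
    set s := inner ℝ n u / (inner ℝ n x₀ - c) with hs
    have hs0 : 0 ≤ s := div_nonneg hun (by linarith)
    have hw₀ : u - s • (x₀ - y) ∈ (ℝ ∙ n)ᗮ := by
      rw [Submodule.mem_orthogonal_singleton_iff_inner_right, inner_sub_right, inner_smul_right,
        inner_sub_right, show inner ℝ n y = c from hy.2, hs, div_mul_cancel₀ _ (by linarith),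
        sub_self]
    have h1 := eventually_smul_mem hyF ⟨_, hw₀⟩
    have h2 : ∀ᶠ t : ℝ in 𝓝[>] 0, t * s < 1 := by
      have : Continuous fun t : ℝ => t * s := by fun_prop
      have h3 := this.tendsto 0
      rw [zero_mul] at h3
      exact (h3.mono_left nhdsWithin_le_nhds).eventually_lt_const one_pos
    obtain ⟨t, ⟨h3, h4⟩, h5⟩ := ((h1.and h2).and self_mem_nhdsWithin).exists
    have h5 : 0 < t := h5
    refine ⟨t / 2, by positivity, ?_⟩
    have h6 : y + (t * s) • (x₀ - y) ∈ K :=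
      hK.1.add_smul_sub_mem hy.1 (interior_subset hx₀) ⟨by positivity, h4.le⟩
    have hconv : Convex ℝ K := hK.1
    have h7 := hconv h3.1 h6 (a := (1 / 2 : ℝ)) (b := (1 / 2 : ℝ)) (by norm_num) (by norm_num) (by norm_num)
    convert h7 using 1
    simp only [Submodule.coe_smul]
    module
  obtain ⟨R, hR⟩ := hK.2.1.isBounded.exists_norm_le
  set T : Set ℝ := {τ | 0 ≤ τ ∧ y + τ • u ∈ K} with hT
  have hTc : IsCompact T := by
    apply IsCompact.of_isClosed_subset (isCompact_Icc (a := (0 : ℝ)) (b := 2 * R))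
    · exact isClosed_Ici.inter (hK.isClosed.preimage (by fun_prop : Continuous fun τ : ℝ => y + τ • u))
    · rintro τ ⟨h0, hτ⟩
      refine ⟨h0, ?_⟩
      have h1 := hR _ hτ
      have h2 := hR _ hy.1
      have h3 : ‖τ • u‖ = τ := by rw [norm_smul, hu, mul_one, Real.norm_eq_abs, abs_of_nonneg h0]
      have h4 : ‖τ • u‖ ≤ ‖y + τ • u‖ + ‖y‖ := by
        have := norm_sub_le (y + τ • u) y
        rwa [add_sub_cancel_left] at this
      linarith
  obtain ⟨τ, ⟨hτ0, hτK⟩, hmax⟩ := hTc.exists_isMaxOn ⟨ε, hε.le, hεK⟩ continuousOn_id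
  have hmax' : ∀ t : ℝ, 0 < t → y + τ • u + t • u ∉ K := fun t ht h => by
    have h1 : τ + t ∈ T := ⟨by positivity, by rwa [add_smul, ← add_assoc]⟩
    have := hmax h1
    simp only [id, mem_ofPred_eq] at this
    linarith
  have hτpos : 0 < τ := by
    have h1 : ε ∈ T := ⟨hε.le, hεK⟩
    have := hmax h1
    simp only [id, mem_ofPred_eq] at this
    linarith
  refine ⟨τ, hτpos, ?_⟩
  have hfr : y + τ • u ∈ frontier K := by
    refine ⟨subset_closure hτK, fun hi => ?_⟩
    have h1 : (fun v => y + τ • u + v) ⁻¹' K ∈ 𝓝 (0 : E3) := by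
      apply (by fun_prop : Continuous fun v => y + τ • u + v).continuousAt.preimage_mem_nhds
      rw [add_zero]
      exact mem_interior_iff_mem_nhds.1 hi
    obtain ⟨t, ht, ht0⟩ := ((eventually_smul_mem h1 u).and self_mem_nhdsWithin).exists
    exact hmax' t ht0 ht
  by_cases hc : y + τ • u ∈ K ∩ plane n c
  · rw [mem_closure_diff_iff, mem_nhdsWithin_frontier_iff_face hK hn hKc subset_rfl hc.1 hc.2]
    intro h1
    have hup : u ∈ (ℝ ∙ n)ᗮ := by
      rw [Submodule.mem_orthogonal_singleton_iff_inner_right]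
      have h2 : inner ℝ n (y + τ • u) = c := hc.2
      rw [inner_add_right, inner_smul_right, show inner ℝ n y = c from hy.2] at h2
      have h3 : τ * inner ℝ n u = 0 := by linarith
      exact (mul_eq_zero.1 h3).resolve_left hτpos.ne'
    obtain ⟨t, ht, ht0⟩ := ((eventually_smul_mem h1 ⟨u, hup⟩).and self_mem_nhdsWithin).exists
    exact hmax' t ht0 ht.1
  · exact subset_closure ⟨hfr, hc⟩

/-- Removing the relative interior of a two-dimensional face from the boundary of a convex body
leaves a nondegenerate cap. -/
theorem isNondegenerateCap_of_face (hK : IsSolidBody K) (hn : ‖n‖ = 1)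
    (hKc : ∀ z ∈ K, c ≤ inner ℝ n z) {y : E3} (hy : y ∈ K ∩ plane n c)
    (hyF : K ∩ plane n c ∈ 𝓝[frontier K] y) :
    IsNondegenerateCap (closure (frontier K \ (K ∩ plane n c))) := by
  have hn0 : n ≠ 0 := by
    rintro rfl
    simp at hn
  have hyD : y ∉ closure (frontier K \ (K ∩ plane n c)) := fun h => mem_closure_diff_iff.1 h hyF
  rw [mem_nhdsWithin_frontier_iff_face hK hn0 hKc subset_rfl hy.1 hy.2] at hyF
  set D := closure (frontier K \ (K ∩ plane n c)) with hD
  have hDfr : D ⊆ frontier K := closure_minimal sdiff_subset isClosed_frontier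
  have hDcomp : IsCompact D := hK.2.1.of_isClosed_subset isClosed_closure
    (hDfr.trans hK.frontier_subset)
  have hpos : ∀ d : D, 0 < ‖(d : E3) - y‖ := fun d => norm_pos_iff.2 (sub_ne_zero.2 fun h =>
    hyD (h ▸ d.2))
  have hin : ∀ d : D, 0 ≤ inner ℝ n ((d : E3) - y) := fun d => by
    rw [inner_sub_right, show inner ℝ n y = c from hy.2]
    linarith [hKc _ (hK.frontier_subset (hDfr d.2))]
  -- θ projects radially from y to the upper unit hemisphere and then vertically to the unit disk;
  -- the equator corresponds to the plane of the face.
  let θ : D → (ℝ ∙ n)ᗮ := fun d => ‖(d : E3) - y‖⁻¹ • projAlong hn ((d : E3) - y)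
  have hθc : Continuous θ := by
    have h1 : Continuous fun d : D => ‖(d : E3) - y‖⁻¹ :=
      Continuous.inv₀ (by fun_prop) fun d => (hpos d).ne'
    have h2 : Continuous fun d : D => projAlong hn ((d : E3) - y) :=
      (continuous_projAlong hn).comp (by fun_prop)
    exact h1.smul h2
  have hθn : ∀ d, ‖θ d‖ ^ 2 + (‖(d : E3) - y‖⁻¹ * inner ℝ n ((d : E3) - y)) ^ 2 = 1 := fun d => by
    have h1 := norm_projAlong_sq hn ((d : E3) - y)
    have h2 := hpos d
    simp only [θ]
    rw [norm_smul, mul_pow, h1, norm_inv, norm_norm]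
    field_simp
    ring
  have hθle : ∀ d, ‖θ d‖ ≤ 1 := fun d => by
    rw [← sq_le_one_iff₀ (norm_nonneg _)]
    nlinarith [hθn d, sq_nonneg (‖(d : E3) - y‖⁻¹ * inner ℝ n ((d : E3) - y))]
  have hdir : ∀ d : D, ‖(d : E3) - y‖⁻¹ • ((d : E3) - y) =
      (θ d : E3) + (‖(d : E3) - y‖⁻¹ * inner ℝ n ((d : E3) - y)) • n := fun d => by
    simp only [θ, projAlong, Submodule.coe_smul]
    module
  have hinj : Function.Injective θ := by
    intro d d' hdd
    have h1 := hθn d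
    have h2 := hθn d'
    rw [← hdd] at h2
    have h3 : ‖(d : E3) - y‖⁻¹ * inner ℝ n ((d : E3) - y) =
        ‖(d' : E3) - y‖⁻¹ * inner ℝ n ((d' : E3) - y) := by
      rw [← sq_eq_sq₀ (mul_nonneg (inv_nonneg.2 (norm_nonneg _)) (hin d))
        (mul_nonneg (inv_nonneg.2 (norm_nonneg _)) (hin d'))]
      linarith
    have h4 : ‖(d : E3) - y‖⁻¹ • ((d : E3) - y) = ‖(d' : E3) - y‖⁻¹ • ((d' : E3) - y) := by
      rw [hdir, hdir, h3, hdd]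
    have key : ∀ a b : D, ‖(a : E3) - y‖⁻¹ • ((a : E3) - y) = ‖(b : E3) - y‖⁻¹ • ((b : E3) - y) →
        ‖(a : E3) - y‖ < ‖(b : E3) - y‖ → False := fun a b hab hlt => by
      have h5 : (a : E3) = y + (‖(a : E3) - y‖ / ‖(b : E3) - y‖) • ((b : E3) - y) := by
        rw [div_eq_mul_inv, mul_smul, ← hab, smul_smul, mul_inv_cancel₀ (hpos a).ne', one_smul]
        abel
      have h6 := notMem_closure_of_mem_open_segment hK hn0 hKc hy hyF
        (hK.frontier_subset (hDfr b.2))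
        (t := ‖(a : E3) - y‖ / ‖(b : E3) - y‖)
        ⟨div_pos (hpos a) (hpos b), (div_lt_one (hpos b)).2 hlt⟩
      rw [← h5] at h6
      exact h6 a.2
    rcases lt_trichotomy ‖(d : E3) - y‖ ‖(d' : E3) - y‖ with h | h | h
    · exact (key d d' h4 h).elim
    · rw [h] at h4
      have h5 := smul_right_injective E3 (inv_ne_zero (hpos d').ne') h4
      exact Subtype.ext (sub_left_injective h5)
    · exact (key d' d h4.symm h).elim
  have hsurj : ∀ w : (ℝ ∙ n)ᗮ, ‖w‖ ≤ 1 → ∃ d, θ d = w := by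
    intro w hw
    have hw2 : 0 ≤ 1 - ‖w‖ ^ 2 := by nlinarith [norm_nonneg w]
    set u : E3 := w + √(1 - ‖w‖ ^ 2) • n with hu
    have hnu : inner ℝ n u = √(1 - ‖w‖ ^ 2) := by
      rw [hu, inner_add_right, inner_orthogonal_coe, inner_smul_right, real_inner_self_eq_norm_sq,
        hn]
      ring
    have hPu : projAlong hn u = w := by
      apply Subtype.ext
      simp only [projAlong, hnu]
      rw [hu, add_sub_cancel_right]
    have hu1 : ‖u‖ = 1 := by
      have h1 := norm_projAlong_sq hn u
      rw [hPu, hnu, Real.sq_sqrt hw2] at h1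
      rw [← sq_eq_sq₀ (norm_nonneg _) zero_le_one]
      linarith
    obtain ⟨τ, hτ, hd⟩ := exists_mem_closure_on_ray hK hn0 hKc hy hyF hu1
      (by rw [hnu]; exact Real.sqrt_nonneg _)
    refine ⟨⟨_, hd⟩, ?_⟩
    simp only [θ, add_sub_cancel_left]
    rw [norm_smul, hu1, mul_one, Real.norm_eq_abs, abs_of_pos hτ, projAlong_smul, hPu, smul_smul,
      inv_mul_cancel₀ hτ.ne', one_smul]
  let e : (ℝ ∙ n)ᗮ ≃ₗᵢ[ℝ] EuclideanSpace ℝ (Fin 2) :=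
    ((stdOrthonormalBasis ℝ (ℝ ∙ n)ᗮ).reindex (finCongr (finrank_orthogonal_span hn0))).repr
  let H : D → UnitDisk := fun d => ⟨e (θ d), by
    rw [mem_closedBall_zero_iff, LinearIsometryEquiv.norm_map]; exact hθle d⟩
  have hHc : Continuous H := Continuous.subtype_mk (e.continuous.comp hθc) _
  have hHb : Function.Bijective H := by
    constructor
    · intro d d' h
      exact hinj (e.injective (congrArg Subtype.val h))
    · intro z
      obtain ⟨d, hd⟩ := hsurj (e.symm z) (by
        rw [LinearIsometryEquiv.norm_map]; exact mem_closedBall_zero_iff.1 z.2)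
      refine ⟨d, Subtype.ext ?_⟩
      simp only [H, hd, LinearIsometryEquiv.apply_symm_apply]
  have : CompactSpace D := isCompact_iff_compactSpace.1 hDcomp
  let Φ : D ≃ₜ UnitDisk := Continuous.homeoOfEquivCompactToT2 (f := Equiv.ofBijective H hHb) hHc
  have hΦ : ∀ d, Φ d = H d := fun d => rfl
  have hrange : range (Subtype.val ∘ Φ.symm) = D := by
    rw [range_comp, Φ.symm.surjective.range_eq, image_univ, Subtype.range_coe]
  have hcircle : ∀ d : D, (d : E3) ∈ plane n c ↔
      ‖((Φ d : UnitDisk) : EuclideanSpace ℝ (Fin 2))‖ = 1 := fun d => by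
    have h1 : ‖((Φ d : UnitDisk) : EuclideanSpace ℝ (Fin 2))‖ = ‖θ d‖ := by
      rw [hΦ]; exact e.norm_map _
    have h2 := hθn d
    have h3 : (d : E3) ∈ plane n c ↔ inner ℝ n ((d : E3) - y) = 0 := by
      rw [inner_sub_right, show inner ℝ n y = c from hy.2, sub_eq_zero]; rfl
    rw [h1, h3]
    constructor
    · intro h
      rw [h] at h2
      rw [← sq_eq_sq₀ (norm_nonneg _) zero_le_one]
      linarith
    · intro h
      rw [h] at h2
      have h4 : ‖(d : E3) - y‖⁻¹ * inner ℝ n ((d : E3) - y) = 0 := by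
        rw [← sq_eq_zero_iff]; linarith
      exact (mul_eq_zero.1 h4).resolve_left (inv_ne_zero (hpos d).ne')
  refine ⟨K, n, c, Subtype.val ∘ Φ.symm, hK, hn0,
    IsEmbedding.subtypeVal.comp Φ.symm.isEmbedding, hrange, hDfr, ?_⟩
  ext x
  constructor
  · rintro ⟨hx, hxc⟩
    exact ⟨Φ ⟨x, hx⟩, (hcircle ⟨x, hx⟩).1 hxc, by simp⟩
  · rintro ⟨z, hz, rfl⟩
    refine ⟨(Φ.symm z).2, (hcircle (Φ.symm z)).2 ?_⟩
    rw [Φ.apply_symm_apply]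
    exact hz

end cap

/-! ### Thin residual sets force a closed surface -/

section

variable {M : Type*} [TopologicalSpace M] [CompactSpace M] {f : M → E3}

theorem image_inter_mem_nhdsWithin (hf : Continuous f) {C : Set M} (hC : IsClosed C)
    (hinj : InjOn f C) {p : M} (hp : p ∈ C) {U : Set M} (hU : U ∈ 𝓝 p) :
    f '' (C ∩ U) ∈ 𝓝[f '' C] (f p) := by
  have : Nonempty M := ⟨p⟩
  obtain ⟨g, hgc, hg⟩ := exists_inverse_on_image hC.isCompact hf.continuousOn hinj
  have h1 : g ⁻¹' U ∈ 𝓝[f '' C] (f p) := by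
    apply (hgc (f p) ⟨p, hp, rfl⟩).preimage_mem_nhdsWithin
    rwa [hg p hp]
  filter_upwards [h1, self_mem_nhdsWithin]
  rintro _ hy ⟨x, hx, rfl⟩
  rw [mem_preimage, hg x hx] at hy
  exact ⟨x, ⟨hx, hy⟩, rfl⟩

/-- Local injectivity gives an open neighborhood W of the diagonal in which distinct points have
distinct images. The exceptional points are the image of the compact set of pairs in `C ×ˢ C` with
equal images outside W. -/
theorem isClosed_setOf_not_uniqueFiber (hf : Continuous f) (hloc : ∀ p, ∃ U ∈ 𝓝 p, InjOn f U)
    {C : Set M} (hC : IsClosed C) : IsClosed {x | ¬ UniqueFiber f C x} := by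
  set W : Set (M × M) := ⋃ u ∈ {u : Set M | IsOpen u ∧ InjOn f u}, u ×ˢ u with hW
  have hWo : IsOpen W := isOpen_biUnion fun u hu => hu.1.prod hu.1
  have hZ : IsClosed ((C ×ˢ C) ∩ {z : M × M | f z.1 = f z.2} ∩ Wᶜ) :=
    ((hC.prod hC).inter (isClosed_eq (by fun_prop) (by fun_prop))).inter hWo.isClosed_compl
  have h1 : {x | ¬ UniqueFiber f C x} =
      (fun z : M × M => f z.1) '' ((C ×ˢ C) ∩ {z : M × M | f z.1 = f z.2} ∩ Wᶜ) := by
    ext x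
    constructor
    · intro hx
      simp only [mem_ofPred_eq, UniqueFiber, not_forall] at hx
      obtain ⟨p, hp, q, hq, hpx, hqx, hne⟩ := hx
      refine ⟨(p, q), ⟨⟨⟨hp, hq⟩, hpx.trans hqx.symm⟩, fun hw => ?_⟩, hpx⟩
      simp only [hW, mem_iUnion, exists_prop] at hw
      obtain ⟨u, hu, hpu, hqu⟩ := hw
      exact hne (hu.2 hpu hqu (hpx.trans hqx.symm))
    · rintro ⟨⟨p, q⟩, ⟨⟨⟨hp, hq⟩, hpq⟩, hw⟩, rfl⟩ hu
      have hpq' : p = q := hu p hp q hq rfl hpq.symm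
      subst hpq'
      apply hw
      obtain ⟨U, hU, hinj⟩ := hloc p
      obtain ⟨u, huU, hu, hpu⟩ := _root_.mem_nhds_iff.1 hU
      simp only [hW, mem_iUnion, exists_prop]
      exact ⟨u, ⟨hu, hinj.mono huU⟩, hpu, hpu⟩
  rw [h1]
  exact (hZ.isCompact.image (by fun_prop)).isClosed

/-- A convex set without interior points in a plane lies on a line. -/
theorem exists_subset_line {n b : E3} (hn : n ≠ 0) {B : Set E3} (hB : Convex ℝ B) (hb : b ∈ B)
    (hthin : ∀ y ∈ B, {w : (ℝ ∙ n)ᗮ | y + w ∈ B} ∉ 𝓝 0) :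
    ∃ d : (ℝ ∙ n)ᗮ, d ≠ 0 ∧ ∀ w : (ℝ ∙ n)ᗮ, b + w ∈ B → ∃ τ : ℝ, w = τ • d := by
  set B₀ : Set (ℝ ∙ n)ᗮ := {w | b + w ∈ B} with hB₀
  have h0 : (0 : (ℝ ∙ n)ᗮ) ∈ B₀ := by simpa [hB₀] using hb
  have hconv : Convex ℝ B₀ :=
    (hB.translate_preimage_right b).is_linear_preimage (f := ((ℝ ∙ n)ᗮ).subtype)
      ((ℝ ∙ n)ᗮ).subtype.isLinear
  have hint : ¬ (interior B₀).Nonempty := by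
    rintro ⟨w, hw⟩
    have hwB : w ∈ B₀ := interior_subset hw
    apply hthin (b + w) hwB
    have h1 : Tendsto (fun w' : (ℝ ∙ n)ᗮ => w + w') (𝓝 0) (𝓝 w) := by
      have : Continuous fun w' : (ℝ ∙ n)ᗮ => w + w' := by fun_prop
      simpa using this.tendsto 0
    filter_upwards [h1 (mem_interior_iff_mem_nhds.1 hw)] with w' hw'
    simpa [hB₀, add_assoc] using hw'
  rw [hconv.interior_nonempty_iff_affineSpan_eq_top,
    AffineSubspace.affineSpan_eq_top_iff_vectorSpan_eq_top_of_nonempty ℝ _ _ ⟨0, h0⟩,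
    vectorSpan_eq_span_vsub_set_right ℝ h0] at hint
  have hsub : (fun x : (ℝ ∙ n)ᗮ => x -ᵥ (0 : (ℝ ∙ n)ᗮ)) '' B₀ = B₀ := by simp
  rw [hsub] at hint
  have h2 := Submodule.finrank_lt hint
  rw [finrank_orthogonal_span hn] at h2
  have h3 : Module.finrank ℝ (Submodule.span ℝ B₀) ≤ 1 := by omega
  obtain ⟨v, hv⟩ := finrank_le_one_iff.1 h3
  have : Nontrivial (ℝ ∙ n)ᗮ := by
    apply Module.nontrivial_of_finrank_pos (R := ℝ)
    rw [finrank_orthogonal_span hn]; norm_num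
  by_cases hv0 : (v : (ℝ ∙ n)ᗮ) = 0
  · obtain ⟨d, hd⟩ := exists_ne (0 : (ℝ ∙ n)ᗮ)
    refine ⟨d, hd, fun w hw => ⟨0, ?_⟩⟩
    obtain ⟨a, ha⟩ := hv ⟨w, Submodule.subset_span hw⟩
    have h4 := congrArg Subtype.val ha
    simp only [Submodule.coe_smul, hv0, smul_zero] at h4
    rw [zero_smul, ← h4]
  · refine ⟨v, hv0, fun w hw => ?_⟩
    obtain ⟨a, ha⟩ := hv ⟨w, Submodule.subset_span hw⟩
    exact ⟨a, (congrArg Subtype.val ha).symm⟩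

/-- A convex B without interior lies on a line. The compact set of points with several preimages
would have an extreme point x on that line, with all the others on one ray from x. The complement of
a subset of this ray is connected near x, which makes the fiber over x unique after all. -/
theorem injOn_closure_lift_of_thin [T2Space M] (hf : Continuous f) (hloc : ∀ p, ∃ U ∈ 𝓝 p, InjOn f U)
    {K : Set E3} (hK : IsSolidBody K) {n : E3} {c : ℝ} (hn : n ≠ 0)
    (hKc : ∀ y ∈ K, c ≤ inner ℝ n y) {B : Set E3} (hB : B ⊆ K ∩ plane n c) (hBc : Convex ℝ B)
    (hthin : ∀ y ∈ B, B ∉ 𝓝[frontier K] y) {g : E3 → M} (hg : IsLift f (frontier K \ B) g) :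
    InjOn f (closure (g '' (frontier K \ B))) ∧ f '' closure (g '' (frontier K \ B)) = frontier K := by
  set C := closure (g '' (frontier K \ B)) with hC
  have himg : f '' C = frontier K := by
    rw [hC, hg.image_closure hf]
    apply subset_antisymm (closure_minimal sdiff_subset isClosed_frontier)
    intro x hx
    by_cases hxB : x ∈ B
    · exact mem_closure_diff_iff.2 (hthin x hxB)
    · exact subset_closure ⟨hx, hxB⟩
  refine ⟨?_, himg⟩
  set X : Set E3 := {x | ¬ UniqueFiber f C x} with hX
  have hXB : X ⊆ B := fun x hx => by
    by_contra hxB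
    apply hx
    by_cases hxf : x ∈ frontier K
    · exact hg.uniqueFiber hf ⟨hxf, hxB⟩
    · intro p hp q hq hpx
      exact (hxf (by rw [← himg, ← hpx]; exact ⟨p, hp, rfl⟩)).elim
  have hXc : IsCompact X := hK.2.1.of_isClosed_subset
    (isClosed_setOf_not_uniqueFiber hf hloc isClosed_closure) fun x hx => (hB (hXB hx)).1
  rcases X.eq_empty_or_nonempty with hXe | hXn
  · intro p hp q hq hpq
    have : f q ∉ X := by rw [hXe]; exact notMem_empty _
    rw [hX, mem_ofPred_eq, not_not] at this
    exact this p hp q hq hpq rfl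
  · exfalso
    obtain ⟨b, hb⟩ := hXn
    obtain ⟨d, hd, hline⟩ := exists_subset_line hn hBc (hXB hb) fun y hy => by
      rw [← mem_nhdsWithin_frontier_iff_face hK hn hKc hB (hB hy).1 (hB hy).2]
      exact hthin y hy
    have hline' : ∀ z ∈ B, ∃ τ : ℝ, z = b + τ • (d : E3) := fun z hz => by
      have h1 : z - b ∈ (ℝ ∙ n)ᗮ := by
        rw [Submodule.mem_orthogonal_singleton_iff_inner_right, inner_sub_right,
          show inner ℝ n z = c from (hB hz).2, show inner ℝ n b = c from (hB (hXB hb)).2, sub_self]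
      obtain ⟨τ, hτ⟩ := hline ⟨_, h1⟩ (by simpa using hz)
      have h2 := congrArg Subtype.val hτ
      simp only [Submodule.coe_smul] at h2
      exact ⟨τ, by rw [← h2]; abel⟩
    obtain ⟨x, hx, hmin⟩ := hXc.exists_isMinOn ⟨b, hb⟩ (f := fun z => inner ℝ (d : E3) z)
      (by fun_prop)
    -- Points of B before x have unique fibers by minimality of x, so only the part of B on the ray
    -- starting at x has to be removed.
    set B' := B ∩ {z | inner ℝ (d : E3) x ≤ inner ℝ (d : E3) z} with hB'
    have hdd : 0 < inner ℝ (d : E3) (d : E3) := real_inner_self_pos.2 (by simpa using hd)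
    have hxc : x ∈ K ∩ plane n c := hB (hXB hx)
    apply hx
    refine uniqueFiber_of_connectedAt hf hloc (A := frontier K \ B') ?_ isClosed_closure ?_ ?_ ?_
    · rw [himg]; exact sdiff_subset
    · rintro a ⟨haf, haB'⟩
      by_contra hau
      exact haB' ⟨hXB hau, hmin hau⟩
    · refine hg.subset_closure_inter.trans (closure_mono (inter_subset_inter_right _ ?_))
      exact preimage_mono (sdiff_subset_sdiff_right inter_subset_left)
    · refine connectedAt_frontier_diff hK hn hKc (inter_subset_left.trans hB) hxc.1 hxc.2 ?_
      refine connectedAt_compl_of_subset_ray (by rw [finrank_orthogonal_span hn]; norm_num) hd ?_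
      rintro w ⟨hw, hwx⟩
      obtain ⟨τ, hτ⟩ := hline' _ hw
      obtain ⟨σ, hσ⟩ := hline' _ (hXB hx)
      have h1 : (w : E3) = (τ - σ) • (d : E3) := by
        have : (w : E3) = (x + w) - x := by abel
        rw [this, hτ]
        nth_rw 1 [hσ]
        module
      refine ⟨τ - σ, ?_, ?_⟩
      · simp only [mem_ofPred_eq, inner_add_right, h1, inner_smul_right] at hwx
        by_contra hneg
        push Not at hneg
        nlinarith
      · rw [zero_add]
        exact Subtype.ext h1

end

section

variable {M : Type*} [TopologicalSpace M] [CompactSpace M]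
  [ConnectedSpace M] [ChartedSpace (EuclideanHalfSpace 2) M] {f : M → E3}

theorem IsLocallyConvexImmersion.locallyInjective {M : Type*} [TopologicalSpace M] {f : M → E3}
    (hf : IsLocallyConvexImmersion f) (p : M) : ∃ U ∈ 𝓝 p, InjOn f U := by
  obtain ⟨U, hU, hinj, -⟩ := hf.2 p
  exact ⟨U, hU, hinj⟩

theorem IsLocallyConvexImmersion.tendsto_nhdsWithin {M : Type*} [TopologicalSpace M] {f : M → E3}
    (hf : IsLocallyConvexImmersion f) {p : M} {U : Set M} (hU : U ∈ 𝓝 p) {S : Set E3}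
    (hS : f '' U ⊆ S) : Tendsto f (𝓝 p) (𝓝[S] (f p)) := by
  apply tendsto_nhdsWithin_of_tendsto_nhds_of_eventually_within _ hf.1.continuousAt
  filter_upwards [hU] with x hx
  exact hS ⟨x, hx, rfl⟩

/-- A locally convex surface with boundary does not contain a closed convex surface. -/
theorem not_image_eq_frontier (hM : (bdry M).Nonempty) (hf : IsLocallyConvexImmersion f)
    {K : Set E3} (hK : IsSolidBody K) {C : Set M} (hC : IsClosed C) (hne : C.Nonempty)
    (hinj : InjOn f C) : f '' C ≠ frontier K := by
  intro himg
  -- Near `f p` the local body has the same boundary as K, which `f '' (C ∩ U)` already covers.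
  -- Local injectivity then puts nearby points of M in C.
  have hopen : IsOpen C := by
    rw [isOpen_iff_mem_nhds]
    intro p hp
    obtain ⟨U, hU, hUinj, K', hK', hUK'⟩ := hf.2 p
    have h1 := image_inter_mem_nhdsWithin hf.1 hC hinj hp hU
    rw [himg] at h1
    have h2 : frontier K' ∈ 𝓝[frontier K] (f p) :=
      mem_of_superset h1 ((image_mono inter_subset_right).trans hUK')
    have hpK : f p ∈ frontier K := himg ▸ mem_image_of_mem f hp
    rw [nhdsWithin_frontier_eq hK hK' hpK h2] at h1
    filter_upwards [hU, hf.tendsto_nhdsWithin hU hUK' h1] with x hx hxf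
    obtain ⟨x', hx', hxx⟩ := hxf
    rw [← hUinj hx'.2 hx hxx]
    exact hx'.1
  have huniv : C = univ := IsClopen.eq_univ ⟨hC, hopen⟩ hne
  subst huniv
  obtain ⟨p, hp⟩ := hM
  refine image_notMem_nhdsWithin_of_mem_bdry hf.1 hp univ_mem isCompact_univ hinj hK ?_ ?_
  · rw [← himg]; exact ⟨p, trivial, rfl⟩
  · rw [himg]; exact self_mem_nhdsWithin

theorem not_isLift_of_thin [T2Space M] (hM : (bdry M).Nonempty) (hf : IsLocallyConvexImmersion f)
    {K : Set E3} (hK : IsSolidBody K) {n : E3} {c : ℝ} (hn : n ≠ 0)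
    (hKc : ∀ y ∈ K, c ≤ inner ℝ n y) {B : Set E3} (hB : B ⊆ K ∩ plane n c) (hBc : Convex ℝ B)
    (hthin : ∀ y ∈ B, B ∉ 𝓝[frontier K] y) (g : E3 → M) : ¬ IsLift f (frontier K \ B) g := by
  intro hg
  obtain ⟨h1, h2⟩ := injOn_closure_lift_of_thin hf.1 hf.locallyInjective hK hn hKc hB hBc hthin hg
  refine not_image_eq_frontier hM hf hK isClosed_closure ?_ h1 h2
  rw [← image_nonempty (f := f), h2]
  obtain ⟨x₀, hx₀⟩ := hK.2.2
  exact ⟨_, exit_mem_frontier hK hx₀ hn⟩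

end

/-! ### Cutting a two-dimensional face by a line -/

section planar

variable {n : E3} {F : Set E3}

theorem sub_mem_orthogonal {n x y : E3} {c : ℝ} (hx : x ∈ plane n c) (hy : y ∈ plane n c) :
    x - y ∈ (ℝ ∙ n)ᗮ := by
  rw [Submodule.mem_orthogonal_singleton_iff_inner_right, inner_sub_right,
    show inner ℝ n x = c from hx, show inner ℝ n y = c from hy, sub_self]

theorem mem_interior_planar_iff {b : E3} {w : (ℝ ∙ n)ᗮ} :
    w ∈ interior {w : (ℝ ∙ n)ᗮ | b + w ∈ F} ↔ {w' : (ℝ ∙ n)ᗮ | b + w + w' ∈ F} ∈ 𝓝 0 := by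
  rw [mem_interior_iff_mem_nhds]
  have h := (Homeomorph.addLeft w).map_nhds_eq 0
  simp only [Homeomorph.coe_addLeft, add_zero] at h
  rw [← h, mem_map]
  have : (fun x => w + x) ⁻¹' {w : (ℝ ∙ n)ᗮ | b + w ∈ F} =
      {w' : (ℝ ∙ n)ᗮ | b + w + w' ∈ F} := by
    ext w'
    simp [add_assoc]
  rw [this]

theorem convex_planar {b : E3} (hF : Convex ℝ F) : Convex ℝ {w : (ℝ ∙ n)ᗮ | b + w ∈ F} :=
  (hF.translate_preimage_right b).is_linear_preimage (f := ((ℝ ∙ n)ᗮ).subtype)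
    ((ℝ ∙ n)ᗮ).subtype.isLinear

/-- A supporting functional of a planar convex set at a relative boundary point. -/
theorem exists_planar_support {c : ℝ} (hF : Convex ℝ F) (hFp : F ⊆ plane n c) {y x : E3}
    (hyF : y ∈ F) (hy : {w : (ℝ ∙ n)ᗮ | y + w ∈ F} ∈ 𝓝 0) (hx : x ∈ F)
    (hxF : {w : (ℝ ∙ n)ᗮ | x + w ∈ F} ∉ 𝓝 0) :
    ∃ κ : E3 →L[ℝ] ℝ, (∀ z ∈ F, κ z ≤ κ x) ∧
      ∀ z ∈ F, {w : (ℝ ∙ n)ᗮ | z + w ∈ F} ∈ 𝓝 0 → κ z < κ x := by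
  set F₀ := {w : (ℝ ∙ n)ᗮ | y + w ∈ F} with hF₀
  have hconv : Convex ℝ F₀ := convex_planar hF
  have hx₀ : (⟨x - y, sub_mem_orthogonal (hFp hx) (hFp hyF)⟩ : (ℝ ∙ n)ᗮ) ∉ interior F₀ := by
    rw [mem_interior_planar_iff]
    simpa using hxF
  obtain ⟨φ, hφ⟩ := geometric_hahn_banach_open_point hconv.interior isOpen_interior hx₀
  have hφ' : ∀ w ∈ F₀, φ w ≤ φ ⟨x - y, sub_mem_orthogonal (hFp hx) (hFp hyF)⟩ := by
    intro w hw
    have h1 : F₀ ⊆ closure (interior F₀) := by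
      rw [hconv.closure_interior_eq_closure_of_nonempty_interior
        ⟨0, mem_interior_iff_mem_nhds.2 hy⟩]
      exact subset_closure
    exact closure_minimal (fun z hz => (hφ z hz).le)
      (isClosed_le φ.continuous continuous_const) (h1 hw)
  have hval : ∀ z, ∀ hz : z ∈ F, φ.comp ((ℝ ∙ n)ᗮ).orthogonalProjectionOnto z =
      φ ⟨z - y, sub_mem_orthogonal (hFp hz) (hFp hyF)⟩ +
        φ.comp ((ℝ ∙ n)ᗮ).orthogonalProjectionOnto y := fun z hz => by
    have h1 : ((ℝ ∙ n)ᗮ).orthogonalProjectionOnto (z - y) =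
        ⟨z - y, sub_mem_orthogonal (hFp hz) (hFp hyF)⟩ :=
      (ℝ ∙ n)ᗮ.orthogonalProjectionOnto_mem_subspace_eq_self
        ⟨z - y, sub_mem_orthogonal (hFp hz) (hFp hyF)⟩
    rw [← h1]
    simp
  refine ⟨φ.comp ((ℝ ∙ n)ᗮ).orthogonalProjectionOnto, fun z hz => ?_, fun z hz hzF => ?_⟩
  · rw [hval z hz, hval x hx]
    have := hφ' ⟨z - y, sub_mem_orthogonal (hFp hz) (hFp hyF)⟩ (by simpa [hF₀] using hz)
    linarith
  · rw [hval z hz, hval x hx]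
    have := hφ ⟨z - y, sub_mem_orthogonal (hFp hz) (hFp hyF)⟩ (by
      rw [mem_interior_planar_iff]
      simpa using hzF)
    linarith

/-- In a plane, the vectors orthogonal to a nonzero functional form a line. -/
theorem exists_eq_smul_of_inner_eq_zero {n m : E3} (hn : n ≠ 0) {u v w : E3}
    (hu : u ∈ (ℝ ∙ n)ᗮ) (hv : v ∈ (ℝ ∙ n)ᗮ) (hw : w ∈ (ℝ ∙ n)ᗮ) (hv0 : v ≠ 0)
    (hmu : inner ℝ m u = 0) (hmv : inner ℝ m v = 0) (hmw : inner ℝ m w ≠ 0) :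
    ∃ a : ℝ, u = a • v := by
  let φ : (ℝ ∙ n)ᗮ →ₗ[ℝ] ℝ := (innerSL ℝ m).toLinearMap.comp ((ℝ ∙ n)ᗮ).subtype
  have hφ : ∀ z : (ℝ ∙ n)ᗮ, φ z = inner ℝ m (z : E3) := fun z => rfl
  have hr : LinearMap.range φ = ⊤ := by
    apply LinearMap.range_eq_top.2
    intro t
    refine ⟨(t / inner ℝ m w) • ⟨w, hw⟩, ?_⟩
    rw [map_smul, hφ, smul_eq_mul, div_mul_cancel₀ _ hmw]
  have h1 := LinearMap.finrank_range_add_finrank_ker φ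
  rw [hr, finrank_top, finrank_orthogonal_span hn, Module.finrank_self] at h1
  have h2 : Module.finrank ℝ (LinearMap.ker φ) = 1 := by omega
  have hvk : (⟨v, hv⟩ : (ℝ ∙ n)ᗮ) ∈ LinearMap.ker φ := hmv
  have huk : (⟨u, hu⟩ : (ℝ ∙ n)ᗮ) ∈ LinearMap.ker φ := hmu
  have hne : (⟨⟨v, hv⟩, hvk⟩ : LinearMap.ker φ) ≠ 0 := fun h => hv0 (by
    have := congrArg (fun z : LinearMap.ker φ => ((z : (ℝ ∙ n)ᗮ) : E3)) h
    simpa using this)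
  obtain ⟨a, ha⟩ := (finrank_eq_one_iff_of_nonzero' _ hne).1 h2 ⟨⟨u, hu⟩, huk⟩
  exact ⟨a, by
    have := congrArg (fun z : LinearMap.ker φ => ((z : (ℝ ∙ n)ᗮ) : E3)) ha
    simpa using this.symm⟩

theorem tendsto_lineMap_one (y z : E3) :
    Tendsto (fun t : ℝ => y + t • (z - y)) (𝓝[<] 1) (𝓝 z) := by
  have : Continuous fun t : ℝ => y + t • (z - y) := by fun_prop
  have h2 := this.tendsto 1
  simp only [one_smul, add_sub_cancel] at h2
  exact h2.mono_left nhdsWithin_le_nhds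

/-- Relative interior points of `F` are dense in each open subset of `F`. -/
theorem exists_relint_mem (hF : Convex ℝ F) {y z : E3} (hyF : y ∈ F)
    (hy : {w : (ℝ ∙ n)ᗮ | y + w ∈ F} ∈ 𝓝 0) (hz : z ∈ F) {V : Set E3} (hV : V ∈ 𝓝 z) :
    ∃ z' ∈ F ∩ V, {w : (ℝ ∙ n)ᗮ | z' + w ∈ F} ∈ 𝓝 0 ∧ ∃ t ∈ Ioo (0 : ℝ) 1,
      z' = y + t • (z - y) := by
  have h1 : ∀ᶠ t : ℝ in 𝓝[<] 1, t ∈ Ioo (0 : ℝ) 1 := Ioo_mem_nhdsLT one_pos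
  obtain ⟨t, ht, htV⟩ := (h1.and ((tendsto_lineMap_one y z).eventually_mem hV)).exists
  exact ⟨_, ⟨hF.add_smul_sub_mem hyF hz ⟨ht.1.le, ht.2.le⟩, htV⟩,
    relint_segment hF hy hz ⟨ht.1.le, ht.2⟩, t, ht, rfl⟩

end planar

theorem convex_plane (n : E3) (c : ℝ) : Convex ℝ (plane n c) :=
  convex_hyperplane (f := fun z => inner ℝ n z) ⟨fun _ _ => inner_add_right _ _ _,
    fun _ _ => inner_smul_right _ _ _⟩ c

theorem isClosed_plane (n : E3) (c : ℝ) : IsClosed (plane n c) :=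
  isClosed_eq (by fun_prop) continuous_const

/-- The part of the face `K ∩ plane n c` below the level `s` of the functional `m`. -/
def lowFace (K : Set E3) (n : E3) (c : ℝ) (m : E3) (s : ℝ) : Set E3 :=
  (K ∩ plane n c) ∩ {z | inner ℝ m z ≤ s}

section lowFace

variable {K : Set E3} {n : E3} {c : ℝ} {m : E3} {s : ℝ}

theorem lowFace_subset : lowFace K n c m s ⊆ K ∩ plane n c := inter_subset_left

theorem convex_lowFace (hK : IsSolidBody K) : Convex ℝ (lowFace K n c m s) :=
  (hK.1.inter (convex_plane n c)).inter
    (convex_halfSpace_le (f := fun z => inner ℝ m z) ⟨fun _ _ => inner_add_right _ _ _,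
      fun _ _ => inner_smul_right _ _ _⟩ s)

theorem isClosed_lowFace (hK : IsSolidBody K) : IsClosed (lowFace K n c m s) :=
  (hK.isClosed.inter (isClosed_plane n c)).inter (isClosed_le (by fun_prop) continuous_const)

theorem diff_lowFace_mem_nhdsWithin (hK : IsSolidBody K) {x : E3}
    (hx : x ∈ frontier K \ lowFace K n c m s) :
    frontier K \ lowFace K n c m s ∈ 𝓝[frontier K] x :=
  inter_mem self_mem_nhdsWithin
    (nhdsWithin_le_nhds ((isClosed_lowFace hK).isOpen_compl.mem_nhds hx.2))

/-- A point of the face on the critical level is not interior to the low part. -/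
theorem lowFace_notMem_nhdsWithin (hK : IsSolidBody K) (hn : n ≠ 0)
    (hKc : ∀ y ∈ K, c ≤ inner ℝ n y) {x z : E3} (hx : x ∈ K ∩ plane n c) (hxs : s ≤ inner ℝ m x)
    (hz : z ∈ K ∩ plane n c) (hzs : inner ℝ m x < inner ℝ m z) :
    lowFace K n c m s ∉ 𝓝[frontier K] x := by
  rw [mem_nhdsWithin_frontier_iff_face hK hn hKc lowFace_subset hx.1 hx.2]
  intro h
  obtain ⟨t, ht, ht0⟩ := ((eventually_smul_mem h ⟨_, sub_mem_orthogonal hz.2 hx.2⟩).and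
    self_mem_nhdsWithin).exists
  have h1 : inner ℝ m (x + t • (z - x)) ≤ s := ht.2
  have h2 : 0 < t := ht0
  rw [inner_add_right, inner_smul_right, inner_sub_right] at h1
  nlinarith

end lowFace

/-- The level set `m = s` cuts the two-dimensional face `K ∩ plane n c`. -/
structure CutFace (K : Set E3) (n : E3) (c : ℝ) (m : E3) (s : ℝ) : Prop where
  solid : IsSolidBody K
  ne : n ≠ 0
  side : ∀ y ∈ K, c ≤ inner ℝ n y
  relint : ∃ y ∈ K ∩ plane n c, {w : (ℝ ∙ n)ᗮ | y + w ∈ K ∩ plane n c} ∈ 𝓝 0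
  below : ∃ z ∈ K ∩ plane n c, inner ℝ m z < s
  above : ∃ z ∈ K ∩ plane n c, s < inner ℝ m z

theorem frontier_subset_closure_union (K : Set E3) (n : E3) (c : ℝ) (m : E3) (s : ℝ) :
    frontier K ⊆ closure (frontier K \ lowFace K n c m s) ∪ K ∩ plane n c := fun x hx => by
  by_cases hxF : x ∈ lowFace K n c m s
  · exact Or.inr hxF.1
  · exact Or.inl (subset_closure ⟨hx, hxF⟩)

namespace CutFace

variable {K : Set E3} {n : E3} {c : ℝ} {m : E3} {s : ℝ}

theorem convex (h : CutFace K n c m s) : Convex ℝ (K ∩ plane n c) :=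
  h.solid.1.inter (convex_plane n c)

theorem face_subset (h : CutFace K n c m s) : K ∩ plane n c ⊆ frontier K :=
  face_subset_frontier h.ne h.side

theorem mem_diff_of_lt (h : CutFace K n c m s) {x : E3} (hx : x ∈ K ∩ plane n c)
    (hxs : s < inner ℝ m x) : x ∈ frontier K \ lowFace K n c m s :=
  ⟨h.face_subset hx, fun hl => (not_le.2 hxs) hl.2⟩

theorem mem_closure (h : CutFace K n c m s) {x : E3} (hx : x ∈ K ∩ plane n c)
    (hxs : s ≤ inner ℝ m x) : x ∈ closure (frontier K \ lowFace K n c m s) := by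
  rcases hxs.eq_or_lt with hs | hs
  · obtain ⟨z, hz, hzs⟩ := h.above
    exact mem_closure_diff_iff.2
      (lowFace_notMem_nhdsWithin h.solid h.ne h.side hx hxs hz (hs ▸ hzs))
  · exact subset_closure (h.mem_diff_of_lt hx hs)

theorem exists_relint_above (h : CutFace K n c m s) {x : E3} (hx : x ∈ K ∩ plane n c)
    (hxs : s ≤ inner ℝ m x) {V : Set E3} (hV : V ∈ 𝓝 x) :
    ∃ z ∈ (K ∩ plane n c) ∩ V, {w : (ℝ ∙ n)ᗮ | z + w ∈ K ∩ plane n c} ∈ 𝓝 0 ∧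
      s < inner ℝ m z := by
  obtain ⟨y, hy, hyF⟩ := h.relint
  obtain ⟨z, hz, hzs⟩ := h.above
  have hopen : IsOpen {z : E3 | s < inner ℝ m z} := isOpen_lt continuous_const (by fun_prop)
  obtain ⟨y₁, hy₁, hy₁F, -⟩ := exists_relint_mem h.convex hy hyF hz (hopen.mem_nhds hzs)
  obtain ⟨z', hz', hz'F, t, ht, rfl⟩ := exists_relint_mem h.convex hy₁.1 hy₁F hx hV
  refine ⟨_, hz', hz'F, ?_⟩
  have h1 : s < inner ℝ m y₁ := hy₁.2
  rw [inner_add_right, inner_smul_right, inner_sub_right]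
  have := ht.1
  have := ht.2
  nlinarith

theorem exists_relint_level (h : CutFace K n c m s) :
    ∃ z ∈ K ∩ plane n c, {w : (ℝ ∙ n)ᗮ | z + w ∈ K ∩ plane n c} ∈ 𝓝 0 ∧
      inner ℝ m z = s := by
  obtain ⟨z₁, hz₁, hz₁s⟩ := h.below
  obtain ⟨z₂, hz₂, hz₂s⟩ := h.above
  obtain ⟨y, hy, hyF, hys⟩ := h.exists_relint_above hz₂ hz₂s.le univ_mem
  have hd : 0 < inner ℝ m y - inner ℝ m z₁ := by linarith
  set t := (inner ℝ m y - s) / (inner ℝ m y - inner ℝ m z₁) with ht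
  have ht0 : 0 ≤ t := div_nonneg (by linarith) hd.le
  have ht1 : t < 1 := by rw [ht, div_lt_one hd]; linarith
  refine ⟨y + t • (z₁ - y), h.convex.add_smul_sub_mem hy.1 hz₁ ⟨ht0, ht1.le⟩,
    relint_segment h.convex hyF hz₁ ⟨ht0, ht1⟩, ?_⟩
  rw [inner_add_right, inner_smul_right, inner_sub_right, ht]
  field_simp
  ring

/-- At a relative interior point z of F above the cut, z lies on ∂K' while K' contains F near z. A
support functional of K' at z is therefore a multiple of n, so the plane of F supports K' and the
part of F near x lies on ∂K'. -/
theorem frontier_mem_nhdsWithin (h : CutFace K n c m s) {x : E3} (hx : x ∈ K ∩ plane n c)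
    (hxs : s ≤ inner ℝ m x) {K' : Set E3} (hK' : IsSolidBody K')
    (h1 : frontier K' ∈ 𝓝[closure (frontier K \ lowFace K n c m s)] x)
    (h2 : K' ∈ 𝓝[K ∩ plane n c] x) : frontier K' ∈ 𝓝[frontier K] x := by
  suffices h3 : frontier K' ∈ 𝓝[K ∩ plane n c] x by
    apply nhdsWithin_mono x (frontier_subset_closure_union K n c m s)
    rw [nhdsWithin_union]
    exact ⟨h1, h3⟩
  obtain ⟨O₁, hO₁, hxO₁, hO₁K⟩ := mem_nhdsWithin.1 h1
  obtain ⟨O₂, hO₂, hxO₂, hO₂K⟩ := mem_nhdsWithin.1 h2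
  obtain ⟨z, ⟨hz, hzO₁, hzO₂⟩, hzF, hzs⟩ := h.exists_relint_above hx hxs
    (inter_mem (hO₁.mem_nhds hxO₁) (hO₂.mem_nhds hxO₂))
  have hzK' : z ∈ frontier K' :=
    hO₁K ⟨hzO₁, subset_closure (h.mem_diff_of_lt hz hzs)⟩
  obtain ⟨k, hk, hk'⟩ := hK'.exists_support hzK'.2
  have hzF' : {w : (ℝ ∙ n)ᗮ | z + w ∈ O₂ ∩ (K ∩ plane n c)} ∈ 𝓝 0 := by
    have h4 : (fun w : (ℝ ∙ n)ᗮ => z + (w : E3)) ⁻¹' O₂ ∈ 𝓝 0 := by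
      apply (by fun_prop : Continuous fun w : (ℝ ∙ n)ᗮ => z + (w : E3)).continuousAt.preimage_mem_nhds
      simpa using hO₂.mem_nhds hzO₂
    filter_upwards [h4, hzF] with w hw hw'
    exact ⟨hw, hw'⟩
  obtain ⟨a, rfl⟩ := exists_eq_smul_of_forall_le hzF' fun y hy => hk' y (hO₂K hy)
  filter_upwards [h2, self_mem_nhdsWithin] with y hy hyF
  refine ⟨subset_closure hy, fun hi => ?_⟩
  have h5 := hk y hi
  rw [real_inner_smul_left, real_inner_smul_left, show inner ℝ n y = c from hyF.2,
    show inner ℝ n z = c from hz.2] at h5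
  exact lt_irrefl _ h5

/-- Relative boundary points of F are limits of ∂K \ F, so those near x lie in K'. Every point of F
near x lies on a segment from a nearby point z of K' to such a boundary point, and convexity of K'
finishes. -/
theorem mem_nhdsWithin_face_of_corner (h : CutFace K n c m s) {x : E3} (hx : x ∈ K ∩ plane n c)
    (hxs : s ≤ inner ℝ m x) (hxF : {w : (ℝ ∙ n)ᗮ | x + w ∈ K ∩ plane n c} ∉ 𝓝 0) {K' : Set E3}
    (hK' : Convex ℝ K') (h1 : K' ∈ 𝓝[closure (frontier K \ lowFace K n c m s)] x) :
    K' ∈ 𝓝[K ∩ plane n c] x := by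
  obtain ⟨O, hO, hxO, hOK⟩ := mem_nhdsWithin.1 h1
  obtain ⟨z, ⟨hz, hzO⟩, hzF, hzs⟩ := h.exists_relint_above hx hxs (hO.mem_nhds hxO)
  have hzK' : z ∈ K' := hOK ⟨hzO, subset_closure (h.mem_diff_of_lt hz hzs)⟩
  set F₀ := {w : (ℝ ∙ n)ᗮ | z + w ∈ K ∩ plane n c} with hF₀
  have hconv : Convex ℝ F₀ := convex_planar h.convex
  have hclosed : IsClosed F₀ :=
    (h.solid.isClosed.inter (isClosed_plane n c)).preimage
      (by fun_prop : Continuous fun w : (ℝ ∙ n)ᗮ => z + (w : E3))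
  let ω : E3 → (ℝ ∙ n)ᗮ := fun y => ((ℝ ∙ n)ᗮ).orthogonalProjectionOnto (y - z)
  have hωc : Continuous ω := by fun_prop
  have hω : ∀ y ∈ K ∩ plane n c, (ω y : E3) = y - z := fun y hy =>
    congrArg Subtype.val ((ℝ ∙ n)ᗮ.orthogonalProjectionOnto_mem_subspace_eq_self
        ⟨y - z, sub_mem_orthogonal hy.2 hz.2⟩)
  have hωF : ∀ y ∈ K ∩ plane n c, ω y ∈ F₀ := fun y hy => by
    rw [hF₀, mem_ofPred_eq, hω y hy, add_sub_cancel]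
    exact hy
  have hqc : Continuous (gauge F₀) := continuous_gauge hconv hzF
  have hqx : gauge F₀ (ω x) = 1 := by
    rw [gauge_eq_one_iff_mem_frontier hconv hzF]
    refine ⟨subset_closure (hωF x hx), fun hi => hxF ?_⟩
    rw [mem_interior_planar_iff, hω x hx, add_sub_cancel] at hi
    exact hi
  -- e projects radially from z onto the relative boundary of F. It fixes x, so continuity keeps it
  -- in the region where K' is controlled.
  let e : E3 → E3 := fun y => z + (gauge F₀ (ω y))⁻¹ • (ω y : E3)
  have hex : e x = x := by
    simp only [e, hqx, inv_one, one_smul, hω x hx, add_sub_cancel]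
  have hec : ContinuousAt e x := by
    apply continuousAt_const.add
    have h2 : ContinuousAt (fun y => (gauge F₀ (ω y))⁻¹) x :=
      (hqc.comp hωc).continuousAt.inv₀ (by simp [hqx])
    exact h2.smul (by fun_prop : Continuous fun y => (ω y : E3)).continuousAt
  have h2 : ∀ᶠ y in 𝓝 x, e y ∈ O := hec.eventually_mem (by rw [hex]; exact hO.mem_nhds hxO)
  have h3 : ∀ᶠ y in 𝓝 x, 0 < gauge F₀ (ω y) :=
    (hqc.comp hωc).continuousAt.eventually_const_lt (by simp [hqx])
  filter_upwards [nhdsWithin_le_nhds h2, nhdsWithin_le_nhds h3, self_mem_nhdsWithin]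
    with y hyO hypos hy
  have hfr : (gauge F₀ (ω y))⁻¹ • ω y ∈ frontier F₀ := by
    rw [← gauge_eq_one_iff_mem_frontier hconv hzF, gauge_smul_of_nonneg (inv_nonneg.2 hypos.le),
      smul_eq_mul, inv_mul_cancel₀ hypos.ne']
  have heF : e y ∈ K ∩ plane n c := hclosed.frontier_subset hfr
  have heK : e y ∈ K' := by
    apply hOK
    refine ⟨hyO, closure_mono (sdiff_subset_sdiff_right lowFace_subset) ?_⟩
    rw [mem_closure_diff_iff, mem_nhdsWithin_frontier_iff_face h.solid h.ne h.side subset_rfl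
      heF.1 heF.2]
    intro hi
    apply hfr.2
    rw [mem_interior_planar_iff]
    exact hi
  have hle : gauge F₀ (ω y) ≤ 1 := gauge_le_one_of_mem (hωF y hy)
  have h4 := hK'.add_smul_sub_mem hzK' heK ⟨hypos.le, hle⟩
  convert h4 using 1
  simp only [e, add_sub_cancel_left, smul_smul, mul_inv_cancel₀ hypos.ne', one_smul, hω y hy,
    add_sub_cancel]

/-- If K' contains F near a close point `x₁` of the cutting segment, it also does so near x: the
points of F near x are midpoints between points near `x₁` and the reflection of `x₁` in x, which
again lies on the segment. -/
theorem mem_nhdsWithin_face_of_frequently (h : CutFace K n c m s) {x : E3}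
    (hx : x ∈ K ∩ plane n c) (hxs : inner ℝ m x = s)
    (hxF : {w : (ℝ ∙ n)ᗮ | x + w ∈ K ∩ plane n c} ∈ 𝓝 0) {K' : Set E3}
    (hK' : Convex ℝ K') (h1 : K' ∈ 𝓝[closure (frontier K \ lowFace K n c m s)] x)
    (h2 : ∀ V ∈ 𝓝 x, ∃ x₁ ∈ V ∩ (K ∩ plane n c), inner ℝ m x₁ = s ∧ K' ∈ 𝓝[K ∩ plane n c] x₁) :
    K' ∈ 𝓝[K ∩ plane n c] x := by
  obtain ⟨ε, hε, hεK⟩ := Metric.mem_nhdsWithin_iff.1 h1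
  obtain ⟨ρ, hρ, hρF⟩ := Metric.mem_nhds_iff.1 hxF
  have hρF' : ∀ y ∈ plane n c, dist y x < ρ → y ∈ K ∩ plane n c := fun y hy hyx => by
    have hw : (⟨y - x, sub_mem_orthogonal hy hx.2⟩ : (ℝ ∙ n)ᗮ) ∈ ball 0 ρ := by
      rw [mem_ball_zero_iff, Submodule.coe_norm, ← dist_eq_norm]
      exact hyx
    have h3 : x + (y - x) ∈ K ∩ plane n c := hρF hw
    rwa [add_sub_cancel] at h3
  set r := min ε ρ / 2 with hr
  have hrpos : 0 < r := by positivity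
  have hrε : r < ε := by have := min_le_left ε ρ; linarith [lt_min hε hρ]
  have hrρ : 2 * r ≤ ρ := by have := min_le_right ε ρ; linarith
  obtain ⟨x₁, ⟨hx₁r, hx₁⟩, hx₁s, hx₁K⟩ := h2 _ (ball_mem_nhds x hrpos)
  obtain ⟨δ, hδ, hδK⟩ := Metric.mem_nhdsWithin_iff.1 hx₁K
  rw [mem_ball] at hx₁r
  set x₂ := (2 : ℝ) • x - x₁ with hx₂
  have hx₂p : x₂ ∈ plane n c := by
    change inner ℝ n x₂ = c
    rw [hx₂, inner_sub_right, inner_smul_right, show inner ℝ n x = c from hx.2,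
      show inner ℝ n x₁ = c from hx₁.2]
    ring
  have hx₂d : dist x₂ x < r := by
    have : x₂ - x = x - x₁ := by rw [hx₂]; module
    rw [dist_eq_norm, this, ← dist_eq_norm, dist_comm]
    exact hx₁r
  have hx₂s : inner ℝ m x₂ = s := by
    rw [hx₂, inner_sub_right, inner_smul_right, hxs, hx₁s]
    ring
  have hx₂F := hρF' x₂ hx₂p (by linarith)
  have hx₂K : x₂ ∈ K' := hεK ⟨by rw [mem_ball]; linarith, h.mem_closure hx₂F hx₂s.ge⟩
  filter_upwards [nhdsWithin_le_nhds (ball_mem_nhds x (show 0 < min (r / 2) (δ / 2) by positivity)),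
    self_mem_nhdsWithin] with y hy hyF
  rw [mem_ball, lt_min_iff, dist_eq_norm] at hy
  -- Chosen so that y is the midpoint of `y₁` and `x₂`.
  set y₁ := x₁ + (2 : ℝ) • (y - x) with hy₁
  have hn2 : ‖(2 : ℝ) • (y - x)‖ = 2 * ‖y - x‖ := by rw [norm_smul]; simp
  have hy₁p : y₁ ∈ plane n c := by
    change inner ℝ n y₁ = c
    rw [hy₁, inner_add_right, inner_smul_right, inner_sub_right, show inner ℝ n x = c from hx.2,
      show inner ℝ n x₁ = c from hx₁.2, show inner ℝ n y = c from hyF.2]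
    ring
  have hy₁K : y₁ ∈ K' := by
    apply hδK
    refine ⟨?_, hρF' y₁ hy₁p ?_⟩
    · rw [mem_ball, dist_eq_norm, hy₁, add_sub_cancel_left, hn2]
      linarith
    · have : y₁ - x = (x₁ - x) + (2 : ℝ) • (y - x) := by rw [hy₁]; abel
      rw [dist_eq_norm, this]
      have h3 := norm_add_le (x₁ - x) ((2 : ℝ) • (y - x))
      rw [hn2] at h3
      rw [dist_eq_norm] at hx₁r
      linarith
  have h4 := hK' hy₁K hx₂K (a := (1 / 2 : ℝ)) (b := (1 / 2 : ℝ)) (by norm_num) (by norm_num)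
    (by norm_num)
  convert h4 using 1
  rw [hy₁, hx₂]
  module

/-- The cutting segment has an endpoint on the relative boundary of the face. -/
theorem exists_corner (h : CutFace K n c m s) :
    ∃ x ∈ K ∩ plane n c, inner ℝ m x = s ∧
      {w : (ℝ ∙ n)ᗮ | x + w ∈ K ∩ plane n c} ∉ 𝓝 0 := by
  let φ : (ℝ ∙ n)ᗮ →ₗ[ℝ] ℝ := (innerSL ℝ m).toLinearMap.comp ((ℝ ∙ n)ᗮ).subtype
  have hker : LinearMap.ker φ ≠ ⊥ := LinearMap.ker_ne_bot_of_finrank_lt (by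
    rw [finrank_orthogonal_span h.ne, Module.finrank_self]; norm_num)
  obtain ⟨d, hd, hd0⟩ := (Submodule.ne_bot_iff _).1 hker
  have hmd : inner ℝ m (d : E3) = 0 := hd
  have hdd : 0 < inner ℝ (d : E3) (d : E3) := real_inner_self_pos.2 (by simpa using hd0)
  obtain ⟨z, hz, -, hzs⟩ := h.exists_relint_level
  have hcomp : IsCompact ((K ∩ plane n c) ∩ {x | inner ℝ m x = s}) :=
    (h.solid.2.1.inter_right (isClosed_plane n c)).inter_right
      (isClosed_eq (by fun_prop) continuous_const)
  -- d spans a direction of the cutting line. A point of the segment farthest along d cannot be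
  -- relatively interior to F.
  obtain ⟨x, ⟨hx, hxs⟩, hmax⟩ := hcomp.exists_isMaxOn ⟨z, hz, hzs⟩
    (f := fun z => inner ℝ (d : E3) z) (by fun_prop)
  refine ⟨x, hx, hxs, fun hF => ?_⟩
  obtain ⟨t, ht, ht0⟩ := ((eventually_smul_mem hF d).and self_mem_nhdsWithin).exists
  have ht0 : 0 < t := ht0
  have hxs' : inner ℝ m x = s := hxs
  have h1 : x + t • (d : E3) ∈ (K ∩ plane n c) ∩ {x | inner ℝ m x = s} := by
    refine ⟨ht, ?_⟩
    change inner ℝ m (x + t • (d : E3)) = s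
    rw [inner_add_right, inner_smul_right, hmd, hxs']
    ring
  have h2 := hmax h1
  simp only [mem_ofPred_eq, inner_add_right, inner_smul_right] at h2
  nlinarith

/-- No regular curve in the low part of the face passes through a corner. -/
theorem not_hasDerivAt_corner (h : CutFace K n c m s) {x : E3}
    (hx : x ∈ K ∩ plane n c) (hxs : inner ℝ m x = s)
    (hxF : {w : (ℝ ∙ n)ᗮ | x + w ∈ K ∩ plane n c} ∉ 𝓝 0) {γ : ℝ → E3} {t₀ : ℝ} {v : E3}
    (hγ : HasDerivAt γ v t₀) (hγx : γ t₀ = x) (hv : v ≠ 0) :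
    ¬ ∀ᶠ t in 𝓝 t₀, γ t ∈ lowFace K n c m s := by
  intro hlow
  obtain ⟨y, hy, hyF, hys⟩ := h.exists_relint_level
  obtain ⟨z, hz, hzs⟩ := h.above
  obtain ⟨κ, hκ, hκ'⟩ := exists_planar_support h.convex inter_subset_right hy hyF hx hxF
  have hn : inner ℝ n v = 0 := by
    have h1 := (innerSL ℝ n).hasFDerivAt.comp_hasDerivAt t₀ hγ
    have h2 : (innerSL ℝ n) ∘ γ =ᶠ[𝓝 t₀] fun _ => c := by
      filter_upwards [hlow] with t ht
      exact ht.1.2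
    exact (h1.congr_of_eventuallyEq h2.symm).unique (hasDerivAt_const t₀ c)
  have hm : inner ℝ m v = 0 := by
    have h1 := (innerSL ℝ m).hasFDerivAt.comp_hasDerivAt t₀ hγ
    have h2 : IsLocalMax ((innerSL ℝ m) ∘ γ) t₀ := by
      filter_upwards [hlow] with t ht
      change inner ℝ m (γ t) ≤ inner ℝ m (γ t₀)
      rw [hγx, hxs]
      exact ht.2
    exact h2.hasDerivAt_eq_zero h1
  have hk : κ v = 0 := by
    have h1 := κ.hasFDerivAt.comp_hasDerivAt t₀ hγ
    have h2 : IsLocalMax (κ ∘ γ) t₀ := by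
      filter_upwards [hlow] with t ht
      simp only [Function.comp_apply]
      rw [hγx]
      exact hκ _ ht.1
    exact h2.hasDerivAt_eq_zero h1
  -- Both `y - x` and v are parallel to the cutting line, so they are proportional. But κ vanishes
  -- on v and is strictly negative on `y - x`.
  obtain ⟨a, ha⟩ := exists_eq_smul_of_inner_eq_zero h.ne (u := y - x) (w := z - x) (m := m)
    (sub_mem_orthogonal hy.2 hx.2)
    (Submodule.mem_orthogonal_singleton_iff_inner_right.2 hn) (sub_mem_orthogonal hz.2 hx.2) hv
    (by rw [inner_sub_right, hys, hxs, sub_self]) hm (by rw [inner_sub_right, hxs]; linarith)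
  have h3 := hκ' y hy hyF
  have h4 : κ (y - x) = 0 := by rw [ha, map_smul, hk, smul_zero]
  rw [map_sub] at h4
  linarith

end CutFace

/-! ### Extending a lift past a cut -/

section extension

variable {M : Type*} [TopologicalSpace M] [T2Space M] [CompactSpace M] {f : M → E3}
  {K : Set E3} {n : E3} {c : ℝ} {m : E3} {s : ℝ}

theorem CutFace.injOn (h : CutFace K n c m s) (hf : IsLocallyConvexImmersion f) {g : E3 → M}
    (hg : IsLift f (frontier K \ lowFace K n c m s) g) :
    InjOn f (closure (g '' (frontier K \ lowFace K n c m s))) := by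
  obtain ⟨y, hy, hyF⟩ := h.relint
  obtain ⟨z, hz, hzs⟩ := h.below
  have hopen : IsOpen {z : E3 | inner ℝ m z < s} := isOpen_lt (by fun_prop) continuous_const
  obtain ⟨z', ⟨hz', hz's⟩, hz'F, -⟩ := exists_relint_mem h.convex hy hyF hz (hopen.mem_nhds hzs)
  have hz's' : inner ℝ m z' < s := hz's
  refine injOn_closure_lift hf.1 hf.locallyInjective h.solid h.ne h.side lowFace_subset
    (convex_lowFace h.solid) ⟨hz', hz's'.le⟩ ?_ hg
  have h1 := (mem_nhdsWithin_frontier_iff_face h.solid h.ne h.side subset_rfl hz'.1 hz'.2).2 hz'F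
  exact inter_mem h1 (mem_of_superset (nhdsWithin_le_nhds (hopen.mem_nhds hz's))
    fun w hw => le_of_lt (mem_ofPred_eq ▸ hw))

variable [ChartedSpace (EuclideanHalfSpace 2) M]

/-- If the local body at a point over the cutting segment contains the face nearby, then the
surface covers a neighborhood of that point in the boundary of `K`. -/
theorem CutFace.image_mem_of_body (h : CutFace K n c m s) (hf : IsLocallyConvexImmersion f)
    (hflat : IsLocallyNonflatAlongBoundary f) (hreg : IsRegularOnBoundary 2 f) {g : E3 → M}
    (hg : IsLift f (frontier K \ lowFace K n c m s) g) {N : Set M} (hNc : IsClosed N)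
    (hN : N ∈ 𝓝ˢ (closure (g '' (frontier K \ lowFace K n c m s)))) (hNinj : InjOn f N) {p : M}
    (hp : p ∈ closure (g '' (frontier K \ lowFace K n c m s))) (hpF : f p ∈ K ∩ plane n c)
    (hps : inner ℝ m (f p) = s) {U : Set M} (hU : U ∈ 𝓝 p) (hUinj : InjOn f U) {K' : Set E3}
    (hK' : IsSolidBody K') (hUK' : f '' U ⊆ frontier K') (hE : K' ∈ 𝓝[K ∩ plane n c] (f p)) :
    f '' N ∈ 𝓝[frontier K] (f p) := by
  set C := closure (g '' (frontier K \ lowFace K n c m s)) with hC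
  have hCinj : InjOn f C := h.injOn hf hg
  have hNp : N ∈ 𝓝 p := mem_nhdsSet_iff_forall.1 hN p hp
  have hCN : C ⊆ N := subset_of_mem_nhdsSet hN
  have h1 : f '' (C ∩ U) ∈ 𝓝[closure (frontier K \ lowFace K n c m s)] (f p) := by
    rw [← hg.image_closure hf.1]
    exact image_inter_mem_nhdsWithin hf.1 isClosed_closure hCinj hp hU
  have h2 := h.frontier_mem_nhdsWithin hpF hps.ge hK'
    (mem_of_superset h1 ((image_mono inter_subset_right).trans hUK')) hE
  have hpfr : f p ∈ frontier K := h.face_subset hpF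
  have heq := nhdsWithin_frontier_eq h.solid hK' hpfr h2
  have htend : Tendsto f (𝓝 p) (𝓝[frontier K] (f p)) := by
    rw [heq]; exact hf.tendsto_nhdsWithin hU hUK'
  by_cases hpb : p ∈ bdry M
  · exfalso
    -- Boundary points of M are impossible here. Over the relative interior of F the surface would
    -- be flat near p; over a corner, the boundary curve would be trapped in the low part of F.
    by_cases hrel : {w : (ℝ ∙ n)ᗮ | f p + w ∈ K ∩ plane n c} ∈ 𝓝 0
    · rw [← mem_nhdsWithin_frontier_iff_face h.solid h.ne h.side subset_rfl hpF.1 hpF.2] at hrel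
      refine hflat p hpb _ (htend hrel) n c h.ne ?_
      rintro _ ⟨x, hx, rfl⟩
      exact hx.2
    · obtain ⟨e, hpe, hec, hed⟩ := hreg ⟨p, hpb⟩
      have ht₀ := e.map_target hpe
      set t₀ := e.symm ⟨p, hpb⟩ with ht₀'
      have het₀ : (e t₀ : M) = p := by rw [ht₀', e.right_inv hpe]
      have hγ : HasDerivAt (boundaryCurve f e) (deriv (boundaryCurve f e) t₀) t₀ :=
        ((hec.differentiableOn (by norm_num)).differentiableAt
          (e.open_source.mem_nhds ht₀)).hasDerivAt
      have hγx : boundaryCurve f e t₀ = f p := by rw [boundaryCurve, het₀]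
      refine h.not_hasDerivAt_corner hpF hps hrel hγ hγx (hed t₀ ht₀) ?_
      have hetend : Tendsto (fun t => (e t : M)) (𝓝 t₀) (𝓝 p) := by
        have h3 := (continuous_subtype_val (p := (· ∈ bdry M))).continuousAt.tendsto.comp
          (e.continuousAt ht₀).tendsto
        rw [← het₀]
        exact h3
      have hint : ∀ᶠ q in 𝓝 p, N ∈ 𝓝 q := eventually_mem_nhds_iff.2 hNp
      filter_upwards [hetend.eventually hint,
        hetend.eventually (htend.eventually self_mem_nhdsWithin)] with t htN htf
      -- Above the cut the lift already covers a neighborhood in ∂K, which cannot happen at a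
      -- boundary point of M. Hence the boundary curve stays in the low part.
      by_contra hlow
      have hA : f (e t) ∈ frontier K \ lowFace K n c m s := ⟨htf, hlow⟩
      refine image_notMem_nhdsWithin_of_mem_bdry hf.1 (e t).2 htN hNc.isCompact hNinj h.solid htf ?_
      refine mem_of_superset (diff_lowFace_mem_nhdsWithin h.solid hA) ?_
      rw [← hg.image_image]
      exact image_mono (subset_closure.trans hCN)
  · have h3 := image_mem_nhdsWithin_of_notMem_bdry hf.1 hpb (inter_mem hU hNp)
      (hUinj.mono inter_subset_left) hK' ((image_mono inter_subset_left).trans hUK')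
    rw [← heq] at h3
    exact mem_of_superset h3 (image_mono inter_subset_right)

/-- The points of the cutting segment near which `f '' N` covers ∂K form an open set. It is closed
by the reflection argument and contains an endpoint by the corner argument, so it is the whole
segment. -/
theorem CutFace.image_mem (h : CutFace K n c m s) (hf : IsLocallyConvexImmersion f)
    (hflat : IsLocallyNonflatAlongBoundary f) (hreg : IsRegularOnBoundary 2 f) {g : E3 → M}
    (hg : IsLift f (frontier K \ lowFace K n c m s) g) {N : Set M} (hNc : IsClosed N)
    (hN : N ∈ 𝓝ˢ (closure (g '' (frontier K \ lowFace K n c m s)))) (hNinj : InjOn f N) {x : E3}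
    (hx : x ∈ K ∩ plane n c) (hxs : inner ℝ m x = s) : f '' N ∈ 𝓝[frontier K] x := by
  set C := closure (g '' (frontier K \ lowFace K n c m s)) with hC
  have hCinj : InjOn f C := h.injOn hf hg
  have hCN : C ⊆ N := subset_of_mem_nhdsSet hN
  have himg : f '' C = closure (frontier K \ lowFace K n c m s) := hg.image_closure hf.1
  -- the local criterion, phrased in terms of the local body
  have key : ∀ x ∈ K ∩ plane n c, inner ℝ m x = s →
      (∀ K' : Set E3, IsSolidBody K' → ∀ U : Set M, IsOpen U → f '' U ⊆ frontier K' →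
        (∃ p ∈ C ∩ U, f p = x) →
        K' ∈ 𝓝[closure (frontier K \ lowFace K n c m s)] x → K' ∈ 𝓝[K ∩ plane n c] x) →
      f '' N ∈ 𝓝[frontier K] x := by
    intro x hx hxs hE
    obtain ⟨p, hp, rfl⟩ : x ∈ f '' C := himg ▸ h.mem_closure hx hxs.ge
    obtain ⟨U, hU, hUinj, K', hK', hUK'⟩ := hf.2 p
    obtain ⟨U', hU'U, hU'o, hpU'⟩ := _root_.mem_nhds_iff.1 hU
    refine h.image_mem_of_body hf hflat hreg hg hNc hN hNinj hp hx hxs hU hUinj hK' hUK'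
      (hE K' hK' U' hU'o ((image_mono hU'U).trans hUK') ⟨p, ⟨hp, hpU'⟩, rfl⟩ ?_)
    have h1 := image_inter_mem_nhdsWithin hf.1 isClosed_closure hCinj hp hU
    rw [himg] at h1
    exact mem_of_superset h1
      (((image_mono inter_subset_right).trans hUK').trans hK'.frontier_subset)
  have hcorner : ∀ x ∈ K ∩ plane n c, inner ℝ m x = s →
      {w : (ℝ ∙ n)ᗮ | x + w ∈ K ∩ plane n c} ∉ 𝓝 0 → f '' N ∈ 𝓝[frontier K] x :=
    fun x hx hxs hxF => key x hx hxs fun K' hK' U _ _ _ h1 =>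
      h.mem_nhdsWithin_face_of_corner hx hxs.ge hxF hK'.1 h1
  set L : Set E3 := (K ∩ plane n c) ∩ {x | inner ℝ m x = s} with hL
  have hLconn : IsPreconnected L := by
    apply Convex.isPreconnected
    exact h.convex.inter (convex_hyperplane (f := fun z => inner ℝ m z)
      ⟨fun _ _ => inner_add_right _ _ _, fun _ _ => inner_smul_right _ _ _⟩ s)
  have : PreconnectedSpace L := isPreconnected_iff_preconnectedSpace.1 hLconn
  set T : Set L := {x | f '' N ∈ 𝓝[frontier K] (x : E3)} with hT
  have hTo : IsOpen T := by
    have h1 : T = Subtype.val ⁻¹' interior {y : E3 | y ∈ frontier K → y ∈ f '' N} := by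
      ext x
      rw [hT, mem_ofPred_eq, nhdsWithin, mem_inf_principal, ← mem_interior_iff_mem_nhds]
      rfl
    rw [h1]
    exact isOpen_interior.preimage continuous_subtype_val
  have hTc : IsClosed T := by
    apply isClosed_of_closure_subset
    rintro ⟨x, hx, hxs⟩ hxT
    have hxs : inner ℝ m x = s := hxs
    by_cases hxF : {w : (ℝ ∙ n)ᗮ | x + w ∈ K ∩ plane n c} ∈ 𝓝 0
    · refine key x hx hxs fun K' hK' U hUo hUK' ⟨p, hp, hpx⟩ h1 =>
        h.mem_nhdsWithin_face_of_frequently hx hxs hxF hK'.1 h1 fun V hV => ?_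
      have hpU : f '' (C ∩ U) ∈ 𝓝[closure (frontier K \ lowFace K n c m s)] x := by
        rw [← himg, ← hpx]
        exact image_inter_mem_nhdsWithin hf.1 isClosed_closure hCinj hp.1 (hUo.mem_nhds hp.2)
      obtain ⟨V', hV'o, hxV', hV'⟩ := mem_nhdsWithin.1 hpU
      obtain ⟨⟨x₁, hx₁, hx₁s⟩, hx₁V, hx₁T⟩ := mem_closure_iff_nhds.1 hxT (Subtype.val ⁻¹' (V ∩ V'))
        (continuous_subtype_val.continuousAt.preimage_mem_nhds
          (inter_mem hV (hV'o.mem_nhds hxV')))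
      have hx₁s : inner ℝ m x₁ = s := hx₁s
      have hx₁T : f '' N ∈ 𝓝[frontier K] x₁ := hx₁T
      refine ⟨x₁, ⟨hx₁V.1, hx₁⟩, hx₁s, ?_⟩
      obtain ⟨p₁, hp₁, hp₁x⟩ := hV' ⟨hx₁V.2, h.mem_closure hx₁ hx₁s.ge⟩
      have hp₁x : f p₁ = x₁ := hp₁x
      -- Near `x₁` the image of N is all of ∂K, and the part of N mapped close to `x₁` lies in U. So
      -- F lies in K' near `x₁`.
      have h2 : f '' (N ∩ U) ∈ 𝓝[f '' N] x₁ := by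
        rw [← hp₁x]
        exact image_inter_mem_nhdsWithin hf.1 hNc hNinj (hCN hp₁.1) (hUo.mem_nhds hp₁.2)
      have h3 := nhdsWithin_le_of_mem hx₁T h2
      exact mem_of_superset (nhdsWithin_mono x₁ h.face_subset h3)
        (((image_mono inter_subset_right).trans hUK').trans hK'.frontier_subset)
    · exact hcorner x hx hxs hxF
  obtain ⟨x₀, hx₀, hx₀s, hx₀F⟩ := h.exists_corner
  have huniv := IsClopen.eq_univ ⟨hTc, hTo⟩ ⟨⟨x₀, hx₀, hx₀s⟩, hcorner x₀ hx₀ hx₀s hx₀F⟩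
  have : (⟨x, hx, hxs⟩ : L) ∈ T := huniv ▸ mem_univ _
  exact this

/-- A lift over the part of the boundary above a cut of the face extends past the cut. -/
theorem CutFace.exists_extension (h : CutFace K n c m s) (hf : IsLocallyConvexImmersion f)
    (hflat : IsLocallyNonflatAlongBoundary f) (hreg : IsRegularOnBoundary 2 f) {g : E3 → M}
    (hg : IsLift f (frontier K \ lowFace K n c m s) g) :
    ∃ s' < s, ∃ g' : E3 → M, IsLift f (frontier K \ lowFace K n c m s') g' ∧
      EqOn g' g (frontier K \ lowFace K n c m s) := by
  set C := closure (g '' (frontier K \ lowFace K n c m s)) with hC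
  -- A locally injective map that is injective on a compact set is injective on a neighborhood of
  -- it.
  obtain ⟨N₀, hN₀, hN₀inj⟩ := (h.injOn hf hg).exists_mem_nhdsSet isClosed_closure.isCompact
    (fun x _ => hf.1.continuousAt) (fun x _ => hf.locallyInjective x)
  obtain ⟨N, hN, hNc, hNN₀⟩ := exists_mem_nhdsSet_isClosed_subset hN₀ isClosed_closure
  have hNinj := hN₀inj.mono hNN₀
  have hCN : C ⊆ N := subset_of_mem_nhdsSet hN
  have hAN : frontier K \ lowFace K n c m s ⊆ f '' N := by
    rw [← hg.image_image]
    exact image_mono (subset_closure.trans hCN)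
  -- Q is the closure of the uncovered part of ∂K. It is compact and lies strictly below the cut, so
  -- its highest level of m serves as `s'`; if Q is empty, any smaller level will do.
  set Q := closure (frontier K \ f '' N) with hQ
  have hQfr : Q ⊆ frontier K := closure_minimal sdiff_subset isClosed_frontier
  have hQlow : ∀ x ∈ Q, x ∈ K ∩ plane n c ∧ inner ℝ m x < s := by
    intro x hx
    rw [hQ, mem_closure_diff_iff] at hx
    have hxfr : x ∈ frontier K := hQfr (mem_closure_diff_iff.2 hx)
    have hxlow : x ∈ lowFace K n c m s := by
      by_contra hl
      exact hx (mem_of_superset (diff_lowFace_mem_nhdsWithin h.solid ⟨hxfr, hl⟩) hAN)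
    refine ⟨hxlow.1, lt_of_le_of_ne hxlow.2 fun heq => hx ?_⟩
    exact h.image_mem hf hflat hreg hg hNc hN hNinj hxlow.1 heq
  obtain ⟨s', hs', hQs'⟩ : ∃ s' < s, ∀ x ∈ Q, inner ℝ m x ≤ s' := by
    rcases Q.eq_empty_or_nonempty with hQe | hQn
    · exact ⟨s - 1, by linarith, fun x hx => by simp [hQe] at hx⟩
    · have hQcomp : IsCompact Q :=
        h.solid.2.1.of_isClosed_subset isClosed_closure (hQfr.trans h.solid.frontier_subset)
      obtain ⟨x, hx, hmax⟩ := hQcomp.exists_isMaxOn hQn (f := fun z => inner ℝ m z) (by fun_prop)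
      exact ⟨inner ℝ m x, (hQlow x hx).2, fun y hy => hmax hy⟩
  obtain ⟨x₀, hx₀, -, hx₀s⟩ := h.exists_relint_above h.above.choose_spec.1
    h.above.choose_spec.2.le univ_mem
  have : Nonempty M := ⟨g x₀⟩
  obtain ⟨g', hg'c, hg'⟩ := exists_inverse_on_image hNc.isCompact hf.1.continuousOn hNinj
  have hA'N : frontier K \ lowFace K n c m s' ⊆ f '' N := by
    rintro x ⟨hx, hxl⟩
    by_contra hxN
    have hxQ : x ∈ Q := subset_closure ⟨hx, hxN⟩
    exact hxl ⟨(hQlow x hxQ).1, hQs' x hxQ⟩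
  refine ⟨s', hs', g', ⟨hg'c.mono hA'N, fun a ha => ?_⟩, fun a ha => ?_⟩
  · obtain ⟨x, hx, rfl⟩ := hA'N ha
    rw [hg' x hx]
  · have h1 := hg' (g a) (hCN (subset_closure ⟨a, ha, rfl⟩))
    rwa [hg.2 a ha] at h1

end extension

/-! ### Sweeping the cut across the face -/

section sweep

variable {M : Type*} [TopologicalSpace M] [T2Space M] {f : M → E3}
  {K : Set E3} {n : E3} {c : ℝ} {m : E3} {s : ℝ}

/-- A convex part of F above both cuts joins x to a point z where both lifts equal g. Lifts of a
locally injective map to a Hausdorff space that agree at one point agree on a connected set. -/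
theorem CutFace.lift_unique (hf : IsLocallyConvexImmersion f) {b s' : ℝ}
    (h : CutFace K n c m b) (hs : s ≤ b) (hs' : s' ≤ b) {g g₁ g₂ : E3 → M}
    (hg₁ : IsLift f (frontier K \ lowFace K n c m s) g₁)
    (hg₂ : IsLift f (frontier K \ lowFace K n c m s') g₂)
    (he₁ : EqOn g₁ g (frontier K \ lowFace K n c m b))
    (he₂ : EqOn g₂ g (frontier K \ lowFace K n c m b)) {x : E3}
    (hx : x ∈ frontier K \ lowFace K n c m s) (hx' : x ∈ frontier K \ lowFace K n c m s') :
    g₁ x = g₂ x := by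
  by_cases hxb : x ∈ lowFace K n c m b
  · obtain ⟨z, hz, hzb⟩ := h.above
    set J := (K ∩ plane n c) ∩ {y | max s s' < inner ℝ m y} with hJ
    have hJs : J ⊆ frontier K \ lowFace K n c m s := fun y hy =>
      ⟨h.face_subset hy.1, fun hl => not_le.2 ((le_max_left _ _).trans_lt (mem_ofPred_eq ▸ hy.2))
        hl.2⟩
    have hJs' : J ⊆ frontier K \ lowFace K n c m s' := fun y hy =>
      ⟨h.face_subset hy.1, fun hl => not_le.2 ((le_max_right _ _).trans_lt (mem_ofPred_eq ▸ hy.2))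
        hl.2⟩
    have hJconv : Convex ℝ J := h.convex.inter
      (convex_halfSpace_gt (f := fun z => inner ℝ m z) ⟨fun _ _ => inner_add_right _ _ _,
        fun _ _ => inner_smul_right _ _ _⟩ _)
    have hlt : max s s' < inner ℝ m x := max_lt
      (by by_contra hle; exact hx.2 ⟨hxb.1, not_lt.1 hle⟩)
      (by by_contra hle; exact hx'.2 ⟨hxb.1, not_lt.1 hle⟩)
    have hxJ : x ∈ J := ⟨hxb.1, hlt⟩
    have hzlt : max s s' < inner ℝ m z := (max_le hs hs').trans_lt hzb
    have hzJ : z ∈ J := ⟨hz, hzlt⟩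
    have hzA := h.mem_diff_of_lt hz hzb
    have hinj : IsLocallyInjective f := fun p => by
      obtain ⟨U, hU, hinj⟩ := hf.locallyInjective p
      obtain ⟨u, huU, hu, hpu⟩ := _root_.mem_nhds_iff.1 hU
      exact ⟨u, hu, hpu, hinj.mono huU⟩
    exact (T2Space.isSeparatedMap f).eqOn_of_comp_eqOn hinj hJconv.isPreconnected
      (hg₁.1.mono hJs) (hg₂.1.mono hJs')
      (fun y hy => by simp only [Function.comp_apply, hg₁.2 y (hJs hy), hg₂.2 y (hJs' hy)])
      hzJ ((he₁ hzA).trans (he₂ hzA).symm) hxJ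
  · rw [he₁ ⟨hx.1, hxb⟩, he₂ ⟨hx.1, hxb⟩]

variable [CompactSpace M] [ConnectedSpace M] [ChartedSpace (EuclideanHalfSpace 2) M]

/-- If `f` lifts the boundary of `K` minus the low part of a face, then the cut is proper. -/
theorem CutFace.of_isLift (hM : (bdry M).Nonempty) (hf : IsLocallyConvexImmersion f) {b : ℝ}
    (h : CutFace K n c m b) (hs : s ≤ b) {g : E3 → M}
    (hg : IsLift f (frontier K \ lowFace K n c m s) g) : CutFace K n c m s := by
  obtain ⟨z, hz, hzb⟩ := h.above
  refine ⟨h.solid, h.ne, h.side, h.relint, ?_, z, hz, hs.trans_lt hzb⟩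
  by_contra! hbelow
  -- With no point of F below level s, the low part lies on a single line of F and has no interior
  -- in ∂K.
  refine not_isLift_of_thin hM hf h.solid h.ne h.side lowFace_subset (convex_lowFace h.solid)
    (fun y hy => ?_) g hg
  have hys : inner ℝ m y ≤ s := hy.2
  exact lowFace_notMem_nhdsWithin h.solid h.ne h.side hy.1 (hbelow y hy.1) hz
    ((hys.trans hs).trans_lt hzb)

/-- A proper cut of a face admits no lift: sweeping the cut across the face would make the
surface closed. -/
theorem CutFace.not_isLift (hM : (bdry M).Nonempty) (hf : IsLocallyConvexImmersion f)
    (hflat : IsLocallyNonflatAlongBoundary f) (hreg : IsRegularOnBoundary 2 f)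
    (h : CutFace K n c m s) (g : E3 → M) :
    ¬ IsLift f (frontier K \ lowFace K n c m s) g := by
  intro hg
  set A : ℝ → Set E3 := fun t => frontier K \ lowFace K n c m t with hA
  set S : Set ℝ := {t | t ≤ s ∧ ∃ g', IsLift f (A t) g' ∧ EqOn g' g (A s)} with hS
  have hsS : s ∈ S := ⟨le_rfl, g, hg, fun _ _ => rfl⟩
  obtain ⟨z, hz, hmin⟩ : ∃ z ∈ K ∩ plane n c, ∀ y ∈ K ∩ plane n c, inner ℝ m z ≤ inner ℝ m y := by
    obtain ⟨y, hy, -⟩ := h.relint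
    obtain ⟨z, hz, hmin⟩ := (h.solid.2.1.inter_right (isClosed_plane n c)).exists_isMinOn ⟨y, hy⟩
      (f := fun z => inner ℝ m z) (by fun_prop)
    exact ⟨z, hz, fun y hy => hmin hy⟩
  have hSbdd : BddBelow S := ⟨inner ℝ m z, by
    rintro t ⟨hts, g', hg', -⟩
    obtain ⟨y, hy, hyt⟩ := (h.of_isLift hM hf hts hg').below
    exact (hmin y hy).trans hyt.le⟩
  have hlift : ∀ t : S, ∃ g', IsLift f (A t) g' ∧ EqOn g' g (A s) := fun t => t.2.2
  choose G hG hGe using hlift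
  set t₀ := sInf S with ht₀
  have ht₀s : t₀ ≤ s := csInf_le hSbdd hsS
  -- The domains `A t` with t in S exhaust `A t₀`, so the lifts, which agree on overlaps, glue to a
  -- lift at the infimum level itself.
  have hcover : ∀ x ∈ A t₀, ∃ t : S, x ∈ A t := by
    rintro x ⟨hxf, hxl⟩
    by_cases hxF : x ∈ K ∩ plane n c
    · have hlt : t₀ < inner ℝ m x := by
        by_contra hle
        exact hxl ⟨hxF, not_lt.1 hle⟩
      obtain ⟨t, htS, ht⟩ := exists_lt_of_csInf_lt ⟨s, hsS⟩ hlt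
      exact ⟨⟨t, htS⟩, hxf, fun hl => not_le.2 ht hl.2⟩
    · exact ⟨⟨s, hsS⟩, hxf, fun hl => hxF hl.1⟩
  classical
  let g₀ : E3 → M := fun x => if hx : ∃ t : S, x ∈ A t then G hx.choose x else g x
  have hg₀ : ∀ t : S, ∀ x ∈ A t, g₀ x = G t x := fun t x hx => by
    have hex : ∃ t : S, x ∈ A t := ⟨t, hx⟩
    simp only [g₀, dif_pos hex]
    exact h.lift_unique hf hex.choose.2.1 t.2.1 (hG _) (hG t) (hGe _) (hGe t)
      hex.choose_spec hx
  have hg₀lift : IsLift f (A t₀) g₀ := by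
    refine ⟨fun x hx => ?_, fun x hx => ?_⟩
    · obtain ⟨t, ht⟩ := hcover x hx
      have h1 : ContinuousWithinAt g₀ (A t) x :=
        ((hG t).1 x ht).congr (fun y hy => hg₀ t y hy) (hg₀ t x ht)
      refine h1.mono_of_mem_nhdsWithin ?_
      exact nhdsWithin_mono x sdiff_subset (diff_lowFace_mem_nhdsWithin h.solid ht)
    · obtain ⟨t, ht⟩ := hcover x hx
      rw [hg₀ t x ht, (hG t).2 x ht]
  have hg₀e : EqOn g₀ g (A s) := fun x hx =>
    (hg₀ ⟨s, hsS⟩ x hx).trans (hGe ⟨s, hsS⟩ hx)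
  -- The cut at `t₀` is still proper, so the glued lift extends to a level below the infimum.
  obtain ⟨t₁, ht₁, g₁, hg₁, hg₁e⟩ :=
    (h.of_isLift hM hf ht₀s hg₀lift).exists_extension hf hflat hreg hg₀lift
  have hsub : A s ⊆ A t₀ := fun x hx => ⟨hx.1, fun hl => hx.2 ⟨hl.1, le_trans hl.2 ht₀s⟩⟩
  have ht₁S : t₁ ∈ S :=
    ⟨ht₁.le.trans ht₀s, g₁, hg₁, fun x hx => (hg₁e (hsub hx)).trans (hg₀e hx)⟩
  exact not_le.2 ht₁ (csInf_le hSbdd ht₁S)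

end sweep

/-! ### Cutting off a convex piece by a line -/

section separation

/-- A convex piece of a face whose complement in the face is convex is cut off by a line. -/
theorem exists_cutFace {K : Set E3} (hK : IsSolidBody K) {n : E3} {c : ℝ} (hn : n ≠ 0)
    (hKc : ∀ y ∈ K, c ≤ inner ℝ n y) {B : Set E3} (hB : B ⊆ K ∩ plane n c) (hBc : Convex ℝ B)
    (hBcl : IsClosed B) (hBd : Convex ℝ ((K ∩ plane n c) \ B)) {y : E3} (hy : y ∈ B)
    (hyB : B ∈ 𝓝[frontier K] y) (hne : B ≠ K ∩ plane n c) :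
    ∃ (m : E3) (s : ℝ), CutFace K n c m s ∧ lowFace K n c m s = B := by
  rw [mem_nhdsWithin_frontier_iff_face hK hn hKc hB (hB hy).1 (hB hy).2] at hyB
  have hyp := (hB hy).2
  set B₀ := {w : (ℝ ∙ n)ᗮ | y + w ∈ B} with hB₀
  have hB₀c : Convex ℝ B₀ := convex_planar hBc
  have hD₀c : Convex ℝ {w : (ℝ ∙ n)ᗮ | y + w ∈ (K ∩ plane n c) \ B} := convex_planar hBd
  obtain ⟨φ, u, hφ, hφ'⟩ := geometric_hahn_banach_open hB₀c.interior isOpen_interior hD₀c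
    (disjoint_left.2 fun w hw hw' => hw'.2 (interior_subset hw : w ∈ B₀))
  have h0 : (0 : (ℝ ∙ n)ᗮ) ∈ interior B₀ := mem_interior_iff_mem_nhds.2 hyB
  have hu : 0 < u := by simpa using hφ 0 h0
  set m := (InnerProductSpace.toDual ℝ E3).symm
    (φ.comp ((ℝ ∙ n)ᗮ).orthogonalProjectionOnto) with hm
  have hval : ∀ z, ∀ hz : z ∈ plane n c,
      inner ℝ m z = φ ⟨z - y, sub_mem_orthogonal hz hyp⟩ + inner ℝ m y := fun z hz => by
    have h1 : ((ℝ ∙ n)ᗮ).orthogonalProjectionOnto (z - y) =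
        ⟨z - y, sub_mem_orthogonal hz hyp⟩ :=
      (ℝ ∙ n)ᗮ.orthogonalProjectionOnto_mem_subspace_eq_self
        ⟨z - y, sub_mem_orthogonal hz hyp⟩
    rw [← h1, ← sub_eq_iff_eq_add, ← inner_sub_right, hm, InnerProductSpace.toDual_symm_apply]
    rfl
  have hin : ∀ z ∈ B, inner ℝ m z ≤ inner ℝ m y + u := fun z hz => by
    have h1 : B₀ ⊆ closure (interior B₀) := by
      rw [hB₀c.closure_interior_eq_closure_of_nonempty_interior ⟨0, h0⟩]
      exact subset_closure
    have h2 : (⟨z - y, sub_mem_orthogonal (hB hz).2 hyp⟩ : (ℝ ∙ n)ᗮ) ∈ B₀ := by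
      simpa [hB₀] using hz
    have h3 : φ ⟨z - y, sub_mem_orthogonal (hB hz).2 hyp⟩ ≤ u :=
      closure_minimal (fun w hw => (hφ w hw).le)
        (isClosed_le φ.continuous continuous_const) (h1 h2)
    rw [hval z (hB hz).2]
    linarith
  have hout : ∀ z ∈ K ∩ plane n c, z ∉ B → inner ℝ m y + u ≤ inner ℝ m z := fun z hz hzB => by
    have h1 := hφ' ⟨z - y, sub_mem_orthogonal hz.2 hyp⟩
      (show y + (z - y) ∈ (K ∩ plane n c) \ B by rw [add_sub_cancel]; exact ⟨hz, hzB⟩)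
    rw [hval z hz.2]
    linarith
  have hFc : Convex ℝ (K ∩ plane n c) := hK.1.inter (convex_plane n c)
  have heq : lowFace K n c m (inner ℝ m y + u) = B := by
    apply subset_antisymm
    · rintro x ⟨hxF, hxs⟩
      have hxs : inner ℝ m x ≤ inner ℝ m y + u := hxs
      rw [← hBcl.closure_eq]
      refine mem_closure_of_tendsto (tendsto_lineMap_one y x) ?_
      filter_upwards [Ioo_mem_nhdsLT (one_pos : (0 : ℝ) < 1)] with t ht
      by_contra hnB
      have h1 := hout _ (hFc.add_smul_sub_mem (hB hy) hxF ⟨ht.1.le, ht.2.le⟩) hnB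
      rw [inner_add_right, inner_smul_right, inner_sub_right] at h1
      have := ht.1
      have := ht.2
      nlinarith
    · exact fun x hx => ⟨hB hx, hin x hx⟩
  obtain ⟨z, hz, hzB⟩ : ∃ z ∈ K ∩ plane n c, z ∉ B := by
    by_contra! hall
    exact hne (subset_antisymm hB hall)
  refine ⟨m, inner ℝ m y + u, ⟨hK, hn, hKc, ⟨y, hB hy, mem_of_superset hyB fun w hw => hB hw⟩,
    ⟨y, hB hy, by linarith⟩, ⟨z, hz, ?_⟩⟩, heq⟩
  by_contra hle
  exact hzB (heq ▸ ⟨hz, not_lt.1 hle⟩)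

end separation

/-! ### The limit body and the limit plane of nested caps -/

theorem IsNondegenerateCap.nonempty_interior_convexHull {D : Set E3} (hD : IsNondegenerateCap D) :
    (interior (convexHull ℝ D)).Nonempty := by
  obtain ⟨K, -, -, -, hK, -, -, -, hDK, -⟩ := id hD
  obtain ⟨n, c, hn, ⟨z, hz, -⟩, -, hst⟩ := hD.structure
  obtain ⟨h1, h2⟩ := hst K hK hDK
  have hconv : Convex ℝ K := hK.1
  obtain ⟨x, hxF, hx⟩ : (openCap K n c).Nonempty := closure_nonempty_iff.1 ⟨z, h2 hz⟩
  have hopen : IsOpen {y : E3 | c < inner ℝ n y} := isOpen_lt continuous_const (by fun_prop)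
  have hxcl : x ∈ closure (interior K) := by
    rw [hconv.closure_interior_eq_closure_of_nonempty_interior hK.2.2]
    exact subset_closure (hK.frontier_subset hxF)
  obtain ⟨w, hw, hwK⟩ := mem_closure_iff.1 hxcl _ hopen hx
  refine ⟨w, interior_mono (convexHull_mono h1) (mem_interior.2
    ⟨_, interior_inter_subset_convexHull_openCap hK (c := c) (n := n) ?_,
      isOpen_interior.inter hopen, hwK, hw⟩)⟩
  rintro rfl
  simp at hn

theorem IsNondegenerateCap.disjoint_interior_convexHull {D : Set E3} (hD : IsNondegenerateCap D) :
    Disjoint D (interior (convexHull ℝ D)) := by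
  obtain ⟨K, -, -, -, hK, -, -, -, hDK, -⟩ := hD
  exact disjoint_left.2 fun x hx hxi => (hDK hx).2
    (interior_mono (convexHull_min (hDK.trans hK.frontier_subset) hK.1) hxi)

theorem interior_plane_eq_empty {n : E3} (hn : n ≠ 0) (c : ℝ) : interior (plane n c) = ∅ := by
  by_contra! h
  obtain ⟨x, hx⟩ := h
  have hxp : x ∈ plane n c := interior_subset hx
  replace hxp : inner ℝ n x = c := hxp
  have : Tendsto (fun t : ℝ => x + t • n) (𝓝[>] 0) (𝓝 x) := by
    have hc : Continuous fun t : ℝ => x + t • n := by fun_prop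
    simpa using (hc.tendsto 0).mono_left nhdsWithin_le_nhds
  obtain ⟨t, ht, ht0⟩ := ((this.eventually_mem (mem_interior_iff_mem_nhds.1 hx)).and
    self_mem_nhdsWithin).exists
  have ht' : inner ℝ n (x + t • n) = c := ht
  rw [inner_add_right, inner_smul_right, hxp, real_inner_self_eq_norm_sq] at ht'
  have : 0 < t * ‖n‖ ^ 2 := mul_pos ht0 (by positivity)
  linarith

theorem IsNondegenerateCap.not_isDegenerateCap_of_subset {D D' : Set E3}
    (hD : IsNondegenerateCap D) (h : D ⊆ D') : ¬ IsDegenerateCap D' := by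
  rintro ⟨-, -, -, n, c, hn, hp⟩
  obtain ⟨x, hx⟩ := hD.nonempty_interior_convexHull
  have := interior_mono (convexHull_min (h.trans hp) (convex_plane n c)) hx
  rwa [interior_plane_eq_empty hn] at this

/-- Nested nondegenerate caps lie on the boundary of the closed convex hull of their union. -/
theorem exists_solidBody_of_monotone {D : ℕ → Set E3} (hmono : Monotone D)
    (hD : ∀ i, IsNondegenerateCap (D i)) (hb : Bornology.IsBounded (⋃ i, D i)) :
    ∃ K, IsSolidBody K ∧ (∀ i, D i ⊆ frontier K) ∧ K ⊆ closure (⋃ i, convexHull ℝ (D i)) := by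
  set V := ⋃ i, convexHull ℝ (D i) with hV
  have hdir : Monotone fun i => convexHull ℝ (D i) := fun i j hij => convexHull_mono (hmono hij)
  have hVc : Convex ℝ V := hdir.directed_le.convex_iUnion fun i => convex_convexHull ℝ _
  have hVi : (interior V).Nonempty :=
    (hD 0).nonempty_interior_convexHull.mono (interior_mono (subset_iUnion_of_subset 0 subset_rfl))
  have hVb : Bornology.IsBounded V := (isBounded_convexHull.2 hb).subset
    (iUnion_subset fun i => convexHull_mono (subset_iUnion _ i))
  have hint : interior (closure V) = interior V :=
    hVc.interior_closure_eq_interior_of_nonempty_interior hVi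
  refine ⟨closure V, ⟨hVc.closure, hVb.isCompact_closure, hVi.mono (interior_mono subset_closure)⟩,
    fun i x hx => ⟨?_, fun hxi => ?_⟩, subset_rfl⟩
  · rw [closure_closure]
    exact subset_closure (mem_iUnion.2 ⟨i, subset_convexHull ℝ _ hx⟩)
  · rw [hint] at hxi
    -- A point of a cap interior to V would be interior to a simplex with vertices in V. Finitely
    -- many vertices lie in a single hull, whereas a cap never meets the interior of its own hull.
    obtain ⟨b, hxb, hbV⟩ := exists_mem_interior_convexHull_affineBasis
      (mem_interior_iff_mem_nhds.1 hxi)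
    have hfin : ∀ k, ∃ j, b k ∈ convexHull ℝ (D j) := fun k =>
      mem_iUnion.1 (hbV (subset_convexHull ℝ _ (mem_range_self k)))
    choose j hj using hfin
    obtain ⟨N, hN⟩ := (Set.finite_range j).bddAbove
    have hsub : convexHull ℝ (range b) ⊆ convexHull ℝ (D (max N i)) := by
      refine convexHull_min (range_subset_iff.2 fun k => ?_) (convex_convexHull ℝ _)
      exact hdir ((hN (mem_range_self k)).trans (le_max_left _ _)) (hj k)
    exact disjoint_left.1 (hD (max N i)).disjoint_interior_convexHull
      (hmono (le_max_right _ _) hx) (interior_mono hsub hxb)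

/-- A limit of the planes cutting off nested caps supports the limit body. -/
theorem exists_limit_plane {D : ℕ → Set E3} (hmono : Monotone D)
    (hb : Bornology.IsBounded (⋃ i, D i)) {K : Set E3}
    (hK : K ⊆ closure (⋃ i, convexHull ℝ (D i))) {n : ℕ → E3} {c : ℕ → ℝ} (hn : ∀ i, ‖n i‖ = 1)
    (hz : ∀ i, ∃ z ∈ D i, inner ℝ (n i) z = c i) (hc : ∀ i, ∀ z ∈ D i, c i ≤ inner ℝ (n i) z) :
    ∃ (n₀ : E3) (c₀ : ℝ), ‖n₀‖ = 1 ∧ (∀ z ∈ K, c₀ ≤ inner ℝ n₀ z) ∧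
      ∀ x, (∀ i, inner ℝ (n i) x ≤ c i) → inner ℝ n₀ x ≤ c₀ := by
  obtain ⟨R, hR⟩ := hb.exists_norm_le
  have hcR : ∀ i, c i ∈ Icc (-R) R := fun i => by
    obtain ⟨z, hzD, hzc⟩ := hz i
    refine abs_le.1 ?_
    rw [← hzc]
    calc |inner ℝ (n i) z| ≤ ‖n i‖ * ‖z‖ := abs_real_inner_le_norm _ _
      _ ≤ R := by rw [hn, one_mul]; exact hR z (mem_iUnion.2 ⟨i, hzD⟩)
  -- Unit normals and bounded offsets have a convergent subsequence. A fixed cap lies on the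
  -- positive side of all later planes, hence of the limit plane.
  obtain ⟨⟨n₀, c₀⟩, ⟨h1, -⟩, φ, hφ, hlim⟩ :=
    ((isCompact_sphere (0 : E3) 1).prod (isCompact_Icc (a := -R) (b := R))).tendsto_subseq
      (x := fun i => (n i, c i)) fun i => ⟨by simp [hn i], hcR i⟩
  have hnl : Tendsto (fun k => n (φ k)) atTop (𝓝 n₀) := (continuous_fst.tendsto _).comp hlim
  have hcl : Tendsto (fun k => c (φ k)) atTop (𝓝 c₀) := (continuous_snd.tendsto _).comp hlim
  have hinner : ∀ x, Tendsto (fun k => inner ℝ (n (φ k)) x) atTop (𝓝 (inner ℝ n₀ x)) :=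
    fun x => hnl.inner tendsto_const_nhds
  refine ⟨n₀, c₀, by simpa using h1, ?_, fun x hx =>
    le_of_tendsto_of_tendsto' (hinner x) hcl fun k => hx _⟩
  have hcl' : IsClosed {z : E3 | c₀ ≤ inner ℝ n₀ z} := isClosed_le continuous_const (by fun_prop)
  have hcv : Convex ℝ {z : E3 | c₀ ≤ inner ℝ n₀ z} :=
    convex_halfSpace_ge (f := fun z => inner ℝ n₀ z) ⟨fun _ _ => inner_add_right _ _ _,
        fun _ _ => inner_smul_right _ _ _⟩ _
  have : K ⊆ {z : E3 | c₀ ≤ inner ℝ n₀ z} := by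
    refine hK.trans (closure_minimal (iUnion_subset fun i => convexHull_min (fun z hzi => ?_) hcv)
      hcl')
    refine le_of_tendsto_of_tendsto hcl (hinner z) ?_
    filter_upwards [eventually_ge_atTop i] with k hk
    exact hc _ z (hmono (hk.trans (hφ.id_le k)) hzi)
  exact this

theorem injOn_iUnion_of_monotone {X Y : Type*} {f : X → Y} {C : ℕ → Set X} (hmono : Monotone C) (h : ∀ i, InjOn f (C i)) :
    InjOn f (⋃ i, C i) := by
  intro x hx y hy hxy
  obtain ⟨i, hi⟩ := mem_iUnion.1 hx
  obtain ⟨j, hj⟩ := mem_iUnion.1 hy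
  exact h _ (hmono (le_max_left i j) hi) (hmono (le_max_right i j) hj) hxy

/-! ### Nested caps in the surface -/

section caps

variable {M : Type*} [TopologicalSpace M] {f : M → E3}

/-- A nested sequence of degenerate caps is eventually constant. -/
theorem isCap_closure_iUnion_of_degenerate {C : ℕ → Set M} (hmono : Monotone C)
    (hC : ∀ i, IsCap f (C i)) (hdeg : ∀ i, IsDegenerateCap (f '' C i)) :
    IsCap f (closure (⋃ i, C i)) := by
  -- An increasing chain of direction spaces stabilizes, so all later caps map into any plane
  -- containing the image of the N-th one.
  obtain ⟨N, hN⟩ := monotone_stabilizes_iff_noetherian.2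
    (inferInstance : IsNoetherian ℝ E3) ⟨fun i => vectorSpan ℝ (f '' C i),
      fun i j hij => vectorSpan_mono ℝ (image_mono (hmono hij))⟩
  obtain ⟨n, c, U, hn, hCp, hU, hCU, hdisj⟩ := (hC N).2.2.2.2 (hdeg N)
  obtain ⟨p₀, hp₀⟩ := (hC N).2.1.nonempty
  have hle : vectorSpan ℝ (f '' C N) ≤ (ℝ ∙ n)ᗮ := by
    refine Submodule.span_le.2 ?_
    rintro _ ⟨x, hx, y, hy, rfl⟩
    refine Submodule.mem_orthogonal_singleton_iff_inner_right.2 ?_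
    have hx' : inner ℝ n x = c := hCp hx
    have hy' : inner ℝ n y = c := hCp hy
    change inner ℝ n (x - y) = 0
    rw [inner_sub_right, hx', hy', sub_self]
  have key : ∀ j, C j ⊆ C N := by
    intro j
    rcases le_total j N with hj | hj
    · exact hmono hj
    have hpl : ∀ p ∈ C j, inner ℝ n (f p) = c := by
      intro p hp
      have hmem : f p - f p₀ ∈ vectorSpan ℝ (f '' C j) :=
        vsub_mem_vectorSpan ℝ (mem_image_of_mem f hp) (mem_image_of_mem f (hmono hj hp₀))
      have heq : vectorSpan ℝ (f '' C N) = vectorSpan ℝ (f '' C j) := hN j hj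
      rw [← heq] at hmem
      have h0 := Submodule.mem_orthogonal_singleton_iff_inner_right.1 (hle hmem)
      have h1 : inner ℝ n (f p₀) = c := hCp (mem_image_of_mem f hp₀)
      rw [inner_sub_right, h1] at h0
      linarith
    have hout : ∀ p ∈ C j, p ∈ U → p ∈ C N := by
      intro p hp hpU
      by_contra hpN
      have hle' : c ≤ inner ℝ n (f p) := (hpl p hp).ge
      exact disjoint_left.1 hdisj (mem_image_of_mem f ⟨hpU, hpN⟩) hle'
    -- Condition (ii) allows no point of `C j` in `U \ C N`. The connected set `C j` is thus split
    -- by U and the complement of `C N`, and it meets U.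
    have hpre := isPreconnected_iff_subset_of_disjoint.1 (hC j).2.1.isPreconnected U (C N)ᶜ hU
      (hC N).1.isOpen_compl
      (fun p _ => by by_cases hp : p ∈ C N; exacts [Or.inl (hCU hp), Or.inr hp])
      (by
        ext p
        simp only [mem_inter_iff, mem_compl_iff, mem_empty_iff_false, iff_false]
        rintro ⟨hp, hpU, hpN⟩
        exact hpN (hout p hp hpU))
    rcases hpre with h | h
    · exact fun p hp => hout p hp (h hp)
    · exact absurd hp₀ (h (hmono hj hp₀))
  have : ⋃ i, C i = C N := subset_antisymm (iUnion_subset key) (subset_iUnion _ N)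
  rw [this, (hC N).1.closure_eq]
  exact hC N

/-- The inverse of an injective map on nested compact sets lifts the relative interiors of their
images. -/
theorem exists_isLift_of_monotone [CompactSpace M] [T2Space M] {C : ℕ → Set M} (hf : Continuous f)
    (hmono : Monotone C) (hcl : ∀ i, IsClosed (C i)) (hne : (C 0).Nonempty)
    (hinj : ∀ i, InjOn f (C i)) {S : Set E3} {O : ℕ → Set E3} (hO : ∀ i, IsOpen (O i))
    (hOC : ∀ i, S ∩ O i ⊆ f '' C i) (hCO : ∀ i, f '' C i ⊆ closure (S ∩ O i)) :
    ∃ g, IsLift f (⋃ i, S ∩ O i) g ∧ closure (g '' ⋃ i, S ∩ O i) = closure (⋃ i, C i) := by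
  obtain ⟨p₀, -⟩ := hne
  have : Nonempty M := ⟨p₀⟩
  have hinjU := injOn_iUnion_of_monotone hmono hinj
  set g := Function.invFunOn f (⋃ i, C i) with hg
  have hgf : ∀ i, ∀ p ∈ C i, g (f p) = p := fun i p hp =>
    hinjU.leftInvOn_invFunOn (mem_iUnion.2 ⟨i, hp⟩)
  have hgc : ∀ i, ContinuousOn g (f '' C i) := by
    intro i
    obtain ⟨g', hg', hgf'⟩ := exists_inverse_on_image (hcl i).isCompact hf.continuousOn (hinj i)
    refine hg'.congr ?_
    rintro _ ⟨p, hp, rfl⟩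
    rw [hgf i p hp, hgf' p hp]
  refine ⟨g, ⟨fun x hx => ?_, fun x hx => ?_⟩, subset_antisymm (closure_mono ?_)
    (closure_minimal (iUnion_subset fun i p hp => ?_) isClosed_closure)⟩
  · obtain ⟨i, hi⟩ := mem_iUnion.1 hx
    refine ((hgc i x (hOC i hi)).mono (hOC i)).mono_of_mem_nhdsWithin ?_
    filter_upwards [self_mem_nhdsWithin, nhdsWithin_le_nhds ((hO i).mem_nhds hi.2)] with y hy hyO
    obtain ⟨j, hj⟩ := mem_iUnion.1 hy
    exact ⟨hj.1, hyO⟩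
  · obtain ⟨i, hi⟩ := mem_iUnion.1 hx
    obtain ⟨p, hp, rfl⟩ := hOC i hi
    rw [hgf i p hp]
  · rintro _ ⟨x, hx, rfl⟩
    obtain ⟨i, hi⟩ := mem_iUnion.1 hx
    obtain ⟨p, hp, rfl⟩ := hOC i hi
    rw [hgf i p hp]
    exact mem_iUnion.2 ⟨i, hp⟩
  · have h1 := ((hgc i _ (mem_image_of_mem f hp)).mono (hOC i)).mem_closure_image
      (hCO i (mem_image_of_mem f hp))
    rw [hgf i p hp] at h1
    exact closure_mono (image_mono (subset_iUnion (fun i => S ∩ O i) i)) h1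

variable [T2Space M] [CompactSpace M] [ConnectedSpace M] [ChartedSpace (EuclideanHalfSpace 2) M]

theorem isCap_closure_iUnion_of_nondegenerate (hM : (bdry M).Nonempty)
    (hf : IsLocallyConvexImmersion f) (hflat : IsLocallyNonflatAlongBoundary f)
    (hreg : IsRegularOnBoundary 2 f) {C : ℕ → Set M} (hmono : Monotone C)
    (hC : ∀ i, IsCap f (C i)) (hnd : ∀ i, IsNondegenerateCap (f '' C i)) :
    IsCap f (closure (⋃ i, C i)) := by
  have hDmono : Monotone fun i => f '' C i := fun i j hij => image_mono (hmono hij)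
  have hb : Bornology.IsBounded (⋃ i, f '' C i) :=
    (isCompact_range hf.1).isBounded.subset (iUnion_subset fun i => image_subset_range f _)
  obtain ⟨K, hK, hDK, hKcl⟩ := exists_solidBody_of_monotone hDmono hnd hb
  choose n c hn hz hc hst using fun i => (hnd i).structure
  obtain ⟨n₀, c₀, hn₀, hKc, hlim⟩ := exists_limit_plane hDmono hb hKcl hn hz hc
  have hn₀' : n₀ ≠ 0 := by rintro rfl; simp at hn₀
  have hKconv : Convex ℝ K := hK.1
  obtain ⟨g, hg, hgC⟩ := exists_isLift_of_monotone hf.1 hmono (fun i => (hC i).1)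
    (hC 0).2.1.nonempty (fun i => (hC i).2.2.1) (S := frontier K)
    (O := fun i => {y | c i < inner ℝ (n i) y})
    (fun i => isOpen_lt continuous_const (by fun_prop)) (fun i => (hst i K hK (hDK i)).1)
    (fun i => (hst i K hK (hDK i)).2)
  -- The part of K beyond none of the cutting planes; the caps lift exactly ∂K \ B.
  set B := K ∩ {x | ∀ i, inner ℝ (n i) x ≤ c i} with hB
  have hnotB : ∀ x ∈ K, x ∉ B ↔ ∃ i, c i < inner ℝ (n i) x := fun x hx => by
    refine ⟨fun h => ?_, fun ⟨i, hi⟩ h => not_le.2 hi (h.2 i)⟩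
    by_contra! hle
    exact h ⟨hx, hle⟩
  have hA : ⋃ i, frontier K ∩ {y | c i < inner ℝ (n i) y} = frontier K \ B := by
    ext x
    refine ⟨fun h => ?_, fun h => ?_⟩
    · obtain ⟨i, hxF, hi⟩ := mem_iUnion.1 h
      exact ⟨hxF, (hnotB x (hK.frontier_subset hxF)).2 ⟨i, hi⟩⟩
    · obtain ⟨i, hi⟩ := (hnotB x (hK.frontier_subset h.1)).1 h.2
      exact mem_iUnion.2 ⟨i, h.1, hi⟩
  rw [hA] at hg hgC
  have hBF : B ⊆ K ∩ plane n₀ c₀ := fun x hx => ⟨hx.1, (hlim x hx.2).antisymm (hKc x hx.1)⟩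
  have hBset : {x : E3 | ∀ i, inner ℝ (n i) x ≤ c i} = ⋂ i, {x | inner ℝ (n i) x ≤ c i} := by
    ext x; simp
  have hBconv : Convex ℝ B := by
    refine hKconv.inter ?_
    rw [hBset]
    exact convex_iInter fun i => convex_halfSpace_le (f := fun z => inner ℝ (n i) z)
      ⟨fun _ _ => inner_add_right _ _ _, fun _ _ => inner_smul_right _ _ _⟩ _
  have hBcl : IsClosed B := by
    refine hK.isClosed.inter ?_
    rw [hBset]
    exact isClosed_iInter fun i => isClosed_le (by fun_prop) continuous_const
  by_cases hthin : ∀ y ∈ B, B ∉ 𝓝[frontier K] y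
  · exact absurd hg (not_isLift_of_thin hM hf hK hn₀' hKc hBF hBconv hthin g)
  push Not at hthin
  obtain ⟨y, hyB, hy⟩ := hthin
  by_cases hBeq : B = K ∩ plane n₀ c₀
  · have hfC : f '' closure (⋃ i, C i) = closure (frontier K \ (K ∩ plane n₀ c₀)) := by
      rw [← hgC, hg.image_closure hf.1, hBeq]
    have hcap : IsNondegenerateCap (f '' closure (⋃ i, C i)) := by
      rw [hfC]
      exact isNondegenerateCap_of_face hK hn₀ hKc (hBF hyB) (hBeq ▸ hy)
    refine ⟨isClosed_closure, ⟨?_, ?_⟩, ?_, Or.inl hcap,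
      fun h => absurd h (hcap.not_isDegenerateCap_of_subset subset_rfl)⟩
    · exact ((hC 0).2.1.nonempty.mono (subset_iUnion _ 0)).closure
    · obtain ⟨p, hp⟩ := (hC 0).2.1.nonempty
      exact (isPreconnected_iUnion ⟨p, mem_iInter.2 fun i => hmono (Nat.zero_le i) hp⟩
        fun i => (hC i).2.1.isPreconnected).closure
    · rw [← hgC]
      exact injOn_closure_lift hf.1 hf.locallyInjective hK hn₀' hKc hBF hBconv hyB hy hg
  -- A point of F beyond the i-th plane belongs to the i-th cap, hence to the j-th one, and so is
  -- weakly beyond the j-th plane. Mixing it with a point strictly beyond the j-th plane stays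
  -- strictly beyond, which makes F \ B convex.
  · have hcomb : ∀ i j, i ≤ j → ∀ x ∈ K ∩ plane n₀ c₀, c i < inner ℝ (n i) x → ∀ z,
        c j < inner ℝ (n j) z → ∀ a b : ℝ, 0 < a → 0 < b → a + b = 1 →
        c j < inner ℝ (n j) (a • x + b • z) := by
      intro i j hij x hx hxi z hzj a b ha hb hab
      have hxj := hc j x (hDmono hij
        ((hst i K hK (hDK i)).1 ⟨face_subset_frontier hn₀' hKc hx, hxi⟩))
      rw [inner_add_right, inner_smul_right, inner_smul_right]
      have h1 := mul_le_mul_of_nonneg_left hxj ha.le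
      have h2 := mul_lt_mul_of_pos_left hzj hb
      have h3 : a * c j + b * c j = c j := by rw [← add_mul, hab, one_mul]
      linarith
    have hdiff : Convex ℝ ((K ∩ plane n₀ c₀) \ B) := by
      refine convex_iff_forall_pos.2 fun x hx z hz a b ha hb hab => ?_
      have hF := (hKconv.inter (convex_plane n₀ c₀)) hx.1 hz.1 ha.le hb.le hab
      obtain ⟨i, hi⟩ := (hnotB x hx.1.1).1 hx.2
      obtain ⟨j, hj⟩ := (hnotB z hz.1.1).1 hz.2
      refine ⟨hF, (hnotB _ hF.1).2 ?_⟩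
      rcases le_total i j with hij | hij
      · exact ⟨j, hcomb i j hij x hx.1 hi z hj a b ha hb hab⟩
      · rw [add_comm]
        exact ⟨i, hcomb j i hij z hz.1 hj x hi b a hb ha (by rwa [add_comm])⟩
    obtain ⟨m, s, hcut, hlow⟩ := exists_cutFace hK hn₀' hKc hBF hBconv hBcl hdiff hyB hy hBeq
    rw [← hlow] at hg
    exact absurd hg (hcut.not_isLift hM hf hflat hreg g)

theorem isCap_closure_iUnion (hM : (bdry M).Nonempty) (hf : IsLocallyConvexImmersion f)
    (hflat : IsLocallyNonflatAlongBoundary f) (hreg : IsRegularOnBoundary 2 f) {C : ℕ → Set M}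
    (hmono : Monotone C) (hC : ∀ i, IsCap f (C i)) : IsCap f (closure (⋃ i, C i)) := by
  by_cases h : ∀ i, IsDegenerateCap (f '' C i)
  · exact isCap_closure_iUnion_of_degenerate hmono hC h
  push Not at h
  obtain ⟨N, hN⟩ := h
  have hnd := (hC N).2.2.2.1.resolve_right hN
  -- Once one cap is nondegenerate no later one is degenerate, and dropping the earlier caps does
  -- not change the union.
  have hshift : ⋃ i, C i = ⋃ i, C (N + i) := subset_antisymm
    (iUnion_subset fun i => (hmono (Nat.le_add_left i N)).trans (subset_iUnion (fun i => C (N + i)) i))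
    (iUnion_subset fun i => subset_iUnion C _)
  rw [hshift]
  refine isCap_closure_iUnion_of_nondegenerate hM hf hflat hreg
    (fun i j hij => hmono (Nat.add_le_add_left hij N)) (fun i => hC _) fun i => ?_
  exact (hC (N + i)).2.2.2.1.resolve_right
    (hnd.not_isDegenerateCap_of_subset (image_mono (hmono (Nat.le_add_right N i))))

end caps

end ConvexCaps

theorem mainTheorem9 {M : Type*} [TopologicalSpace M] [T2Space M] [CompactSpace M]
    [ConnectedSpace M] [ChartedSpace (EuclideanHalfSpace 2) M]
    (hM : (ConvexCaps.bdry M).Nonempty)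
    (f : M → ConvexCaps.E3)
    (hf : ConvexCaps.IsLocallyConvexImmersion f)
    (hflat : ConvexCaps.IsLocallyNonflatAlongBoundary f)
    (hreg : ConvexCaps.IsRegularOnBoundary 2 f)
    (hinf : ConvexCaps.HasNoInflections f)
    (C : ℕ → Set M)
    (hC : ∀ i, ConvexCaps.IsCap f (C i))
    (hnested : ∀ i, C i ⊆ C (i + 1)) :
    ConvexCaps.IsCap f (closure (⋃ i, C i)) :=
  ConvexCaps.isCap_closure_iUnion hM hf hflat hreg (monotone_nat_of_le_succ hnested) hC
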